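/- Let $\mathrm{Diff}^2_+(\mathbb S^1)$ be the group of orientation-preserving $C^2$-diffeomorphisms of the unit circle $\mathbb S^1\subset\mathbb C$, with the topology of uniform convergence of the maps and of their first and second derivatives; it is a Banach manifold modeled on the real $C^2$ vector fields on $\mathbb S^1$. Let $e=\mathrm{id}_{\mathbb S^1}$ and let $\mathcal U\subset\mathrm{Diff}^2_+(\mathbb S^1)$ be a connected open neighbourhood of $e$. For $m\in\mathbb Z$ let $L_m$ be the complex vector field $(L_m)_\gamma:\xi\mapsto\gamma(\xi)^{m+1}$ on $\mathrm{Diff}^2_+(\mathbb S^1)$; for a $C^1$ function $\Phi$ on $\mathcal U$, $(L_m\cdot\Phi)(\gamma)$ denotes the complex-linear extension of the differential $d\Phi_\gamma$ applied to $(L_m)_\gamma$. Let $N\ge 0$ and let $A:\mathbb S^1\times\mathcal U\to M_N(\mathbb C)$ be $C^1$ in $(\xi,\gamma)$, with $\oint_{\mathbb S^1}A(\xi,\gamma)\,d\xi=0$ for all $\gamma\in\mathcal U$. For $x\in\mathbb P^1\setminus\mathbb S^1$ put $$\mathcal A(x,\gamma)=\frac1{2i\pi}\oint_{\mathbb S^1}\frac{A(\xi,\gamma)}{\xi-x}\,d\xi,\qquad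 B_k(\gamma)=-\frac1{2i\pi}\oint_{\mathbb S^1}\xi^kA(\xi,\gamma)\,d\xi\quad(k\in\mathbb Z)$$ (a Cauchy integral takes the value $0$ at $x=\infty$). Let $Y:(\mathbb P^1\setminus\mathbb S^1)\times\mathcal U\to GL_N(\mathbb C)$ be a fundamental solution of the systems $\frac{dY}{dx}=\mathcal A(x,\gamma)Y$, i.e. $Y(\cdot,\gamma)$ is analytic on $\mathbb P^1\setminus\mathbb S^1$ and satisfies the system for every $\gamma\in\mathcal U$, such that $Y(x,\cdot)$ is $C^1$ on $\mathcal U$ for every $x$, and $Y(\infty,\gamma)=I_N$ for all $\gamma\in\mathcal U$. Write $Y^+(\xi,\gamma)$ and $Y^-(\xi,\gamma)$ for the limits of $Y(x,\gamma)$ as $x\to\xi\in\mathbb S^1$ with $|x|<1$ and $|x|>1$ respectively, and $G=(Y^-)^{-1}Y^+$ for the monodromy. $Y$ is called $M$-invariant if these limits exist and are invertible and $G(\xi,\gamma)=G(\gamma^{-1}(\xi),e)$ for all $(\xi,\gamma)\in\mathbb S^1\times\mathcal U$. Put $\Omega_m(x,\gamma)=(L_m\cdot Y(x,\gamma))\,Y(x,\gamma)^{-1}$.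 Then: 1. $Y$ is $M$-invariant if and only if $$\Omega_m(x,\gamma)=-\frac1{2i\pi}\oint_{\mathbb S^1}\frac{\xi^{m+1}A(\xi,\gamma)}{\xi-x}\,d\xi\qquad(*)$$ for all $m\in\mathbb Z$, $x\in\mathbb P^1\setminus\mathbb S^1$ and $\gamma\in\mathcal U$. 2. For all $m\in\mathbb Z$ and $\gamma\in\mathcal U$, $(*)$ holds for all $x\in\mathbb P^1\setminus\mathbb S^1$ if and only if $$\Omega_m(x,\gamma)=-\sum_{n\ge1}\frac{B_{m+n}(\gamma)}{x^n}\ \text{ for }1<|x|<\infty,\qquad \Omega_m(x,\gamma)=\sum_{n\ge0}B_{m-n}(\gamma)x^n\ \text{ for }|x|<1.$$ 3. For all $\gamma\in\mathcal U$, the $B_k$ are the coefficients of the expansions of $\mathcal A$: $\mathcal A(x,\gamma)=\sum_{n\ge0}B_n(\gamma)x^{-n-1}$ for $1<|x|<\infty$ and $\mathcal A(x,\gamma)=-\sum_{n\ge1}B_{-n}(\gamma)x^{n-1}$ for $|x|<1$. -/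

import Mathlib

open scoped Topology OnePoint BoundedContinuousFunction

noncomputable section

namespace UnivSchlesinger

/-! ### The group of orientation preserving `C²`-diffeomorphisms of the circle -/

/-- The Banach space of real `C²` vector fields `u(θ) ∂_θ` on the unit circle, i.e. of `2π`-periodic
`C²` functions `u : ℝ → ℝ`, with the `C²` norm `max (‖u‖_∞, ‖u'‖_∞, ‖u''‖_∞)`.
An element is stored as the triple `(u, u', u'')`. -/
def vect2Submodule : Submodule ℝ ((ℝ →ᵇ ℝ) × (ℝ →ᵇ ℝ) × (ℝ →ᵇ ℝ)) where
  carrier := {f | Function.Periodic f.1 (2 * Real.pi) ∧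
    (∀ θ, HasDerivAt f.1 (f.2.1 θ) θ) ∧ (∀ θ, HasDerivAt f.2.1 (f.2.2 θ) θ)}
  add_mem' := by
    rintro f g ⟨hf, hf1, hf2⟩ ⟨hg, hg1, hg2⟩
    exact ⟨hf.add hg, fun θ => (hf1 θ).add (hg1 θ), fun θ => (hf2 θ).add (hg2 θ)⟩
  zero_mem' := ⟨fun _ => rfl, fun θ => hasDerivAt_const θ (0 : ℝ), fun θ => hasDerivAt_const θ (0 : ℝ)⟩
  smul_mem' := by
    rintro c f ⟨hf, hf1, hf2⟩
    exact ⟨fun θ => congrArg (c * ·) (hf θ), fun θ => (hf1 θ).const_mul c,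
      fun θ => (hf2 θ).const_mul c⟩

/-- The Banach space of real `C²` vector fields on the unit circle, as a type. -/
def Vect2 : Type := vect2Submodule

instance : NormedAddCommGroup Vect2 := inferInstanceAs (NormedAddCommGroup vect2Submodule)

instance : NormedSpace ℝ Vect2 := inferInstanceAs (NormedSpace ℝ vect2Submodule)

namespace Vect2

/-- The function `u`. -/
def disp (u : Vect2) : ℝ → ℝ := u.1.1

/-- The derivative `u'`. -/
def deriv1 (u : Vect2) : ℝ → ℝ := u.1.2.1

/-- The second derivative `u''`. -/
def deriv2 (u : Vect2) : ℝ → ℝ := u.1.2.2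

theorem periodic (u : Vect2) : Function.Periodic u.disp (2 * Real.pi) := u.2.1

theorem hasDerivAt_disp (u : Vect2) (θ : ℝ) : HasDerivAt u.disp (u.deriv1 θ) θ := u.2.2.1 θ

theorem hasDerivAt_deriv1 (u : Vect2) (θ : ℝ) : HasDerivAt u.deriv1 (u.deriv2 θ) θ := u.2.2.2 θ

theorem contDiff_disp (u : Vect2) : ContDiff ℝ 2 u.disp := by
  have h1 : deriv u.disp = u.deriv1 := funext fun θ => (u.hasDerivAt_disp θ).deriv
  have h2 : deriv u.deriv1 = u.deriv2 := funext fun θ => (u.hasDerivAt_deriv1 θ).deriv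
  have c2 : Continuous u.deriv2 := u.1.2.2.continuous
  rw [show (2 : WithTop ℕ∞) = 1 + 1 by norm_num, contDiff_succ_iff_deriv]
  refine ⟨fun θ => (u.hasDerivAt_disp θ).differentiableAt, by simp, ?_⟩
  rw [h1, contDiff_one_iff_deriv, h2]
  exact ⟨fun θ => (u.hasDerivAt_deriv1 θ).differentiableAt, c2⟩

theorem periodic_deriv {f : ℝ → ℝ} {c : ℝ} (hp : Function.Periodic f c) :
    Function.Periodic (deriv f) c := by
  intro x
  rw [← deriv_comp_add_const f c x]
  exact congrArg (fun g => deriv g x) (funext hp)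

/-- A continuous `2π`-periodic function as a bounded continuous function. -/
def toBounded (f : ℝ → ℝ) (hf : Continuous f) (hp : Function.Periodic f (2 * Real.pi)) : ℝ →ᵇ ℝ :=
  ⟨⟨f, hf⟩, by
    obtain ⟨C, hC⟩ := Metric.isBounded_iff.1
      (hp.isBounded_of_continuous (by positivity) hf)
    exact ⟨C, fun x y => hC ⟨x, rfl⟩ ⟨y, rfl⟩⟩⟩

/-- A `2π`-periodic `C²` function as an element of the Banach space `Vect2`. -/
def ofContDiff (f : ℝ → ℝ) (hf : ContDiff ℝ 2 f) (hp : Function.Periodic f (2 * Real.pi)) : Vect2 :=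
  have h : ContDiff ℝ 1 (deriv f) := ((contDiff_succ_iff_deriv (n := 1)).1 hf).2.2
  ⟨(toBounded f hf.continuous hp,
    toBounded (deriv f) h.continuous (periodic_deriv hp),
    toBounded (deriv (deriv f)) (contDiff_one_iff_deriv.1 h).2
      (periodic_deriv (periodic_deriv hp))),
    hp,
    fun θ => (hf.differentiable (by norm_num) θ).hasDerivAt,
    fun θ => (h.differentiable (by norm_num) θ).hasDerivAt⟩

/-- `u` is an admissible displacement: `θ ↦ θ + u(θ)` has everywhere positive derivative. -/
def Admissible (u : Vect2) : Prop := ∀ θ, 0 < 1 + u.deriv1 θ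

theorem lift_periodic (u : Vect2) (θ : ℝ) (n : ℤ) :
    u.disp (θ + n * (2 * Real.pi)) = u.disp θ := by
  have := u.periodic.int_mul n θ
  simpa using this

theorem lift_strictMono {u : Vect2} (hu : u.Admissible) : StrictMono fun θ => θ + u.disp θ := by
  refine strictMono_of_deriv_pos fun θ => ?_
  have h : HasDerivAt (fun θ => θ + u.disp θ) (1 + u.deriv1 θ) θ :=
    (hasDerivAt_id θ).add (u.hasDerivAt_disp θ)
  rw [h.deriv]
  exact hu θ

theorem lift_surjective (u : Vect2) : Function.Surjective fun θ => θ + u.disp θ := by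
  have hb : ∀ θ, |u.disp θ| ≤ ‖u.1.1‖ := fun θ => u.1.1.norm_coe_le_norm θ
  refine Continuous.surjective (continuous_id.add u.1.1.continuous) ?_ ?_
  · refine Filter.tendsto_atTop_mono (f := fun θ => θ + -‖u.1.1‖) (fun θ => ?_)
      (Filter.tendsto_atTop_add_const_right _ _ Filter.tendsto_id)
    have := (abs_le.1 (hb θ)).1
    show θ + _ ≤ θ + u.disp θ
    linarith
  · refine Filter.tendsto_atBot_mono (f := fun θ => θ + ‖u.1.1‖) (g := fun θ => θ + u.disp θ)
      (fun θ => ?_)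
      (Filter.tendsto_atBot_add_const_right _ _ Filter.tendsto_id)
    have := (abs_le.1 (hb θ)).2
    show θ + u.disp θ ≤ θ + _
    linarith

/-- The circle map `e^{iθ} ↦ e^{i(θ + u(θ))}`. -/
def circleFun (u : Vect2) (z : Circle) : Circle :=
  Circle.exp (Complex.arg z + u.disp (Complex.arg z))

theorem circleFun_exp (u : Vect2) (θ : ℝ) :
    u.circleFun (Circle.exp θ) = Circle.exp (θ + u.disp θ) := by
  obtain ⟨n, hn⟩ := Circle.exp_eq_exp.1 (Circle.exp_arg (Circle.exp θ))
  unfold circleFun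
  rw [hn, lift_periodic]
  exact Circle.exp_eq_exp.2 ⟨n, by ring⟩

theorem circleFun_bijective {u : Vect2} (hu : u.Admissible) : Function.Bijective u.circleFun := by
  constructor
  · intro z w h
    obtain ⟨a, rfl⟩ := Circle.exp_surjective z
    obtain ⟨b, rfl⟩ := Circle.exp_surjective w
    rw [circleFun_exp, circleFun_exp] at h
    obtain ⟨n, hn⟩ := Circle.exp_eq_exp.1 h
    refine Circle.exp_eq_exp.2 ⟨n, (lift_strictMono hu).injective ?_⟩
    show a + u.disp a = b + n * (2 * Real.pi) + u.disp (b + n * (2 * Real.pi))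
    rw [lift_periodic, hn]
    ring
  · intro w
    obtain ⟨b, rfl⟩ := Circle.exp_surjective w
    obtain ⟨a, rfl⟩ := u.lift_surjective b
    exact ⟨Circle.exp a, circleFun_exp u a⟩

end Vect2

/-- An orientation preserving `C²`-diffeomorphism of the unit circle: a bijection `γ` of the circle
of the form `γ(e^{iθ}) = e^{i(θ + u(θ))}`, with `u` of class `C²`, `2π`-periodic and `1 + u' > 0`. -/
structure CircleDiff where
  toEquiv : Circle ≃ Circle
  exists_lift : ∃ u : Vect2, u.Admissible ∧
    ∀ θ : ℝ, toEquiv (Circle.exp θ) = Circle.exp (θ + u.disp θ)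

namespace CircleDiff

/-- The neutral element `e = id`. -/
instance : One CircleDiff where
  one := ⟨Equiv.refl Circle, 0, fun θ => by
    show (0 : ℝ) < 1 + 0
    norm_num, fun θ => by
    show Circle.exp θ = Circle.exp (θ + 0)
    rw [add_zero]⟩

/-- The topology of uniform convergence of the maps `γ` and of their first and second derivatives
(with respect to the angle `θ`). -/
instance : TopologicalSpace CircleDiff :=
  TopologicalSpace.induced
    (fun γ => fun k : Fin 3 => UniformFun.ofFun
      (iteratedDeriv k fun θ : ℝ => ((γ.toEquiv (Circle.exp θ) : Circle) : ℂ)))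
    inferInstance

/-- A displacement `u` of `γ`: `γ(e^{iθ}) = e^{i(θ + u(θ))}`; it is unique up to a constant in `2πℤ`,
and the choice is irrelevant below. -/
def lift (γ : CircleDiff) : Vect2 := γ.exists_lift.choose

open Classical in
/-- The diffeomorphism `e^{iθ} ↦ e^{i(θ + u(θ))}` for an admissible `u` (by convention the identity
for other `u`). On admissible `u` this is the universal covering of the group of diffeomorphisms,
whose deck transformations are the translations `u ↦ u + 2πn`. Its local inverses are the charts of
the Banach manifold structure. -/
def ofLift (u : Vect2) : CircleDiff :=
  if hu : u.Admissible then
    ⟨Equiv.ofBijective u.circleFun (Vect2.circleFun_bijective hu), u, hu, u.circleFun_exp⟩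
  else 1

/-- The set of all admissible displacements of the elements of `U`. -/
def lifts (U : Set CircleDiff) : Set Vect2 := {u | u.Admissible ∧ ofLift u ∈ U}

/-- `Φ` is of class `C¹` on the open subset `U` of the Banach manifold of diffeomorphisms. -/
def C1On (Φ : CircleDiff → ℂ) (U : Set CircleDiff) : Prop :=
  ContDiffOn ℝ 1 (fun u : Vect2 => Φ (ofLift u)) (lifts U)

/-- `Φ` is of class `C¹` jointly in both variables on `S¹ × U`. -/
def JointC1On (Φ : Circle → CircleDiff → ℂ) (U : Set CircleDiff) : Prop :=
  ContDiffOn ℝ 1 (fun p : ℝ × Vect2 => Φ (Circle.exp p.1) (ofLift p.2)) (Set.univ ×ˢ lifts U)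

/-- The complex tangent vector `(L_m)_γ : ξ ↦ γ(ξ)^{m+1}` at `γ`. -/
def virasoro (m : ℤ) (γ : CircleDiff) (ξ : Circle) : ℂ := ((γ.toEquiv ξ : Circle) : ℂ) ^ (m + 1)

/-- The component `h` of `(L_m)_γ` in the angular coordinate: moving the displacement `u` of `γ` in a
direction `h` moves `γ(e^{iθ})` with velocity `i γ(e^{iθ}) h(θ)`, so that
`h(θ) = (L_m)_γ(e^{iθ}) / (i γ(e^{iθ}))`. -/
def virasoroAngle (m : ℤ) (γ : CircleDiff) (θ : ℝ) : ℂ :=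
  virasoro m γ (Circle.exp θ) / (Complex.I * (γ.toEquiv (Circle.exp θ) : Circle))

theorem virasoroAngle_contDiff (m : ℤ) (γ : CircleDiff) : ContDiff ℝ 2 (virasoroAngle m γ) := by
  obtain ⟨u, -, hu⟩ := γ.exists_lift
  have h : virasoroAngle m γ = fun θ : ℝ =>
      Complex.exp (((m * (θ + u.disp θ) : ℝ) : ℂ) * Complex.I) / Complex.I := by
    funext θ
    have hne : ((Circle.exp (θ + u.disp θ) : Circle) : ℂ) ≠ 0 := Circle.coe_ne_zero _
    rw [virasoroAngle, virasoro, hu, zpow_add_one₀ hne, mul_div_mul_right _ _ hne]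
    congr 1
    rw [Circle.coe_exp, ← Complex.exp_int_mul]
    push_cast
    ring_nf
  rw [h]
  have h1 : ContDiff ℝ 2 fun θ : ℝ => (m : ℝ) * (θ + u.disp θ) :=
    contDiff_const.mul (contDiff_id.add u.contDiff_disp)
  exact (((Complex.ofRealCLM.contDiff.comp h1).mul contDiff_const).cexp).div_const _

theorem virasoroAngle_periodic (m : ℤ) (γ : CircleDiff) :
    Function.Periodic (virasoroAngle m γ) (2 * Real.pi) := fun θ => by
  simp only [virasoroAngle, Circle.periodic_exp θ]

/-- The real part of `(L_m)_γ` in the angular coordinate. -/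
def virasoroRe (m : ℤ) (γ : CircleDiff) : Vect2 :=
  Vect2.ofContDiff (fun θ => (virasoroAngle m γ θ).re)
    (Complex.reCLM.contDiff.comp (virasoroAngle_contDiff m γ))
    (fun θ => congrArg Complex.re (virasoroAngle_periodic m γ θ))

/-- The imaginary part of `(L_m)_γ` in the angular coordinate. -/
def virasoroIm (m : ℤ) (γ : CircleDiff) : Vect2 :=
  Vect2.ofContDiff (fun θ => (virasoroAngle m γ θ).im)
    (Complex.imCLM.contDiff.comp (virasoroAngle_contDiff m γ))
    (fun θ => congrArg Complex.im (virasoroAngle_periodic m γ θ))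

/-- The Lie derivative `(L_m · Φ)(γ)`: the differential of `Φ` at `γ`, extended complex-linearly to
the complexified tangent space, applied to `(L_m)_γ`. -/
def lieDeriv (m : ℤ) (Φ : CircleDiff → ℂ) (γ : CircleDiff) : ℂ :=
  fderiv ℝ (fun u : Vect2 => Φ (ofLift u)) γ.lift (virasoroRe m γ) +
    Complex.I * fderiv ℝ (fun u : Vect2 => Φ (ofLift u)) γ.lift (virasoroIm m γ)

end CircleDiff

/-! ### Cauchy integrals and the family of differential systems -/

/-- The contour integral `∮_{S¹} f(ξ) dξ` over the positively oriented unit circle. -/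
def contourIntegral (f : Circle → ℂ) : ℂ :=
  ∫ θ in (0 : ℝ)..2 * Real.pi, f (Circle.exp θ) * (Complex.I * (Circle.exp θ : ℂ))

/-- The Cauchy integral `(1/2iπ) ∮_{S¹} F(ξ)/(ξ - x) dξ` of a matrix-valued function on the circle,
for `x` in the Riemann sphere, with the value `0` at `x = ∞`. -/
def cauchyIntegral {N : ℕ} (F : Circle → Matrix (Fin N) (Fin N) ℂ) (x : OnePoint ℂ) :
    Matrix (Fin N) (Fin N) ℂ :=
  x.elim 0 fun x : ℂ => Matrix.of fun i j =>
    (2 * Real.pi * Complex.I)⁻¹ * contourIntegral fun ξ => F ξ i j / ((ξ : ℂ) - x)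

/-- The coefficient `B_k(γ) = -(1/2iπ) ∮_{S¹} ξ^k A(ξ,γ) dξ`. -/
def coeffB {N : ℕ} (A : Circle → CircleDiff → Matrix (Fin N) (Fin N) ℂ) (k : ℤ) (γ : CircleDiff) :
    Matrix (Fin N) (Fin N) ℂ :=
  Matrix.of fun i j =>
    -((2 * Real.pi * Complex.I)⁻¹ * contourIntegral fun ξ => (ξ : ℂ) ^ k * A ξ γ i j)

/-- The complement of the unit circle in the Riemann sphere. -/
def offCircle : Set (OnePoint ℂ) := ((↑) '' Metric.sphere (0 : ℂ) 1)ᶜ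

/-- The local coordinate `w = 1/x` at `∞`, as a parametrization of the Riemann sphere minus `0`. -/
def nearInfty (w : ℂ) : OnePoint ℂ := if w = 0 then ∞ else ((w⁻¹ : ℂ) : OnePoint ℂ)

/-- `Y` is a fundamental solution, of class `C¹` in the parameter `γ ∈ U`, of the family of systems
`dY/dx = 𝒜(x,γ) Y` with `𝒜(x,γ) = (1/2iπ) ∮ A(ξ,γ)/(ξ - x) dξ`; it takes invertible values on the
Riemann sphere minus the unit circle and is analytic there, including at `∞`.
Values of `Y` on the circle, or for `γ ∉ U`, play no role. -/
structure IsFundamentalSolution {N : ℕ} (U : Set CircleDiff)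
    (A : Circle → CircleDiff → Matrix (Fin N) (Fin N) ℂ)
    (Y : OnePoint ℂ → CircleDiff → Matrix (Fin N) (Fin N) ℂ) : Prop where
  isUnit : ∀ x ∈ offCircle, ∀ γ ∈ U, IsUnit (Y x γ)
  ode : ∀ x : ℂ, ‖x‖ ≠ 1 → ∀ γ ∈ U, ∀ i j,
    HasDerivAt (fun z : ℂ => Y z γ i j) ((cauchyIntegral (fun ξ => A ξ γ) x * Y x γ) i j) x
  analytic_infty : ∀ γ ∈ U, ∀ i j, AnalyticAt ℂ (fun w : ℂ => Y (nearInfty w) γ i j) 0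
  c1 : ∀ x ∈ offCircle, ∀ i j, CircleDiff.C1On (fun γ => Y x γ i j) U

/-- `M` is the value at `ξ ∈ S¹` of the monodromy of `y`, a function on the Riemann sphere minus the
circle: `M = (y⁻)⁻¹ y⁺` where `y⁺` and `y⁻` are the limits of `y` at `ξ` from the inside and from the
outside of the circle, which exist and are invertible. -/
def IsMonodromyAt {N : ℕ} (y : OnePoint ℂ → Matrix (Fin N) (Fin N) ℂ) (ξ : Circle)
    (M : Matrix (Fin N) (Fin N) ℂ) : Prop :=
  ∃ yp ym : Matrix (Fin N) (Fin N) ℂ, IsUnit yp ∧ IsUnit ym ∧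
    Filter.Tendsto (fun x : ℂ => y x) (𝓝[{x : ℂ | ‖x‖ < 1}] (ξ : ℂ)) (𝓝 yp) ∧
    Filter.Tendsto (fun x : ℂ => y x) (𝓝[{x : ℂ | 1 < ‖x‖}] (ξ : ℂ)) (𝓝 ym) ∧
    M = ym⁻¹ * yp

/-- `Y` is `M`-invariant on `U`: it has a monodromy `G(ξ,γ)`, and `G(ξ,γ) = G(γ⁻¹(ξ),e)`. -/
def MInvariant {N : ℕ} (U : Set CircleDiff)
    (Y : OnePoint ℂ → CircleDiff → Matrix (Fin N) (Fin N) ℂ) : Prop :=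
  ∃ G : Circle → CircleDiff → Matrix (Fin N) (Fin N) ℂ,
    (∀ ξ, ∀ γ ∈ U, IsMonodromyAt (fun x => Y x γ) ξ (G ξ γ)) ∧
    ∀ ξ, ∀ γ ∈ U, G ξ γ = G (γ.toEquiv.symm ξ) 1

/-- `Ω_m(x,γ) = (L_m · Y(x,γ)) Y(x,γ)⁻¹`. -/
def Omega {N : ℕ} (Y : OnePoint ℂ → CircleDiff → Matrix (Fin N) (Fin N) ℂ) (m : ℤ)
    (x : OnePoint ℂ) (γ : CircleDiff) : Matrix (Fin N) (Fin N) ℂ :=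
  (Matrix.of fun i j => CircleDiff.lieDeriv m (fun γ' => Y x γ' i j) γ) * (Y x γ)⁻¹

end UnivSchlesinger

end

/-!
Write a diffeomorphism as `e^{iθ} ↦ e^{i(θ + u(θ))}`. Functions of `γ` become functions of the
displacement `u` in an open subset of the Banach space `Vect2`, and moving `u` in a direction `h` moves
the points of the circle with the velocity field `vel u h`. The real and imaginary parts of the fields
`L_m`, `m ∈ ℤ`, span a dense real subspace (`eq_top_of_virasoro_mem`, a consequence of the density of
trigonometric polynomials). The real parts are odd in `m` and the imaginary parts are even, so the
equations for all `L_m` separate into equations for all real directions `h` (`forall_omega_eq_iff`):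
the derivative of `Y(x, ·)` in the direction `h`, times `Y(x)⁻¹`, is the value at `x` of the Cauchy
integral of `-vel u h • A`. These are the equations of variation.

As `A` is Lipschitz on the circle, its Cauchy integral is bounded off the circle, also at infinity in
the coordinate `1/x` because `∮ A dξ = 0`. By Grönwall's inequality `Y` and `Y⁻¹` are then Lipschitz on
both sides of the circle, so the limits `Y⁺`, `Y⁻` and the monodromy `G = (Y⁻)⁻¹ Y⁺` always exist
(`isMonodromyAt_iff`), and by Plemelj's jump formula `dG/dξ = (Y⁻)⁻¹ A Y⁺` (`hasDerivAt_monodromy`).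
What has to be shown is that the equations of variation are equivalent to the constancy of
`G(γ(η), γ)` in `γ`.

If `G(γ(η), γ)` is constant, compare `Y_t` and `Y_0` for the displacements `u + t h` and `u`. The
quotient `Y_t Y_0⁻¹` is holomorphic off the circle and equal to `1` at infinity, hence it is `1` plus
the Cauchy integral of its jump `Y_t⁻ (G_t - G_0) (Y_0⁺)⁻¹` (`mul_inverse_sub_one`). As `G_t` is a
reparametrization of `G_0`, dividing by `t` and letting `t → 0` by dominated convergence gives the
equations of variation (`Family.variation_of_monodromy`).

Conversely, the equations of variation and the jump formula show that at a fixed point of the circle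
the derivative of `G` in the direction `h` is `-(Y⁻)⁻¹ (vel u h • A) Y⁺`
(`Family.hasDerivAt_monodromy_of_variation`). The chain rule then gives zero for the derivative of
`G(γ(η), γ)`, hence this function is locally constant in `γ` (`Family.monodromy_of_variation`), and
constant since the neighbourhood is connected (`sphereMonodromy_eq_iff`). For this the topology of the
group has to be compared with that of displacements: nearby diffeomorphisms have nearby displacements
(`CircleDiff.eventually_exists_lift_near`).

The remaining equivalence and the expansions of `𝒜` are geometric series in the Cauchy kernel
(`hasSum_cauchyT`, `hasSum_cauchyT_of_one_lt`) and uniqueness of sums.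
-/

noncomputable section

namespace UnivSchlesinger

set_option linter.unusedSectionVars false

open Set Filter MeasureTheory CircleDiff

/-! ### Means and Cauchy integrals over the unit circle -/

theorem continuous_circle_coe : Continuous fun ξ : Circle => (ξ : ℂ) := continuous_subtype_val

theorem intervalIntegrable_comp_exp {E : Type*} [NormedAddCommGroup E] {f : Circle → E}
    (hf : Continuous f) (a b : ℝ) :
    IntervalIntegrable (fun θ : ℝ => f (Circle.exp θ)) volume a b :=
  (hf.comp Circle.exp.continuous).intervalIntegrable a b

section CircleMean

variable {E : Type*} [NormedAddCommGroup E] [NormedSpace ℂ E]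

/-- The mean value of a function on the unit circle, with respect to normalized arc length. -/
def circleMean (f : Circle → E) : E :=
  (2 * Real.pi)⁻¹ • ∫ θ in (0 : ℝ)..2 * Real.pi, f (Circle.exp θ)

theorem circleMean_add {f g : Circle → E} (hf : Continuous f) (hg : Continuous g) :
    circleMean (fun ξ => f ξ + g ξ) = circleMean f + circleMean g := by
  rw [circleMean, intervalIntegral.integral_add (intervalIntegrable_comp_exp hf _ _)
    (intervalIntegrable_comp_exp hg _ _), smul_add]
  rfl

theorem circleMean_sub {f g : Circle → E} (hf : Continuous f) (hg : Continuous g) :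
    circleMean (fun ξ => f ξ - g ξ) = circleMean f - circleMean g := by
  rw [circleMean, intervalIntegral.integral_sub (intervalIntegrable_comp_exp hf _ _)
    (intervalIntegrable_comp_exp hg _ _), smul_sub]
  rfl

theorem circleMean_smul (c : ℂ) (f : Circle → E) :
    circleMean (fun ξ => c • f ξ) = c • circleMean f := by
  rw [circleMean, intervalIntegral.integral_smul, smul_comm]
  rfl

theorem circleMean_neg (f : Circle → E) : circleMean (fun ξ => -f ξ) = -circleMean f := by
  simpa using circleMean_smul (-1) f

theorem circleMean_const [CompleteSpace E] (c : E) : circleMean (fun _ => c) = c := by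
  have : (2 * Real.pi) ≠ 0 := by positivity
  rw [circleMean, intervalIntegral.integral_const, sub_zero, smul_smul, inv_mul_cancel₀ this,
    one_smul]

theorem norm_circleMean_le {f : Circle → E} {C : ℝ} (h : ∀ ξ, ‖f ξ‖ ≤ C) : ‖circleMean f‖ ≤ C := by
  have h2 : (0 : ℝ) < 2 * Real.pi := by positivity
  have := intervalIntegral.norm_integral_le_of_norm_le_const (a := 0) (b := 2 * Real.pi)
    (f := fun θ : ℝ => f (Circle.exp θ)) (C := C) fun θ _ => h _
  rw [circleMean, norm_smul, Real.norm_of_nonneg (by positivity), inv_mul_le_iff₀ h2]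
  rwa [sub_zero, abs_of_pos h2, mul_comm C] at this

theorem countable_preimage_exp (p : Circle) : {θ : ℝ | Circle.exp θ = p}.Countable := by
  obtain ⟨θ₀, rfl⟩ := Circle.exp_surjective p
  refine (countable_range fun n : ℤ => θ₀ + n * (2 * Real.pi)).mono fun θ hθ => ?_
  obtain ⟨n, hn⟩ := Circle.exp_eq_exp.1 hθ
  exact ⟨n, hn.symm⟩

/-- Dominated convergence for means over the circle, where pointwise convergence may fail at one
point `p`. -/
theorem tendsto_circleMean {ι : Type*} {l : Filter ι} [l.IsCountablyGenerated]
    {f : ι → Circle → E} {g : Circle → E} (C : ℝ) (p : Circle)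
    (hf : ∀ᶠ i in l, Continuous (f i)) (hC : ∀ᶠ i in l, ∀ ξ, ‖f i ξ‖ ≤ C)
    (hlim : ∀ ξ, ξ ≠ p → Tendsto (fun i => f i ξ) l (𝓝 (g ξ))) :
    Tendsto (fun i => circleMean (f i)) l (𝓝 (circleMean g)) := by
  refine Tendsto.const_smul ?_ _
  refine intervalIntegral.tendsto_integral_filter_of_dominated_convergence (fun _ => C) ?_ ?_
    intervalIntegrable_const ?_
  · filter_upwards [hf] with i hi
    exact (hi.comp Circle.exp.continuous).aestronglyMeasurable
  · filter_upwards [hC] with i hi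
    exact Eventually.of_forall fun θ _ => hi _
  · have := (countable_preimage_exp p).ae_notMem volume
    filter_upwards [this] with θ hθ _
    exact hlim _ hθ

theorem circleMean_inv (f : Circle → E) : circleMean (fun ξ => f ξ⁻¹) = circleMean f := by
  have hp : Function.Periodic (fun θ : ℝ => f (Circle.exp θ)) (2 * Real.pi) := fun θ => by
    simp only [Circle.periodic_exp θ]
  have h1 : ∫ θ in (0 : ℝ)..2 * Real.pi, f (Circle.exp θ)⁻¹
      = ∫ θ in (0 : ℝ)..2 * Real.pi, (fun t : ℝ => f (Circle.exp t)) (-θ) := by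
    simp only [Circle.exp_neg]
  rw [circleMean, h1, intervalIntegral.integral_comp_neg fun t : ℝ => f (Circle.exp t), circleMean]
  have := hp.intervalIntegral_add_eq (-(2 * Real.pi)) 0
  rw [neg_add_cancel, zero_add] at this
  rw [neg_zero, this]

/-- Since `dξ = i ξ dθ`, means of `ξ f(ξ)` are contour integrals of `f`. -/
theorem circleMean_coe_smul (f : ℂ → E) :
    circleMean (fun ξ => (ξ : ℂ) • f ξ) = (2 * Real.pi * Complex.I : ℂ)⁻¹ • ∮ z in C(0, 1), f z := by
  have hI : (2 * Real.pi * Complex.I : ℂ)⁻¹ * Complex.I = ((2 * Real.pi : ℝ)⁻¹ : ℝ) := by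
    have : (Real.pi : ℂ) ≠ 0 := by exact_mod_cast Real.pi_ne_zero
    push_cast
    field_simp
  rw [circleMean, circleIntegral]
  have : ∀ θ : ℝ, deriv (circleMap 0 1) θ • f (circleMap 0 1 θ)
      = Complex.I • ((Circle.exp θ : ℂ) • f (Circle.exp θ)) := fun θ => by
    rw [deriv_circleMap, smul_smul, Circle.coe_exp]
    simp [circleMap, mul_comm]
  simp only [this]
  rw [intervalIntegral.integral_smul, smul_smul, hI, Complex.coe_smul]

end CircleMean

section Cauchy

variable {E : Type*} [NormedAddCommGroup E] [NormedSpace ℂ E]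

/-- The Cauchy integral `(1/2iπ) ∮ F(ξ)/(ξ - x) dξ` over the unit circle of a function with values
in a complex Banach space, at a finite point `x`, written as a mean over the circle. -/
def cauchyT (F : Circle → E) (x : ℂ) : E :=
  circleMean fun ξ => ((ξ : ℂ) / (ξ - x)) • F ξ

theorem coe_sub_ne_zero {x : ℂ} (hx : ‖x‖ ≠ 1) (ξ : Circle) : (ξ : ℂ) - x ≠ 0 := fun h =>
  hx (by rw [← sub_eq_zero.1 h, Circle.norm_coe])

theorem continuous_cauchyKernel {x : ℂ} (hx : ‖x‖ ≠ 1) :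
    Continuous fun ξ : Circle => (ξ : ℂ) / (ξ - x) :=
  continuous_circle_coe.div (continuous_circle_coe.sub continuous_const) (coe_sub_ne_zero hx)

theorem continuous_cauchyT_integrand {F : Circle → E} (hF : Continuous F) {x : ℂ} (hx : ‖x‖ ≠ 1) :
    Continuous fun ξ : Circle => ((ξ : ℂ) / (ξ - x)) • F ξ :=
  (continuous_cauchyKernel hx).smul hF

theorem cauchyT_sub {F G : Circle → E} (hF : Continuous F) (hG : Continuous G) {x : ℂ}
    (hx : ‖x‖ ≠ 1) : cauchyT (fun ξ => F ξ - G ξ) x = cauchyT F x - cauchyT G x := by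
  rw [cauchyT, cauchyT, cauchyT, ← circleMean_sub (continuous_cauchyT_integrand hF hx)
    (continuous_cauchyT_integrand hG hx)]
  simp only [smul_sub]

theorem cauchyT_add {F G : Circle → E} (hF : Continuous F) (hG : Continuous G) {x : ℂ}
    (hx : ‖x‖ ≠ 1) : cauchyT (fun ξ => F ξ + G ξ) x = cauchyT F x + cauchyT G x := by
  rw [cauchyT, cauchyT, cauchyT, ← circleMean_add (continuous_cauchyT_integrand hF hx)
    (continuous_cauchyT_integrand hG hx)]
  simp only [smul_add]

theorem cauchyT_smul (c : ℂ) (F : Circle → E) (x : ℂ) :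
    cauchyT (fun ξ => c • F ξ) x = c • cauchyT F x := by
  rw [cauchyT, cauchyT, ← circleMean_smul]
  simp only [smul_comm c]

theorem cauchyT_eq_circleIntegral (f : ℂ → E) (x : ℂ) :
    cauchyT (fun ξ => f ξ) x
      = (2 * Real.pi * Complex.I : ℂ)⁻¹ • ∮ z in C(0, 1), (z - x)⁻¹ • f z := by
  rw [← circleMean_coe_smul fun z => (z - x)⁻¹ • f z]
  simp only [cauchyT, smul_smul, div_eq_mul_inv]

theorem ne_of_norm_lt {x z : ℂ} (hz : z ∈ closure (Metric.ball (0 : ℂ) 1)) (hx : 1 < ‖x‖) :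
    z - x ≠ 0 := fun h => by
  rw [closure_ball _ one_ne_zero, mem_closedBall_zero_iff, sub_eq_zero.1 h] at hz
  linarith

theorem cauchyT_of_diffContOnCl_of_one_lt {f : ℂ → E} (hf : DiffContOnCl ℂ f (Metric.ball 0 1))
    {x : ℂ} (hx : 1 < ‖x‖) : cauchyT (fun ξ => f ξ) x = 0 := by
  have h : DiffContOnCl ℂ (fun z : ℂ => (z - x)⁻¹) (Metric.ball 0 1) :=
    (differentiable_id.sub_const x).diffContOnCl.inv fun z hz => ne_of_norm_lt hz hx
  rw [cauchyT_eq_circleIntegral, (h.smul hf).circleIntegral_eq_zero zero_le_one, smul_zero]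

theorem cauchyT_const_of_one_lt (c : E) {x : ℂ} (hx : 1 < ‖x‖) : cauchyT (fun _ => c) x = 0 :=
  cauchyT_of_diffContOnCl_of_one_lt (f := fun _ => c) diffContOnCl_const hx

variable [CompleteSpace E]

theorem circleMean_eq_of_diffContOnCl {f : ℂ → E} (hf : DiffContOnCl ℂ f (Metric.ball 0 1)) :
    circleMean (fun ξ => f ξ) = f 0 := by
  have := cauchyT_eq_circleIntegral f 0
  rw [hf.two_pi_i_inv_smul_circleIntegral_sub_inv_smul (Metric.mem_ball_self one_pos)] at this
  rw [← this, cauchyT]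
  simp

theorem cauchyT_of_diffContOnCl {f : ℂ → E} (hf : DiffContOnCl ℂ f (Metric.ball 0 1)) {x : ℂ}
    (hx : ‖x‖ < 1) : cauchyT (fun ξ => f ξ) x = f x := by
  rw [cauchyT_eq_circleIntegral,
    hf.two_pi_i_inv_smul_circleIntegral_sub_inv_smul (by simpa using hx)]

/-- The boundary values of a function holomorphic outside of the circle (the function
`x ↦ f (1/x)`) have the constant Cauchy integral `f 0` inside of the circle. -/
theorem cauchyT_inv_of_diffContOnCl {f : ℂ → E} (hf : DiffContOnCl ℂ f (Metric.ball 0 1)) {x : ℂ}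
    (hx : ‖x‖ < 1) : cauchyT (fun ξ => f ξ⁻¹) x = f 0 := by
  have h0 : ∀ z ∈ closure (Metric.ball (0 : ℂ) 1), 1 - x * z ≠ 0 := fun z hz h => by
    rw [closure_ball _ one_ne_zero, mem_closedBall_zero_iff] at hz
    have h1 : ‖x * z‖ = 1 := by rw [← sub_eq_zero.1 h, norm_one]
    rw [norm_mul] at h1
    nlinarith [norm_nonneg x, norm_nonneg z]
  have h : DiffContOnCl ℂ (fun z : ℂ => (1 - x * z)⁻¹) (Metric.ball 0 1) :=
    (((differentiable_const 1).sub (differentiable_id.const_mul x)).diffContOnCl.inv h0)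
  -- The kernel `ξ / (ξ - x)` is the boundary value of `(1 - x z)⁻¹` at `z = ξ⁻¹`, so that the integral
  -- is the mean of a function holomorphic in `z`.
  have h2 := circleMean_eq_of_diffContOnCl (h.smul hf)
  rw [← circleMean_inv] at h2
  rw [cauchyT]
  simp only [mul_zero, sub_zero, inv_one, one_smul] at h2
  rw [← h2]
  congr 1
  funext ξ
  show _ = (1 - x * ((ξ⁻¹ : Circle) : ℂ))⁻¹ • f ((ξ⁻¹ : Circle) : ℂ)
  rw [Circle.coe_inv]
  congr 1
  have := Circle.coe_ne_zero ξ
  have := coe_sub_ne_zero hx.ne ξ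
  have h3 : 1 - x * (ξ : ℂ)⁻¹ = ((ξ : ℂ) - x) / ξ := by field_simp
  rw [h3, inv_div]

/-- The boundary values of a function holomorphic outside of the circle (the function
`x ↦ f (1/x)`): their Cauchy integral at an exterior point. -/
theorem cauchyT_inv_of_diffContOnCl_of_one_lt {f : ℂ → E}
    (hf : DiffContOnCl ℂ f (Metric.ball 0 1)) {x : ℂ} (hx : 1 < ‖x‖) :
    cauchyT (fun ξ => f ξ⁻¹) x = f 0 - f x⁻¹ := by
  have hx0 : x ≠ 0 := norm_pos_iff.1 (by linarith)
  have hxi : ‖x⁻¹‖ < 1 := by rw [norm_inv]; exact inv_lt_one_of_one_lt₀ hx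
  -- At `z = ξ⁻¹` the kernel `ξ / (ξ - x)` is `1 - z / (z - x⁻¹)`.
  rw [← circleMean_eq_of_diffContOnCl hf, ← cauchyT_of_diffContOnCl hf hxi, cauchyT, cauchyT]
  have hc : Continuous fun ξ : Circle => f ξ :=
    hf.continuousOn.comp_continuous continuous_circle_coe fun ξ => by
      rw [closure_ball _ one_ne_zero, mem_closedBall_zero_iff, Circle.norm_coe]
  rw [← circleMean_sub hc (continuous_cauchyT_integrand hc hxi.ne), ← circleMean_inv]
  congr 1
  funext ξ
  have h1 := Circle.coe_ne_zero ξ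
  have h2 := coe_sub_ne_zero hx.ne' ξ⁻¹
  have h3 := coe_sub_ne_zero hxi.ne ξ
  simp only [inv_inv, Circle.coe_inv] at h2 ⊢
  nth_rewrite 2 [← one_smul ℂ (f ξ)]
  rw [← sub_smul]
  congr 1
  field_simp
  have h4 : (1 : ℂ) - ξ * x ≠ 0 := fun h => h2 (by field_simp; linear_combination h)
  have h5 : (x : ℂ) * ξ - 1 ≠ 0 := fun h => h4 (by linear_combination -h)
  have h6 : (ξ : ℂ) * x - 1 ≠ 0 := fun h => h4 (by linear_combination -h)
  field_simp
  ring

theorem cauchyT_const (c : E) {x : ℂ} (hx : ‖x‖ < 1) : cauchyT (fun _ => c) x = c :=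
  cauchyT_of_diffContOnCl (f := fun _ => c) diffContOnCl_const hx

end Cauchy

/-! ### Bounds and boundary values of Cauchy integrals -/

section CauchyBounds

variable {E : Type*} [NormedAddCommGroup E] [NormedSpace ℂ E]

/-- `F` is bounded by `L` and `L`-Lipschitz on the circle. -/
structure BoundedLipschitz (F : Circle → E) (L : ℝ) : Prop where
  bound : ∀ ξ, ‖F ξ‖ ≤ L
  lipschitz : ∀ ξ η : Circle, ‖F ξ - F η‖ ≤ L * ‖(ξ : ℂ) - η‖

namespace BoundedLipschitz

variable {F : Circle → E} {L : ℝ}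

theorem nonneg (h : BoundedLipschitz F L) : 0 ≤ L := (norm_nonneg _).trans (h.bound 1)

theorem continuous (h : BoundedLipschitz F L) : Continuous F := by
  refine (LipschitzWith.of_dist_le_mul (K := L.toNNReal) fun ξ η => ?_).continuous
  rw [dist_eq_norm, Real.coe_toNNReal _ h.nonneg]
  exact (h.lipschitz ξ η).trans_eq (by rw [← dist_eq_norm]; rfl)

theorem mono {L' : ℝ} (h : BoundedLipschitz F L) (hL : L ≤ L') : BoundedLipschitz F L' :=
  ⟨fun ξ => (h.bound ξ).trans hL, fun ξ η => (h.lipschitz ξ η).trans (by gcongr)⟩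

theorem smul {f : Circle → ℂ} {M : ℝ} (hf : BoundedLipschitz f M) (h : BoundedLipschitz F L) :
    BoundedLipschitz (fun ξ => f ξ • F ξ) (2 * (M * L)) := by
  have hM := hf.nonneg
  have hL := h.nonneg
  constructor
  · intro ξ
    rw [norm_smul]
    have := mul_le_mul (hf.bound ξ) (h.bound ξ) (norm_nonneg _) hM
    nlinarith [mul_nonneg hM hL]
  · intro ξ η
    have e : f ξ • F ξ - f η • F η = f ξ • (F ξ - F η) + (f ξ - f η) • F η := by
      rw [smul_sub, sub_smul]; abel
    calc ‖f ξ • F ξ - f η • F η‖ ≤ ‖f ξ‖ * ‖F ξ - F η‖ + ‖f ξ - f η‖ * ‖F η‖ := by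
          rw [e, ← norm_smul, ← norm_smul]; exact norm_add_le _ _
      _ ≤ M * (L * ‖(ξ : ℂ) - η‖) + (M * ‖(ξ : ℂ) - η‖) * L :=
          add_le_add (mul_le_mul (hf.bound ξ) (h.lipschitz ξ η) (norm_nonneg _) hM)
            (mul_le_mul (hf.lipschitz ξ η) (h.bound η) (norm_nonneg _) (by positivity))
      _ = 2 * (M * L) * ‖(ξ : ℂ) - η‖ := by ring

end BoundedLipschitz

theorem boundedLipschitz_coe : BoundedLipschitz (fun ξ : Circle => (ξ : ℂ)) 1 :=
  ⟨fun ξ => (Circle.norm_coe ξ).le, fun _ _ => (one_mul _).ge⟩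

theorem norm_coe_inv_sub (ξ η : Circle) : ‖((ξ⁻¹ : Circle) : ℂ) - (η⁻¹ : Circle)‖ = ‖(ξ : ℂ) - η‖ := by
  rw [Circle.coe_inv_eq_conj, Circle.coe_inv_eq_conj, ← map_sub, Complex.norm_conj]

theorem BoundedLipschitz.comp_inv {F : Circle → E} {L : ℝ} (h : BoundedLipschitz F L) :
    BoundedLipschitz (fun ξ => F ξ⁻¹) L :=
  ⟨fun ξ => h.bound _, fun ξ η => (h.lipschitz _ _).trans_eq (by rw [norm_coe_inv_sub])⟩

/-- The density obtained from `F` by the inversion `ξ ↦ 1/ξ`: if `∮ F(ξ) dξ = 0` then the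
one-form `𝒜(x) dx`, with `𝒜` the Cauchy integral of `F`, becomes `𝒜'(w) dw` in the coordinate
`w = 1/x`, with `𝒜'` the Cauchy integral of `flip F`. -/
def flip (F : Circle → E) (ξ : Circle) : E := ((ξ⁻¹ : Circle) : ℂ) ^ 2 • F ξ⁻¹

theorem BoundedLipschitz.flip {F : Circle → E} {L : ℝ} (h : BoundedLipschitz F L) :
    BoundedLipschitz (flip F) (4 * L) := by
  have h2 : BoundedLipschitz (fun ξ : Circle => (ξ : ℂ) • F ξ) (2 * L) := by
    simpa only [one_mul] using boundedLipschitz_coe.smul h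
  have h3 : BoundedLipschitz (fun ξ : Circle => (ξ : ℂ) • (ξ : ℂ) • F ξ) (4 * L) := by
    have := boundedLipschitz_coe.smul h2
    exact this.mono (by linarith [h.nonneg])
  convert h3.comp_inv using 2 with ξ
  rw [UnivSchlesinger.flip, pow_two, smul_smul]

theorem norm_sub_le_two_mul {x : ℂ} {p : Circle} (hp : ‖x - p‖ = 1 - ‖x‖) (ξ : Circle) :
    ‖(ξ : ℂ) - p‖ ≤ 2 * ‖(ξ : ℂ) - x‖ := by
  have h1 : ‖(ξ : ℂ) - p‖ ≤ ‖(ξ : ℂ) - x‖ + ‖x - p‖ :=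
    norm_sub_le_norm_sub_add_norm_sub _ _ _
  have h2 : 1 - ‖x‖ ≤ ‖(ξ : ℂ) - x‖ := by
    have := norm_sub_norm_le (ξ : ℂ) x
    rwa [Circle.norm_coe] at this
  linarith

theorem exists_nearest_point {x : ℂ} (hx : ‖x‖ < 1) : ∃ p : Circle, ‖x - p‖ = 1 - ‖x‖ := by
  refine ⟨Circle.exp x.arg, ?_⟩
  have h : x - (Circle.exp x.arg : ℂ) = ((‖x‖ - 1 : ℝ) : ℂ) * (Circle.exp x.arg : ℂ) := by
    nth_rewrite 1 [← Complex.norm_mul_exp_arg_mul_I x]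
    rw [Circle.coe_exp]
    push_cast
    ring
  rw [h, norm_mul, Circle.norm_coe, mul_one, Complex.norm_real, Real.norm_eq_abs, abs_sub_comm,
    abs_of_pos (by linarith)]

/-- The Cauchy integral of a Lipschitz function is bounded inside of the circle: subtracting from `F`
its value at the point of the circle nearest to `x` compensates the singularity of the kernel. -/
theorem BoundedLipschitz.norm_cauchyT_le [CompleteSpace E] {F : Circle → E} {L : ℝ}
    (h : BoundedLipschitz F L) {x : ℂ} (hx : ‖x‖ < 1) : ‖cauchyT F x‖ ≤ 3 * L := by
  obtain ⟨p, hp⟩ := exists_nearest_point hx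
  have h1 : cauchyT (fun ξ => F ξ - F p) x = cauchyT F x - F p := by
    rw [cauchyT_sub h.continuous continuous_const hx.ne, cauchyT_const _ hx]
  have h2 : ‖cauchyT (fun ξ => F ξ - F p) x‖ ≤ 2 * L := by
    refine norm_circleMean_le fun ξ => ?_
    have h3 : 0 < ‖(ξ : ℂ) - x‖ := norm_pos_iff.2 (coe_sub_ne_zero hx.ne ξ)
    rw [norm_smul, norm_div, Circle.norm_coe, one_div, inv_mul_le_iff₀ h3]
    refine (h.lipschitz ξ p).trans ?_
    nlinarith [norm_sub_le_two_mul hp ξ, h.nonneg]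
  have h3 := norm_add_le (cauchyT F x - F p) (F p)
  rw [sub_add_cancel, ← h1] at h3
  linarith [h.bound p]

theorem continuousAt_cauchyT {F : Circle → E} (hF : Continuous F) {x : ℂ} (hx : ‖x‖ < 1) :
    ContinuousAt (cauchyT F) x := by
  obtain ⟨C, hC⟩ : ∃ C, ∀ ξ, ‖F ξ‖ ≤ C := by
    obtain ⟨C, hC⟩ := isCompact_univ.exists_bound_of_continuousOn hF.continuousOn
    exact ⟨C, fun ξ => hC ξ (mem_univ _)⟩
  have hev : ∀ᶠ y : ℂ in 𝓝 x, ‖y‖ < (1 + ‖x‖) / 2 :=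
    continuous_norm.continuousAt.eventually_lt continuousAt_const (by linarith)
  have hC0 : 0 ≤ C := (norm_nonneg _).trans (hC 1)
  refine tendsto_circleMean (((1 - ‖x‖) / 2)⁻¹ * C) 1 ?_ ?_ fun ξ _ => ?_
  · filter_upwards [hev] with y hy
    exact continuous_cauchyT_integrand hF (by linarith)
  · filter_upwards [hev] with y hy ξ
    have h1 := norm_sub_norm_le (ξ : ℂ) y
    rw [Circle.norm_coe] at h1
    rw [norm_smul, norm_div, Circle.norm_coe, one_div]
    refine mul_le_mul (inv_anti₀ (by linarith) (by linarith)) (hC ξ) (norm_nonneg _) ?_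
    exact inv_nonneg.2 (by linarith)
  · have : ContinuousAt (fun y : ℂ => ((ξ : ℂ) / (ξ - y)) • F ξ) x :=
      (continuousAt_const.div (continuousAt_const.sub continuousAt_id)
        (coe_sub_ne_zero hx.ne ξ)).smul continuousAt_const
    exact this

/-- The change of variable `w = 1/x` for Cauchy integrals. -/
theorem cauchyT_flip {F : Circle → E} (hF : Continuous F)
    (h0 : circleMean (fun ξ => (ξ : ℂ) • F ξ) = 0) {w : ℂ} (hw : ‖w‖ < 1) (hw0 : w ≠ 0) :
    w ^ 2 • cauchyT (flip F) w = -cauchyT F w⁻¹ := by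
  have hwi : 1 < ‖w⁻¹‖ := by
    rw [norm_inv]; exact (one_lt_inv₀ (norm_pos_iff.2 hw0)).2 hw
  have h1 : w ^ 2 • cauchyT (flip F) w
      = circleMean fun ξ : Circle => -((ξ : ℂ) / (ξ - w⁻¹)) • F ξ - w • ((ξ : ℂ) • F ξ) := by
    rw [cauchyT, ← circleMean_smul, ← circleMean_inv]
    congr 1
    funext ξ
    have h1 := Circle.coe_ne_zero ξ
    have h2 := coe_sub_ne_zero hw.ne ξ⁻¹
    have h3 := coe_sub_ne_zero hwi.ne' ξ
    simp only [flip, inv_inv, Circle.coe_inv, smul_smul, ← sub_smul] at h2 ⊢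
    congr 1
    have h4 : (1 : ℂ) - ξ * w ≠ 0 := fun h => h2 (by field_simp; linear_combination h)
    have h5 : (1 : ℂ) - w * ξ ≠ 0 := fun h => h4 (by linear_combination h)
    have h6 : (ξ : ℂ) * w - 1 ≠ 0 := fun h => h4 (by linear_combination -h)
    have h7 : w * (ξ : ℂ) - 1 ≠ 0 := fun h => h4 (by linear_combination -h)
    have e1 : ((ξ : ℂ)⁻¹ - w) = (1 - w * ξ) / ξ := by field_simp
    have e2 : ((ξ : ℂ) - w⁻¹) = -(1 - w * ξ) / w := by field_simp; ring
    rw [e1, e2]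
    field_simp
    ring
  have c1 : Continuous fun ξ : Circle => -((ξ : ℂ) / (ξ - w⁻¹)) • F ξ :=
    (continuous_cauchyKernel hwi.ne').neg.smul hF
  have c2 : Continuous fun ξ : Circle => w • (ξ : ℂ) • F ξ :=
    (continuous_circle_coe.smul hF).const_smul w
  rw [h1, circleMean_sub c1 c2, circleMean_smul, h0, smul_zero, sub_zero]
  simp only [neg_smul]
  exact circleMean_neg _

/-- The difference of the Cauchy kernels at the points `r p` and `p / r`, symmetric with respect to
the circle. It is the Poisson kernel. -/
def jumpKernel (r : ℝ) (p ξ : Circle) : ℂ := (ξ : ℂ) / (ξ - r * p) - (ξ : ℂ) / (ξ - p / r)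

theorem norm_jumpKernel {r : ℝ} (hr0 : 0 < r) (hr1 : r < 1) (p ξ : Circle) :
    ‖jumpKernel r p ξ‖ = (1 - r ^ 2) / ‖(ξ : ℂ) - r * p‖ ^ 2 := by
  have hrc : (r : ℂ) ≠ 0 := by exact_mod_cast hr0.ne'
  have n1 : ‖(r : ℂ) * p‖ ≠ 1 := by
    rw [norm_mul, Circle.norm_coe, mul_one, Complex.norm_real, Real.norm_of_nonneg hr0.le]
    exact hr1.ne
  have n2 : ‖(p : ℂ) / r‖ ≠ 1 := by
    rw [norm_div, Circle.norm_coe, Complex.norm_real, Real.norm_of_nonneg hr0.le]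
    exact ((one_lt_div hr0).2 hr1).ne'
  have h1 := coe_sub_ne_zero n1 ξ
  have h2 := coe_sub_ne_zero n2 ξ
  have hs : ‖(ξ : ℂ) - p / r‖ = ‖(ξ : ℂ) - r * p‖ / r := by
    have e1 : (ξ : ℂ) - p / r = -(p * ξ) * (((ξ⁻¹ : Circle) : ℂ) - r * (p⁻¹ : Circle)) / r := by
      have := Circle.coe_ne_zero ξ
      have := Circle.coe_ne_zero p
      rw [Circle.coe_inv, Circle.coe_inv]
      field_simp
      ring
    have e2 : ((ξ⁻¹ : Circle) : ℂ) - r * (p⁻¹ : Circle) = starRingEnd ℂ ((ξ : ℂ) - r * p) := by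
      rw [Circle.coe_inv_eq_conj, Circle.coe_inv_eq_conj, map_sub, map_mul, Complex.conj_ofReal]
    rw [e1, norm_div, norm_mul, norm_neg, norm_mul, Circle.norm_coe, Circle.norm_coe, e2,
      Complex.norm_conj, Complex.norm_real, Real.norm_of_nonneg hr0.le]
    ring
  have e : (ξ : ℂ) / (ξ - r * p) - (ξ : ℂ) / (ξ - p / r)
      = ξ * p * (((r ^ 2 - 1 : ℝ) : ℂ) / r) / ((ξ - r * p) * (ξ - p / r)) := by
    rw [div_sub_div _ _ h1 h2]
    congr 1
    push_cast
    field_simp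
    ring
  rw [jumpKernel, e, norm_div, norm_mul, norm_mul, norm_mul, Circle.norm_coe, Circle.norm_coe, hs, norm_div,
    Complex.norm_real, Complex.norm_real, Real.norm_of_nonneg hr0.le, Real.norm_eq_abs,
    abs_of_neg (by nlinarith)]
  have : ‖(ξ : ℂ) - r * p‖ ≠ 0 := norm_ne_zero_iff.2 h1
  field_simp
  ring

theorem norm_mul_circle {r : ℝ} (hr0 : 0 ≤ r) (p : Circle) : ‖(r : ℂ) * p‖ = r := by
  rw [norm_mul, Circle.norm_coe, mul_one, Complex.norm_real, Real.norm_of_nonneg hr0]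

theorem norm_div_circle {r : ℝ} (hr0 : 0 ≤ r) (p : Circle) : ‖(p : ℂ) / r‖ = r⁻¹ := by
  rw [norm_div, Circle.norm_coe, Complex.norm_real, Real.norm_of_nonneg hr0, one_div]

namespace BoundedLipschitz

variable {F : Circle → E} {L : ℝ}

/-- The Poisson kernel is at most `4 / ‖ξ - p‖`, which the Lipschitz bound of `F` compensates. -/
theorem norm_jumpKernel_smul_le (h : BoundedLipschitz F L) (p : Circle) {r : ℝ} (hr0 : 0 < r)
    (hr1 : r < 1) (ξ : Circle) : ‖jumpKernel r p ξ • (F ξ - F p)‖ ≤ 4 * L := by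
  have n1 := norm_mul_circle hr0.le p
  rw [norm_smul, norm_jumpKernel hr0 hr1]
  have hp : ‖(r : ℂ) * p - p‖ = 1 - ‖(r : ℂ) * p‖ := by
    rw [n1, show (r : ℂ) * p - p = ((r - 1 : ℝ) : ℂ) * p by push_cast; ring, norm_mul,
      Circle.norm_coe, mul_one, Complex.norm_real, Real.norm_eq_abs, abs_of_neg (by linarith)]
    ring
  have h1 := norm_sub_le_two_mul hp ξ
  have h2 : 1 - r ≤ ‖(ξ : ℂ) - r * p‖ := by
    have := norm_sub_norm_le (ξ : ℂ) (r * p)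
    rwa [Circle.norm_coe, n1] at this
  have h3 : 0 < ‖(ξ : ℂ) - r * p‖ := by linarith
  have h4 := h.nonneg
  rw [div_mul_eq_mul_div, div_le_iff₀ (by positivity)]
  calc (1 - r ^ 2) * ‖F ξ - F p‖ ≤ (2 * ‖(ξ : ℂ) - r * p‖) * (L * (2 * ‖(ξ : ℂ) - r * p‖)) := by
        refine mul_le_mul (by nlinarith) ((h.lipschitz ξ p).trans (by gcongr)) (norm_nonneg _)
          (by positivity)
    _ = 4 * L * ‖(ξ : ℂ) - r * p‖ ^ 2 := by ring

variable [CompleteSpace E]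

theorem cauchyT_sub_cauchyT (h : BoundedLipschitz F L) (p : Circle) {r : ℝ} (hr0 : 0 < r)
    (hr1 : r < 1) : cauchyT F (r * p) - cauchyT F (p / r) - F p
      = circleMean fun ξ => jumpKernel r p ξ • (F ξ - F p) := by
  have l1 : ‖(r : ℂ) * p‖ < 1 := (norm_mul_circle hr0.le p).trans_lt hr1
  have l2 : 1 < ‖(p : ℂ) / r‖ :=
    ((one_lt_inv₀ hr0).2 hr1).trans_eq (norm_div_circle hr0.le p).symm
  have hc := h.continuous
  have e1 : cauchyT (fun ξ => F ξ - F p) (r * p) = cauchyT F (r * p) - F p := by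
    rw [cauchyT_sub hc continuous_const l1.ne, cauchyT_const _ l1]
  have e2 : cauchyT (fun ξ => F ξ - F p) (p / r) = cauchyT F (p / r) := by
    rw [cauchyT_sub hc continuous_const l2.ne', cauchyT_const_of_one_lt _ l2, sub_zero]
  have c1 : Continuous fun ξ : Circle => ((ξ : ℂ) / (ξ - r * p)) • (F ξ - F p) :=
    continuous_cauchyT_integrand (hc.sub continuous_const) l1.ne
  have c2 : Continuous fun ξ : Circle => ((ξ : ℂ) / (ξ - p / r)) • (F ξ - F p) :=
    continuous_cauchyT_integrand (hc.sub continuous_const) l2.ne'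
  have e3 : circleMean (fun ξ => jumpKernel r p ξ • (F ξ - F p))
      = cauchyT (fun ξ => F ξ - F p) (r * p) - cauchyT (fun ξ => F ξ - F p) (p / r) := by
    rw [cauchyT, cauchyT, ← circleMean_sub c1 c2]
    simp only [jumpKernel, sub_smul]
  rw [e3, e1, e2]
  abel

theorem norm_jump_le (h : BoundedLipschitz F L) (p : Circle) {r : ℝ} (hr0 : 0 < r)
    (hr1 : r < 1) : ‖cauchyT F (r * p) - cauchyT F (p / r)‖ ≤ 5 * L := by
  have h1 := norm_circleMean_le (h.norm_jumpKernel_smul_le p hr0 hr1)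
  rw [← h.cauchyT_sub_cauchyT p hr0 hr1] at h1
  have h2 := norm_add_le (cauchyT F (r * p) - cauchyT F (p / r) - F p) (F p)
  rw [sub_add_cancel] at h2
  linarith [h.bound p]

/-- The jump formula of Plemelj: the difference of the values of the Cauchy integral of `F` at
`r p` and at `p / r` tends to `F p` as `r → 1`. -/
theorem tendsto_jump (h : BoundedLipschitz F L) (p : Circle) :
    Tendsto (fun r : ℝ => cauchyT F (r * p) - cauchyT F (p / r)) (𝓝[<] 1) (𝓝 (F p)) := by
  have hev : ∀ᶠ r : ℝ in 𝓝[<] 1, 0 < r ∧ r < 1 := by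
    filter_upwards [self_mem_nhdsWithin,
      mem_nhdsWithin_of_mem_nhds (lt_mem_nhds (zero_lt_one' ℝ))] with r h1 h2 using ⟨h2, h1⟩
  have hc := h.continuous
  have key : Tendsto (fun r : ℝ => circleMean fun ξ => jumpKernel r p ξ • (F ξ - F p)) (𝓝[<] 1)
      (𝓝 (circleMean fun _ => 0)) := by
    -- Pointwise, the Poisson kernel tends to `0` away from `p`.
    refine tendsto_circleMean (4 * L) p ?_ ?_ fun ξ hξ => ?_
    · filter_upwards [hev] with r hr
      have l1 : ‖(r : ℂ) * p‖ ≠ 1 := by rw [norm_mul_circle hr.1.le]; exact hr.2.ne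
      have l2 : ‖(p : ℂ) / r‖ ≠ 1 := by
        rw [norm_div_circle hr.1.le]; exact ((one_lt_inv₀ hr.1).2 hr.2).ne'
      exact ((continuous_cauchyKernel l1).sub (continuous_cauchyKernel l2)).smul
        (hc.sub continuous_const)
    · filter_upwards [hev] with r hr ξ
      exact h.norm_jumpKernel_smul_le p hr.1 hr.2 ξ
    · have hne : ‖(ξ : ℂ) - ((1 : ℝ) : ℂ) * p‖ ^ 2 ≠ 0 := by
        rw [Complex.ofReal_one, one_mul]
        exact pow_ne_zero 2 (norm_ne_zero_iff.2 (sub_ne_zero.2 fun e => hξ (Circle.ext e)))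
      have h1 : ContinuousAt (fun r : ℝ => (1 - r ^ 2) / ‖(ξ : ℂ) - r * p‖ ^ 2) 1 :=
        ContinuousAt.div (by fun_prop) (by fun_prop) hne
      have h2 : Tendsto (fun r : ℝ => jumpKernel r p ξ) (𝓝[<] 1) (𝓝 0) := by
        rw [tendsto_zero_iff_norm_tendsto_zero]
        have h3 := h1.tendsto.mono_left (nhdsWithin_le_nhds (s := Iio 1))
        rw [one_pow, sub_self, zero_div] at h3
        refine h3.congr' ?_
        filter_upwards [hev] with r hr
        exact (norm_jumpKernel hr.1 hr.2 p ξ).symm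
      simpa using h2.smul_const (F ξ - F p)
  rw [circleMean_const] at key
  have := key.add_const (F p)
  rw [zero_add] at this
  refine this.congr' ?_
  filter_upwards [hev] with r hr
  rw [← h.cauchyT_sub_cauchyT p hr.1 hr.2, sub_add_cancel]

end BoundedLipschitz

end CauchyBounds

/-! ### Power series expansions of Cauchy integrals -/

section PowerSeries

variable {E : Type*} [NormedAddCommGroup E] [NormedSpace ℂ E] [CompleteSpace E]

theorem hasSum_circleMean {f : ℕ → Circle → E} {g : Circle → E} {u : ℕ → ℝ}
    (hf : ∀ n, Continuous (f n)) (hu : Summable u) (hfu : ∀ n ξ, ‖f n ξ‖ ≤ u n)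
    (hg : ∀ ξ, HasSum (fun n => f n ξ) (g ξ)) :
    HasSum (fun n => circleMean (f n)) (circleMean g) := by
  refine HasSum.const_smul _ ?_
  refine intervalIntegral.hasSum_integral_of_dominated_convergence (fun n _ => u n)
    (fun n => ((hf n).comp Circle.exp.continuous).aestronglyMeasurable)
    (fun n => Eventually.of_forall fun θ _ => hfu n _) (Eventually.of_forall fun θ _ => hu)
    intervalIntegrable_const (Eventually.of_forall fun θ _ => hg _)

theorem exists_norm_le {F : Circle → E} (hF : Continuous F) : ∃ C, 0 ≤ C ∧ ∀ ξ, ‖F ξ‖ ≤ C := by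
  obtain ⟨C, hC⟩ := isCompact_univ.exists_bound_of_continuousOn hF.continuousOn
  exact ⟨C, (norm_nonneg _).trans (hC 1 (mem_univ _)), fun ξ => hC ξ (mem_univ _)⟩

/-- Expansion of the Cauchy integral at the origin. -/
theorem hasSum_cauchyT {F : Circle → E} (hF : Continuous F) {x : ℂ} (hx : ‖x‖ < 1) :
    HasSum (fun n : ℕ => x ^ n • circleMean fun ξ : Circle => (ξ : ℂ) ^ (-n : ℤ) • F ξ)
      (cauchyT F x) := by
  obtain ⟨C, hC0, hC⟩ := exists_norm_le hF
  simp only [← circleMean_smul, smul_smul]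
  refine hasSum_circleMean (u := fun n => ‖x‖ ^ n * C) (fun n => ?_)
    ((summable_geometric_of_lt_one (norm_nonneg x) hx).mul_right C) (fun n ξ => ?_) fun ξ => ?_
  · exact (continuous_const.mul (continuous_circle_coe.zpow₀ _ fun ξ =>
      Or.inl (Circle.coe_ne_zero ξ))).smul hF
  · rw [norm_smul, norm_mul, norm_pow, norm_zpow, Circle.norm_coe, one_zpow, mul_one]
    exact mul_le_mul_of_nonneg_left (hC ξ) (by positivity)
  · refine HasSum.smul_const ?_ (F ξ)
    have h0 := Circle.coe_ne_zero ξ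
    have h1 := coe_sub_ne_zero hx.ne ξ
    have h2 : ‖x / ξ‖ < 1 := by rwa [norm_div, Circle.norm_coe, div_one]
    convert hasSum_geometric_of_norm_lt_one h2 using 1
    · funext n
      rw [zpow_neg, zpow_natCast, div_pow, div_eq_mul_inv]
    · rw [← inv_div, sub_div, div_self h0]

/-- Expansion of the Cauchy integral at infinity. -/
theorem hasSum_cauchyT_of_one_lt {F : Circle → E} (hF : Continuous F) {x : ℂ} (hx : 1 < ‖x‖) :
    HasSum (fun n : ℕ => -((x ^ (n + 1))⁻¹ •
      circleMean fun ξ : Circle => (ξ : ℂ) ^ (n + 1 : ℤ) • F ξ)) (cauchyT F x) := by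
  obtain ⟨C, hC0, hC⟩ := exists_norm_le hF
  have hx0 : x ≠ 0 := norm_pos_iff.1 (by linarith)
  have hxi : ‖x‖⁻¹ < 1 := inv_lt_one_of_one_lt₀ hx
  simp only [← circleMean_smul, ← circleMean_neg, smul_smul, ← neg_smul]
  refine hasSum_circleMean (u := fun n => ‖x‖⁻¹ ^ n * C) (fun n => ?_)
    ((summable_geometric_of_lt_one (by positivity) hxi).mul_right C) (fun n ξ => ?_) fun ξ => ?_
  · exact (continuous_const.mul (continuous_circle_coe.zpow₀ _ fun ξ =>
      Or.inl (Circle.coe_ne_zero ξ))).neg.smul hF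
  · rw [norm_smul, norm_neg, norm_mul, norm_inv, norm_pow, norm_zpow, Circle.norm_coe, one_zpow,
      mul_one, ← inv_pow]
    refine mul_le_mul ?_ (hC ξ) (norm_nonneg _) (by positivity)
    exact pow_le_pow_of_le_one (by positivity) hxi.le n.le_succ
  · refine HasSum.smul_const ?_ (F ξ)
    have h1 := coe_sub_ne_zero hx.ne' ξ
    have h2 : ‖(ξ : ℂ) / x‖ < 1 := by rwa [norm_div, Circle.norm_coe, one_div]
    have h4 := (hasSum_geometric_of_norm_lt_one h2).mul_left (-((ξ : ℂ) / x))
    convert h4 using 1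
    · rfl
    · funext n
      have : ((n : ℤ) + 1) = ((n + 1 : ℕ) : ℤ) := by push_cast; rfl
      rw [this, zpow_natCast, div_pow]
      field_simp
      ring
    · have h3 : 1 - (ξ : ℂ) / x = -(ξ - x) / x := by field_simp; ring
      rw [h3]
      field_simp

end PowerSeries

/-! ### Differentiation of bounded limits -/

section Limits

variable {E : Type*} [NormedAddCommGroup E] [NormedSpace ℝ E] [CompleteSpace E]

/-- If the derivatives of `H r` converge boundedly and pointwise to a continuous function, then the
pointwise limit of `H r` is differentiable, with the limit of the derivatives as its derivative. -/
theorem hasDerivAt_of_tendsto_of_bounded {ι : Type*} {l : Filter ι} [l.IsCountablyGenerated]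
    [l.NeBot] {H H' : ι → ℝ → E} {h h' : ℝ → E} {I : Set ℝ} (hI : IsOpen I) (hI' : I.OrdConnected)
    {C : ℝ} (hH : ∀ᶠ r in l, ∀ t ∈ I, HasDerivAt (H r) (H' r t) t)
    (hc : ∀ᶠ r in l, ContinuousOn (H' r) I) (hb : ∀ᶠ r in l, ∀ t ∈ I, ‖H' r t‖ ≤ C)
    (hlim : ∀ t ∈ I, Tendsto (fun r => H r t) l (𝓝 (h t)))
    (hlim' : ∀ t ∈ I, Tendsto (fun r => H' r t) l (𝓝 (h' t)))
    (hh' : ContinuousOn h' I) {t : ℝ} (ht : t ∈ I) : HasDerivAt h (h' t) t := by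
  have key : ∀ s ∈ I, h s = h t + ∫ τ in t..s, h' τ := by
    intro s hs
    have hsub : uIcc t s ⊆ I := hI'.uIcc_subset ht hs
    have h1 : Tendsto (fun r => ∫ τ in t..s, H' r τ) l (𝓝 (∫ τ in t..s, h' τ)) := by
      refine intervalIntegral.tendsto_integral_filter_of_dominated_convergence (fun _ => C) ?_ ?_
        intervalIntegrable_const ?_
      · filter_upwards [hc] with r hr
        exact ((hr.mono hsub).mono uIoc_subset_uIcc).aestronglyMeasurable measurableSet_uIoc
      · filter_upwards [hb] with r hr
        exact Eventually.of_forall fun τ hτ => hr τ (hsub (uIoc_subset_uIcc hτ))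
      · exact Eventually.of_forall fun τ hτ => hlim' τ (hsub (uIoc_subset_uIcc hτ))
    have h2 : Tendsto (fun r => H r s - H r t) l (𝓝 (∫ τ in t..s, h' τ)) := by
      refine h1.congr' ?_
      filter_upwards [hH, hc] with r hr hcr
      exact intervalIntegral.integral_eq_sub_of_hasDerivAt (fun τ hτ => hr τ (hsub hτ))
        (hcr.mono hsub).intervalIntegrable
    rw [← tendsto_nhds_unique ((hlim s hs).sub (hlim t ht)) h2]
    abel
  have hev : h =ᶠ[𝓝 t] fun s => h t + ∫ τ in t..s, h' τ := by
    filter_upwards [hI.mem_nhds ht] with s hs using key s hs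
  refine HasDerivAt.congr_of_eventuallyEq ?_ hev
  refine HasDerivAt.const_add _ ?_
  exact intervalIntegral.integral_hasDerivAt_right IntervalIntegrable.refl
    (hh'.stronglyMeasurableAtFilter hI t ht) (hh'.continuousAt (hI.mem_nhds ht))

end Limits

/-! ### Linear differential equations on the unit disk -/

section Disk

variable {E : Type*} [NormedAddCommGroup E] [NormedSpace ℂ E]

/-- Grönwall's inequality along the radii of the disk. -/
theorem norm_le_of_hasDerivAt_ball {f f' : ℂ → E} {K : ℝ}
    (hf : ∀ x ∈ Metric.ball (0 : ℂ) 1, HasDerivAt f (f' x) x)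
    (hK : ∀ x ∈ Metric.ball (0 : ℂ) 1, ‖f' x‖ ≤ K * ‖f x‖) {x : ℂ}
    (hx : x ∈ Metric.ball (0 : ℂ) 1) : ‖f x‖ ≤ ‖f 0‖ * Real.exp K := by
  rw [mem_ball_zero_iff] at hx
  have hK' : ∀ y ∈ Metric.ball (0 : ℂ) 1, ‖f' y‖ ≤ |K| * ‖f y‖ := fun y hy =>
    (hK y hy).trans (mul_le_mul_of_nonneg_right (le_abs_self K) (norm_nonneg _))
  have hm : ∀ t ∈ Icc (0 : ℝ) 1, (t : ℂ) * x ∈ Metric.ball (0 : ℂ) 1 := fun t ht => by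
    rw [mem_ball_zero_iff, norm_mul, Complex.norm_real, Real.norm_of_nonneg ht.1]
    nlinarith [ht.2, norm_nonneg x]
  have hd : ∀ t ∈ Icc (0 : ℝ) 1,
      HasDerivAt (fun t : ℝ => f (t * x)) (x • f' (t * x)) t := fun t ht => by
    have h1 : HasDerivAt (fun t : ℝ => (t : ℂ) * x) x t := by
      simpa using (Complex.ofRealCLM.hasDerivAt (x := t)).mul_const x
    exact (hf _ (hm t ht)).scomp t h1
  -- For `K < 0` the hypothesis forces `f` to vanish.
  by_cases hK0 : 0 ≤ K
  · have := norm_le_gronwallBound_of_norm_deriv_right_le (f := fun t : ℝ => f (t * x))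
      (δ := ‖f 0‖) (K := K) (ε := 0) (fun t ht => (hd t ht).continuousAt.continuousWithinAt)
      (fun t ht => (hd t (Ico_subset_Icc_self ht)).hasDerivWithinAt) (by simp)
      (fun t ht => by
        rw [norm_smul, add_zero]
        have h1 := hK _ (hm t (Ico_subset_Icc_self ht))
        nlinarith [norm_nonneg (f' (t * x)), norm_nonneg x]) 1 (right_mem_Icc.2 zero_le_one)
    rw [gronwallBound_ε0] at this
    simpa using this
  · have h0 : ∀ y ∈ Metric.ball (0 : ℂ) 1, f y = 0 := fun y hy => by
      have h1 := hK y hy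
      have h2 := norm_nonneg (f' y)
      by_contra h3
      have h4 := norm_pos_iff.2 h3
      nlinarith
    rw [h0 x (by simpa using hx), norm_zero]
    positivity

theorem lipschitzOnWith_of_hasDerivAt_ball {f f' : ℂ → E} {K : ℝ} (hK0 : 0 ≤ K)
    (hf : ∀ x ∈ Metric.ball (0 : ℂ) 1, HasDerivAt f (f' x) x)
    (hK : ∀ x ∈ Metric.ball (0 : ℂ) 1, ‖f' x‖ ≤ K * ‖f x‖) :
    LipschitzOnWith (K * (‖f 0‖ * Real.exp K)).toNNReal f (Metric.ball 0 1) := by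
  refine (convex_ball (0 : ℂ) 1).lipschitzOnWith_of_nnnorm_hasDerivWithin_le
    (fun x hx => (hf x hx).hasDerivWithinAt) fun x hx => ?_
  rw [← NNReal.coe_le_coe, coe_nnnorm, Real.coe_toNNReal _ (by positivity)]
  exact (hK x hx).trans (mul_le_mul_of_nonneg_left (norm_le_of_hasDerivAt_ball hf hK hx) hK0)

/-- The extension by continuity of a function on the open unit disk to the closed disk. It is used
only for functions that are Lipschitz on the open disk, for which it exists. -/
def diskExt (f : ℂ → E) : ℂ → E := extendFrom (Metric.ball 0 1) f

theorem mem_closedBall_circle (p : Circle) : (p : ℂ) ∈ Metric.closedBall (0 : ℂ) 1 := by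
  rw [mem_closedBall_zero_iff, Circle.norm_coe]

variable [CompleteSpace E]

section Lipschitz

variable {f : ℂ → E} {C : NNReal} (hf : LipschitzOnWith C f (Metric.ball 0 1))

include hf

theorem continuousOn_diskExt : ContinuousOn (diskExt f) (Metric.closedBall 0 1) := by
  refine continuousOn_extendFrom (closure_ball (0 : ℂ) one_ne_zero).ge fun x hx => ?_
  rw [← closure_ball (0 : ℂ) one_ne_zero] at hx
  have := mem_closure_iff_nhdsWithin_neBot.1 hx
  refine cauchy_iff_exists_le_nhds.1 ?_
  exact (cauchy_nhds.mono nhdsWithin_le_nhds).map_of_le hf.uniformContinuousOn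
    (le_principal_iff.2 self_mem_nhdsWithin)

theorem diskExt_eq {x : ℂ} (hx : x ∈ Metric.ball (0 : ℂ) 1) : diskExt f x = f x :=
  extendFrom_extends hf.continuousOn _ hx

theorem lipschitzOnWith_diskExt : LipschitzOnWith C (diskExt f) (Metric.closedBall 0 1) := by
  have h1 : LipschitzOnWith C (diskExt f) (Metric.ball 0 1) := fun x hx y hy => by
    rw [diskExt_eq hf hx, diskExt_eq hf hy]
    exact hf hx hy
  have h2 := continuousOn_diskExt hf
  rw [← closure_ball (0 : ℂ) one_ne_zero] at h2 ⊢
  exact h1.closure h2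

theorem tendsto_diskExt {x : ℂ} (hx : x ∈ Metric.closedBall (0 : ℂ) 1) :
    Tendsto f (𝓝[Metric.ball 0 1] x) (𝓝 (diskExt f x)) := by
  have h1 := ((continuousOn_diskExt hf) x hx).mono Metric.ball_subset_closedBall
  refine h1.tendsto.congr' ?_
  filter_upwards [self_mem_nhdsWithin] with y hy using diskExt_eq hf hy

theorem tendsto_diskExt_radial (p : Circle) :
    Tendsto (fun r : ℝ => f (r * p)) (𝓝[<] 1) (𝓝 (diskExt f p)) := by
  refine (tendsto_diskExt hf (mem_closedBall_circle p)).comp ?_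
  refine tendsto_nhdsWithin_iff.2 ⟨?_, ?_⟩
  · have : ContinuousAt (fun r : ℝ => (r : ℂ) * p) 1 := by fun_prop
    have h := this.tendsto.mono_left (nhdsWithin_le_nhds (s := Iio 1))
    simpa using h
  · filter_upwards [self_mem_nhdsWithin,
      mem_nhdsWithin_of_mem_nhds (lt_mem_nhds (zero_lt_one' ℝ))] with r h1 h2
    rw [mem_ball_zero_iff, norm_mul_circle h2.le]
    exact h1

theorem norm_diskExt_le {D : ℝ} (hD : ∀ x ∈ Metric.ball (0 : ℂ) 1, ‖f x‖ ≤ D) (p : Circle) :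
    ‖diskExt f p‖ ≤ D := by
  refine le_of_tendsto (tendsto_diskExt_radial hf p).norm ?_
  filter_upwards [self_mem_nhdsWithin,
      mem_nhdsWithin_of_mem_nhds (lt_mem_nhds (zero_lt_one' ℝ))] with r h1 h2
  refine hD _ ?_
  rw [mem_ball_zero_iff, norm_mul_circle h2.le]
  exact h1

theorem diffContOnCl_diskExt (hd : DifferentiableOn ℂ f (Metric.ball 0 1)) :
    DiffContOnCl ℂ (diskExt f) (Metric.ball 0 1) := by
  refine ⟨hd.congr fun x hx => diskExt_eq hf hx, ?_⟩
  rw [closure_ball (0 : ℂ) one_ne_zero]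
  exact continuousOn_diskExt hf

end Lipschitz

end Disk

section DiskSolution

variable {𝔸 : Type*} [NormedRing 𝔸] [NormedAlgebra ℂ 𝔸] [CompleteSpace 𝔸]

theorem _root_.HasDerivAt.ringInverse {𝕜 : Type*} [NontriviallyNormedField 𝕜] [NormedAlgebra 𝕜 𝔸]
    {y : 𝕜 → 𝔸} {y' : 𝔸} {x : 𝕜} (h : HasDerivAt y y' x) (hu : IsUnit (y x)) :
    HasDerivAt (fun t => Ring.inverse (y t)) (-(Ring.inverse (y x) * y' * Ring.inverse (y x))) x := by
  obtain ⟨u, hu⟩ := hu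
  have h1 := hasFDerivAt_ringInverse (𝕜 := 𝕜) u
  rw [hu] at h1
  have h2 := h1.comp_hasDerivAt x h
  rw [← hu, Ring.inverse_unit]
  exact h2

/-- `y` is an invertible solution on the unit disk of the system `y' = 𝒜 y`, where `𝒜` is the Cauchy
integral of `F`. -/
structure DiskSolution (F : Circle → 𝔸) (y : ℂ → 𝔸) : Prop where
  isUnit : ∀ x ∈ Metric.ball (0 : ℂ) 1, IsUnit (y x)
  ode : ∀ x ∈ Metric.ball (0 : ℂ) 1, HasDerivAt y (cauchyT F x * y x) x

namespace DiskSolution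

variable {F : Circle → 𝔸} {y : ℂ → 𝔸} {L D : ℝ}

theorem hasDerivAt_inverse (h : DiskSolution F y) {x : ℂ} (hx : x ∈ Metric.ball (0 : ℂ) 1) :
    HasDerivAt (fun x => Ring.inverse (y x)) (-(Ring.inverse (y x) * cauchyT F x)) x := by
  convert (h.ode x hx).ringInverse (h.isUnit x hx) using 1
  rw [mul_assoc, mul_assoc, Ring.mul_inverse_cancel _ (h.isUnit x hx), mul_one]

variable (h : DiskSolution F y) (hF : BoundedLipschitz F L)

include h hF

theorem norm_le {x : ℂ} (hx : x ∈ Metric.ball (0 : ℂ) 1) :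
    ‖y x‖ ≤ ‖y 0‖ * Real.exp (3 * L) :=
  norm_le_of_hasDerivAt_ball h.ode (fun x hx => (norm_mul_le _ _).trans
    (mul_le_mul_of_nonneg_right (hF.norm_cauchyT_le (by simpa using hx)) (norm_nonneg _))) hx

theorem norm_inverse_le {x : ℂ} (hx : x ∈ Metric.ball (0 : ℂ) 1) :
    ‖Ring.inverse (y x)‖ ≤ ‖Ring.inverse (y 0)‖ * Real.exp (3 * L) :=
  norm_le_of_hasDerivAt_ball (fun _ hx => h.hasDerivAt_inverse hx)
    (fun x hx => by
      rw [norm_neg, mul_comm (3 * L)]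
      exact (norm_mul_le _ _).trans
        (mul_le_mul_of_nonneg_left (hF.norm_cauchyT_le (by simpa using hx)) (norm_nonneg _))) hx

theorem lipschitz : LipschitzOnWith (3 * L * (‖y 0‖ * Real.exp (3 * L))).toNNReal y
    (Metric.ball 0 1) :=
  lipschitzOnWith_of_hasDerivAt_ball (by linarith [hF.nonneg]) h.ode
    (fun x hx => (norm_mul_le _ _).trans
    (mul_le_mul_of_nonneg_right (hF.norm_cauchyT_le (by simpa using hx)) (norm_nonneg _)))

theorem lipschitz_inverse :
    LipschitzOnWith (3 * L * (‖Ring.inverse (y 0)‖ * Real.exp (3 * L))).toNNReal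
      (fun x => Ring.inverse (y x)) (Metric.ball 0 1) :=
  lipschitzOnWith_of_hasDerivAt_ball (by linarith [hF.nonneg])
    (fun _ hx => h.hasDerivAt_inverse hx)
    (fun x hx => by
      rw [norm_neg, mul_comm (3 * L)]
      exact (norm_mul_le _ _).trans
        (mul_le_mul_of_nonneg_left (hF.norm_cauchyT_le (by simpa using hx)) (norm_nonneg _)))

theorem diskExt_mul_inverse (p : Circle) :
    diskExt y p * diskExt (fun x => Ring.inverse (y x)) p = 1 := by
  refine tendsto_nhds_unique ((tendsto_diskExt_radial (h.lipschitz hF) p).mul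
    (tendsto_diskExt_radial (h.lipschitz_inverse hF) p)) (tendsto_const_nhds.congr' ?_)
  filter_upwards [self_mem_nhdsWithin,
      mem_nhdsWithin_of_mem_nhds (lt_mem_nhds (zero_lt_one' ℝ))] with r h1 h2
  refine (Ring.mul_inverse_cancel _ (h.isUnit _ ?_)).symm
  rw [mem_ball_zero_iff, norm_mul_circle h2.le]
  exact h1

theorem inverse_mul_diskExt (p : Circle) :
    diskExt (fun x => Ring.inverse (y x)) p * diskExt y p = 1 := by
  refine tendsto_nhds_unique ((tendsto_diskExt_radial (h.lipschitz_inverse hF) p).mul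
    (tendsto_diskExt_radial (h.lipschitz hF) p)) (tendsto_const_nhds.congr' ?_)
  filter_upwards [self_mem_nhdsWithin,
      mem_nhdsWithin_of_mem_nhds (lt_mem_nhds (zero_lt_one' ℝ))] with r h1 h2
  refine (Ring.inverse_mul_cancel _ (h.isUnit _ ?_)).symm
  rw [mem_ball_zero_iff, norm_mul_circle h2.le]
  exact h1

theorem isUnit_diskExt (p : Circle) : IsUnit (diskExt y p) :=
  ⟨⟨_, _, h.diskExt_mul_inverse hF p, h.inverse_mul_diskExt hF p⟩, rfl⟩

/-- Inversion commutes with the extension to the boundary. -/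
theorem inverse_diskExt (p : Circle) :
    Ring.inverse (diskExt y p) = diskExt (fun x => Ring.inverse (y x)) p :=
  Ring.inverse_unit ⟨_, _, h.diskExt_mul_inverse hF p, h.inverse_mul_diskExt hF p⟩

end DiskSolution

end DiskSolution

theorem hasDerivAt_coe_exp (θ : ℝ) :
    HasDerivAt (fun θ : ℝ => (Circle.exp θ : ℂ)) (Complex.I * Circle.exp θ) θ := by
  simp only [Circle.coe_exp]
  have h : HasDerivAt (fun θ : ℝ => (θ : ℂ) * Complex.I) Complex.I θ := by
    simpa using (Complex.ofRealCLM.hasDerivAt (x := θ)).mul_const Complex.I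
  simpa [mul_comm] using h.cexp

theorem hasDerivAt_coe_exp_inv (θ : ℝ) :
    HasDerivAt (fun θ : ℝ => (((Circle.exp θ)⁻¹ : Circle) : ℂ))
      (-(Complex.I * ((Circle.exp θ)⁻¹ : Circle))) θ := by
  have h := (hasDerivAt_coe_exp (-θ)).scomp θ (hasDerivAt_neg θ)
  simp only [Function.comp_def, Circle.exp_neg, neg_smul, one_smul] at h
  exact h

theorem eventually_mem_Ioo_one : ∀ᶠ r : ℝ in 𝓝[<] 1, 0 < r ∧ r < 1 := by
  filter_upwards [self_mem_nhdsWithin,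
    mem_nhdsWithin_of_mem_nhds (lt_mem_nhds (zero_lt_one' ℝ))] with r h1 h2 using ⟨h2, h1⟩

theorem mul_circle_mem_ball {r : ℝ} (hr : 0 < r ∧ r < 1) (p : Circle) :
    (r : ℂ) * p ∈ Metric.ball (0 : ℂ) 1 := by
  rw [mem_ball_zero_iff, norm_mul_circle hr.1.le]
  exact hr.2

/-! ### The jump of the connection form -/

section Jump

variable {E : Type*} [NormedAddCommGroup E] [NormedSpace ℂ E] [CompleteSpace E]
  {F : Circle → E} {L : ℝ}

theorem cauchyT_div_eq (hF : Continuous F) (hF0 : circleMean (fun ξ : Circle => (ξ : ℂ) • F ξ) = 0)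
    (p : Circle) {r : ℝ} (hr : 0 < r ∧ r < 1) :
    cauchyT F (p / r) = -(((r : ℂ) * (p⁻¹ : Circle)) ^ 2 • cauchyT (flip F) (r * (p⁻¹ : Circle))) := by
  have hw : ‖(r : ℂ) * (p⁻¹ : Circle)‖ < 1 := by simpa using mul_circle_mem_ball hr p⁻¹
  have hw0 : (r : ℂ) * (p⁻¹ : Circle) ≠ 0 :=
    mul_ne_zero (by exact_mod_cast hr.1.ne') (Circle.coe_ne_zero _)
  rw [cauchyT_flip hF hF0 hw hw0, neg_neg, mul_inv, Circle.coe_inv, inv_inv, div_eq_mul_inv,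
    mul_comm]

/-- The sum, up to a factor `i`, of the angular components of the connection forms at `x = r p` inside
of the circle and at `w = r / p` in the coordinate `w = 1/x` outside of it. The logarithmic derivative
of the monodromy regularized at radius `r` is conjugate to it. -/
def angularJump (F : Circle → E) (r : ℝ) (p : Circle) : E :=
  ((r : ℂ) * p) • cauchyT F (r * p)
    + ((r : ℂ) * (p⁻¹ : Circle)) • cauchyT (flip F) (r * (p⁻¹ : Circle))

/-- The angular jump is the Plemelj jump up to a term of order `1 - r`. -/
theorem angularJump_eq (hF : Continuous F)
    (hF0 : circleMean (fun ξ : Circle => (ξ : ℂ) • F ξ) = 0) (p : Circle) {r : ℝ}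
    (hr : 0 < r ∧ r < 1) :
    angularJump F r p = (p : ℂ) • (cauchyT F (r * p) - cauchyT F (p / r)) -
      (1 - r : ℂ) • ((p : ℂ) • cauchyT F (r * p)
        - ((r : ℂ) * (p⁻¹ : Circle)) • cauchyT (flip F) (r * (p⁻¹ : Circle))) := by
  rw [cauchyT_div_eq hF hF0 p hr, angularJump]
  generalize cauchyT F (r * p) = a
  generalize cauchyT (flip F) (r * (p⁻¹ : Circle)) = b
  have hp := Circle.coe_ne_zero p
  rw [Circle.coe_inv]
  match_scalars
  · ring
  · field_simp
    ring

theorem norm_angularJump_aux (hF : BoundedLipschitz F L) (p : Circle) {r : ℝ}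
    (hr : 0 < r ∧ r < 1) :
    ‖(p : ℂ) • cauchyT F (r * p)
        - ((r : ℂ) * (p⁻¹ : Circle)) • cauchyT (flip F) (r * (p⁻¹ : Circle))‖ ≤ 15 * L := by
  have h1 := hF.norm_cauchyT_le (x := r * p) (by simpa using mul_circle_mem_ball hr p)
  have h2 := hF.flip.norm_cauchyT_le (x := r * (p⁻¹ : Circle))
    (by simpa using mul_circle_mem_ball hr p⁻¹)
  have h3 := norm_sub_le ((p : ℂ) • cauchyT F (r * p))
    (((r : ℂ) * (p⁻¹ : Circle)) • cauchyT (flip F) (r * (p⁻¹ : Circle)))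
  rw [norm_smul, norm_smul, Circle.norm_coe, one_mul, norm_mul_circle hr.1.le] at h3
  nlinarith [norm_nonneg (cauchyT (flip F) (r * (p⁻¹ : Circle))), hr.1, hr.2]

theorem norm_angularJump_le (hF : BoundedLipschitz F L)
    (hF0 : circleMean (fun ξ : Circle => (ξ : ℂ) • F ξ) = 0) (p : Circle) {r : ℝ}
    (hr : 0 < r ∧ r < 1) : ‖angularJump F r p‖ ≤ 20 * L := by
  rw [angularJump_eq hF.continuous hF0 p hr]
  refine (norm_sub_le _ _).trans ?_
  have h1 := hF.norm_jump_le p hr.1 hr.2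
  have h2 := norm_angularJump_aux hF p hr
  have h3 : ‖(1 - r : ℂ)‖ = 1 - r := by
    rw [← Complex.ofReal_one, ← Complex.ofReal_sub, Complex.norm_real,
      Real.norm_of_nonneg (by linarith [hr.2])]
  rw [norm_smul, norm_smul, Circle.norm_coe, one_mul, h3]
  nlinarith [norm_nonneg ((p : ℂ) • cauchyT F (r * p)
        - ((r : ℂ) * (p⁻¹ : Circle)) • cauchyT (flip F) (r * (p⁻¹ : Circle))), hr.1]

theorem tendsto_angularJump (hF : BoundedLipschitz F L)
    (hF0 : circleMean (fun ξ : Circle => (ξ : ℂ) • F ξ) = 0) (p : Circle) :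
    Tendsto (fun r : ℝ => angularJump F r p) (𝓝[<] 1) (𝓝 ((p : ℂ) • F p)) := by
  have h1 := (hF.tendsto_jump p).const_smul (p : ℂ)
  have h2 : Tendsto (fun r : ℝ => (1 - r : ℂ)) (𝓝[<] 1) (𝓝 0) := by
    have : ContinuousAt (fun r : ℝ => (1 - r : ℂ)) 1 := by fun_prop
    simpa using this.tendsto.mono_left (nhdsWithin_le_nhds (s := Iio 1))
  have h3 := (h2.zero_smul_isBoundedUnder_le (g := fun r : ℝ => (p : ℂ) • cauchyT F (r * p)
        - ((r : ℂ) * (p⁻¹ : Circle)) • cauchyT (flip F) (r * (p⁻¹ : Circle)))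
    ⟨15 * L, by
      rw [eventually_map]
      filter_upwards [eventually_mem_Ioo_one] with r hr using norm_angularJump_aux hF p hr⟩)
  have h4 := h1.sub h3
  rw [sub_zero] at h4
  refine h4.congr' ?_
  filter_upwards [eventually_mem_Ioo_one] with r hr
  exact (angularJump_eq hF.continuous hF0 p hr).symm

end Jump

/-! ### Monodromy along the circle -/

section Monodromy

variable {𝔸 : Type*} [NormedRing 𝔸] [NormedAlgebra ℂ 𝔸] [CompleteSpace 𝔸]

/-- The monodromy `(Y⁻)⁻¹ Y⁺` at the point `p` of the circle of the function `Y` given by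
`Y(x) = y(x)` inside and by `Y(x) = z(1/x)` outside of the circle. -/
def monodromy (y z : ℂ → 𝔸) (p : Circle) : 𝔸 :=
  Ring.inverse (diskExt z (p⁻¹ : Circle)) * diskExt y p

variable {F : Circle → 𝔸} {y z : ℂ → 𝔸} {L : ℝ}

theorem tendsto_monodromy (hF : BoundedLipschitz F L) (hy : DiskSolution F y)
    (hz : DiskSolution (flip F) z) (p : Circle) :
    Tendsto (fun r : ℝ => Ring.inverse (z (r * (p⁻¹ : Circle))) * y (r * p)) (𝓝[<] 1)
      (𝓝 (monodromy y z p)) := by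
  rw [monodromy, hz.inverse_diskExt hF.flip]
  exact (tendsto_diskExt_radial (hz.lipschitz_inverse hF.flip) p⁻¹).mul
    (tendsto_diskExt_radial (hy.lipschitz hF) p)

theorem continuous_diskExt_coe {E : Type*} [NormedAddCommGroup E] [NormedSpace ℂ E]
    [CompleteSpace E] {f : ℂ → E} {C : NNReal} (hf : LipschitzOnWith C f (Metric.ball 0 1)) :
    Continuous fun p : Circle => diskExt f p :=
  (continuousOn_diskExt hf).comp_continuous continuous_circle_coe mem_closedBall_circle

theorem continuous_monodromy (hF : BoundedLipschitz F L) (hy : DiskSolution F y)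
    (hz : DiskSolution (flip F) z) : Continuous (monodromy y z) := by
  have h1 : Continuous fun p : Circle =>
      diskExt (fun x => Ring.inverse (z x)) (p⁻¹ : Circle) :=
    (continuous_diskExt_coe (hz.lipschitz_inverse hF.flip)).comp continuous_inv
  have h2 : monodromy y z = fun p : Circle =>
      diskExt (fun x => Ring.inverse (z x)) (p⁻¹ : Circle) * diskExt y p :=
    funext fun p => by rw [monodromy, hz.inverse_diskExt hF.flip]
  rw [h2]
  exact h1.mul (continuous_diskExt_coe (hy.lipschitz hF))

/-- The derivative of the monodromy along the circle: `dG/dξ = (Y⁻)⁻¹ A Y⁺`. Differentiating along the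
circles of radius `r < 1` in both charts produces the angular jump, which tends boundedly to `ξ A(ξ)`
as `r → 1`. -/
theorem hasDerivAt_monodromy (hF : BoundedLipschitz F L)
    (hF0 : circleMean (fun ξ : Circle => (ξ : ℂ) • F ξ) = 0) (hy : DiskSolution F y)
    (hz : DiskSolution (flip F) z) (θ : ℝ) :
    HasDerivAt (fun θ : ℝ => monodromy y z (Circle.exp θ))
      (Ring.inverse (diskExt z ((Circle.exp θ)⁻¹ : Circle)) *
        ((Complex.I * Circle.exp θ) • F (Circle.exp θ)) * diskExt y (Circle.exp θ)) θ := by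
  set a : ℂ → 𝔸 := cauchyT F
  set b : ℂ → 𝔸 := cauchyT (flip F)
  refine hasDerivAt_of_tendsto_of_bounded (l := 𝓝[<] (1 : ℝ)) (I := univ)
    (H := fun r θ => Ring.inverse (z (r * ((Circle.exp θ)⁻¹ : Circle))) * y (r * Circle.exp θ))
    (H' := fun r θ => Ring.inverse (z (r * ((Circle.exp θ)⁻¹ : Circle))) *
      (Complex.I • angularJump F r (Circle.exp θ)) * y (r * Circle.exp θ))
    (h' := fun θ => Ring.inverse (diskExt z ((Circle.exp θ)⁻¹ : Circle)) *
        ((Complex.I * Circle.exp θ) • F (Circle.exp θ)) * diskExt y (Circle.exp θ))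
    (C := ‖Ring.inverse (z 0)‖ * Real.exp (3 * (4 * L)) * (20 * L) *
      (‖y 0‖ * Real.exp (3 * L)))
    isOpen_univ ordConnected_univ ?_ ?_ ?_ ?_ ?_ ?_ (mem_univ θ)
  · filter_upwards [eventually_mem_Ioo_one] with r hr θ _
    have hx := mul_circle_mem_ball hr (Circle.exp θ)
    have hw := mul_circle_mem_ball hr (Circle.exp θ)⁻¹
    have h1 := (hy.ode _ hx).scomp θ ((hasDerivAt_coe_exp θ).const_mul (r : ℂ))
    have h2 := (hz.hasDerivAt_inverse hw).scomp θ ((hasDerivAt_coe_exp_inv θ).const_mul (r : ℂ))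
    have h3 := h2.mul h1
    simp only [Function.comp_def] at h3
    refine HasDerivAt.congr_deriv h3 ?_
    rw [angularJump]
    simp only [smul_add, mul_add, add_mul, smul_mul_assoc, mul_smul_comm, mul_neg, smul_neg,
      neg_smul, neg_neg, smul_smul, mul_assoc]
    rw [add_comm]
    congr 2 <;> ring_nf
  · filter_upwards [eventually_mem_Ioo_one] with r hr
    refine continuousOn_univ.2 (continuous_iff_continuousAt.2 fun θ => ?_)
    have hx := mul_circle_mem_ball hr (Circle.exp θ)
    have hw := mul_circle_mem_ball hr (Circle.exp θ)⁻¹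
    have cx : ContinuousAt (fun θ : ℝ => (r : ℂ) * (Circle.exp θ : ℂ)) θ :=
      ((hasDerivAt_coe_exp θ).const_mul (r : ℂ)).continuousAt
    have cw : ContinuousAt (fun θ : ℝ => (r : ℂ) * (((Circle.exp θ)⁻¹ : Circle) : ℂ)) θ :=
      ((hasDerivAt_coe_exp_inv θ).const_mul (r : ℂ)).continuousAt
    have c1 := ContinuousAt.comp (f := fun θ : ℝ => (r : ℂ) * (Circle.exp θ : ℂ)) (x := θ)
      (hy.ode _ hx).continuousAt cx
    have c2 := ContinuousAt.comp (f := fun θ : ℝ => (r : ℂ) * (((Circle.exp θ)⁻¹ : Circle) : ℂ))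
      (x := θ) (hz.hasDerivAt_inverse hw).continuousAt cw
    have c3 := ContinuousAt.comp (f := fun θ : ℝ => (r : ℂ) * (Circle.exp θ : ℂ)) (x := θ)
      (continuousAt_cauchyT hF.continuous (by simpa using hx)) cx
    have c4 := ContinuousAt.comp (f := fun θ : ℝ => (r : ℂ) * (((Circle.exp θ)⁻¹ : Circle) : ℂ))
      (x := θ) (continuousAt_cauchyT hF.flip.continuous (by simpa using hw)) cw
    exact (c2.mul (((cx.smul c3).add (cw.smul c4)).const_smul Complex.I)).mul c1
  · filter_upwards [eventually_mem_Ioo_one] with r hr θ _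
    have hx := mul_circle_mem_ball hr (Circle.exp θ)
    have hw := mul_circle_mem_ball hr (Circle.exp θ)⁻¹
    have hL := hF.nonneg
    refine norm_mul_le_of_le (norm_mul_le_of_le (hz.norm_inverse_le hF.flip hw) ?_)
      (hy.norm_le hF hx)
    rw [norm_smul, Complex.norm_I, one_mul]
    exact norm_angularJump_le hF hF0 _ hr
  · exact fun θ _ => tendsto_monodromy hF hy hz _
  · intro θ _
    rw [hz.inverse_diskExt hF.flip, ← smul_smul]
    exact ((tendsto_diskExt_radial (hz.lipschitz_inverse hF.flip) _).mul
      ((tendsto_angularJump hF hF0 _).const_smul _)).mul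
      (tendsto_diskExt_radial (hy.lipschitz hF) _)
  · have e : Continuous fun θ : ℝ => Circle.exp θ := Circle.exp.continuous
    have h1 := (continuous_diskExt_coe (hz.lipschitz_inverse hF.flip)).comp e.inv
    have h2 := (continuous_diskExt_coe (hy.lipschitz hF)).comp e
    have h3 := (h1.mul ((continuous_const (y := Complex.I)).mul
      (continuous_circle_coe.comp e) |>.smul (hF.continuous.comp e))).mul h2
    simp only [hz.inverse_diskExt hF.flip]
    exact h3.continuousOn

variable {F' : Circle → 𝔸} {y' z' : ℂ → 𝔸} {L' : ℝ}

/-- Comparison of two systems by means of their monodromies. The quotient `Y' Y⁻¹` of two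
fundamental solutions normalized at infinity has the jump `(Y')⁻ (G' - G) (Y⁺)⁻¹` across the circle,
hence it differs from the identity by the Cauchy integral of this jump. Here `Y(x) = y(x)` inside
and `Y(x) = z(1/x)` outside of the circle. -/
theorem mul_inverse_sub_one (hF : BoundedLipschitz F L) (hy : DiskSolution F y)
    (hz : DiskSolution (flip F) z) (hz0 : z 0 = 1) (hF' : BoundedLipschitz F' L')
    (hy' : DiskSolution F' y') (hz' : DiskSolution (flip F') z') (hz0' : z' 0 = 1) :
    (∀ x : ℂ, ‖x‖ < 1 → y' x * Ring.inverse (y x) - 1 = cauchyT (fun ξ =>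
      diskExt z' (ξ⁻¹ : Circle) * (monodromy y' z' ξ - monodromy y z ξ) *
        Ring.inverse (diskExt y ξ)) x) ∧
    (∀ x : ℂ, 1 < ‖x‖ → z' x⁻¹ * Ring.inverse (z x⁻¹) - 1 = cauchyT (fun ξ =>
      diskExt z' (ξ⁻¹ : Circle) * (monodromy y' z' ξ - monodromy y z ξ) *
        Ring.inverse (diskExt y ξ)) x) := by
  have d1 : DiffContOnCl ℂ (diskExt y') (Metric.ball 0 1) := diffContOnCl_diskExt
    (hy'.lipschitz hF') fun x hx => (hy'.ode x hx).differentiableAt.differentiableWithinAt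
  have d2 : DiffContOnCl ℂ (diskExt fun x => Ring.inverse (y x)) (Metric.ball 0 1) :=
    diffContOnCl_diskExt (hy.lipschitz_inverse hF) fun x hx =>
      (hy.hasDerivAt_inverse hx).differentiableAt.differentiableWithinAt
  have d3 : DiffContOnCl ℂ (diskExt z') (Metric.ball 0 1) := diffContOnCl_diskExt
    (hz'.lipschitz hF'.flip) fun x hx => (hz'.ode x hx).differentiableAt.differentiableWithinAt
  have d4 : DiffContOnCl ℂ (diskExt fun x => Ring.inverse (z x)) (Metric.ball 0 1) :=
    diffContOnCl_diskExt (hz.lipschitz_inverse hF.flip) fun x hx =>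
      (hz.hasDerivAt_inverse hx).differentiableAt.differentiableWithinAt
  -- `Zp` is `Y' Y⁻¹` inside of the circle, and `Zm` is `Y' Y⁻¹` outside of it, in the coordinate `1/x`.
  set Zp : ℂ → 𝔸 := fun x => diskExt y' x * diskExt (fun x => Ring.inverse (y x)) x with hZp
  set Zm : ℂ → 𝔸 := fun x => diskExt z' x * diskExt (fun x => Ring.inverse (z x)) x with hZm
  have dp : DiffContOnCl ℂ Zp (Metric.ball 0 1) :=
    ⟨d1.differentiableOn.mul d2.differentiableOn, d1.continuousOn.mul d2.continuousOn⟩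
  have dm : DiffContOnCl ℂ Zm (Metric.ball 0 1) :=
    ⟨d3.differentiableOn.mul d4.differentiableOn, d3.continuousOn.mul d4.continuousOn⟩
  have e0 : Zm 0 = 1 := by
    simp only [hZm]
    rw [diskExt_eq (hz'.lipschitz hF'.flip) (Metric.mem_ball_self one_pos),
      diskExt_eq (hz.lipschitz_inverse hF.flip) (Metric.mem_ball_self one_pos), hz0, hz0',
      Ring.inverse_one, one_mul]
  have ej : ∀ ξ : Circle, diskExt z' (ξ⁻¹ : Circle) * (monodromy y' z' ξ - monodromy y z ξ) *
        Ring.inverse (diskExt y ξ) = Zp ξ - Zm (ξ : ℂ)⁻¹ := by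
    intro ξ
    have u1 := hz'.isUnit_diskExt hF'.flip ξ⁻¹
    have u2 := hy.isUnit_diskExt hF ξ
    simp only [hZp, hZm]
    rw [← hy.inverse_diskExt hF, ← Circle.coe_inv, ← hz.inverse_diskExt hF.flip, monodromy,
      monodromy, mul_sub, sub_mul, ← mul_assoc, Ring.mul_inverse_cancel _ u1, one_mul,
      mul_assoc (diskExt z' _), mul_assoc (Ring.inverse _), Ring.mul_inverse_cancel _ u2, mul_one]
  simp only [ej]
  have mc : ∀ ξ : Circle, (ξ : ℂ) ∈ closure (Metric.ball (0 : ℂ) 1) := fun ξ => by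
    rw [closure_ball _ one_ne_zero]; exact mem_closedBall_circle ξ
  have cp : Continuous fun ξ : Circle => Zp ξ :=
    dp.continuousOn.comp_continuous continuous_circle_coe mc
  have cm : Continuous fun ξ : Circle => Zm (ξ : ℂ)⁻¹ := by
    have := dm.continuousOn.comp_continuous (continuous_circle_coe.comp continuous_inv)
      fun ξ => mc ξ⁻¹
    simpa only [Function.comp_def, Circle.coe_inv] using this
  constructor
  · intro x hx
    have hxb : x ∈ Metric.ball (0 : ℂ) 1 := by simpa using hx
    rw [cauchyT_sub cp cm hx.ne, cauchyT_of_diffContOnCl dp hx, cauchyT_inv_of_diffContOnCl dm hx,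
      e0]
    simp only [hZp]
    rw [diskExt_eq (hy'.lipschitz hF') hxb, diskExt_eq (hy.lipschitz_inverse hF) hxb]
  · intro x hx
    have hxb : x⁻¹ ∈ Metric.ball (0 : ℂ) 1 := by
      rw [mem_ball_zero_iff, norm_inv]; exact inv_lt_one_of_one_lt₀ hx
    rw [cauchyT_sub cp cm hx.ne', cauchyT_of_diffContOnCl_of_one_lt dp hx,
      cauchyT_inv_of_diffContOnCl_of_one_lt dm hx, e0]
    simp only [hZm]
    rw [diskExt_eq (hz'.lipschitz hF'.flip) hxb, diskExt_eq (hz.lipschitz_inverse hF.flip) hxb]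
    abel

end Monodromy

/-! ### Displacements -/

namespace Vect2

theorem disp_add (u v : Vect2) (θ : ℝ) : (u + v).disp θ = u.disp θ + v.disp θ := rfl
theorem disp_sub (u v : Vect2) (θ : ℝ) : (u - v).disp θ = u.disp θ - v.disp θ := rfl
theorem disp_smul (c : ℝ) (u : Vect2) (θ : ℝ) : (c • u).disp θ = c * u.disp θ := rfl
theorem deriv1_sub (u v : Vect2) (θ : ℝ) : (u - v).deriv1 θ = u.deriv1 θ - v.deriv1 θ := rfl
theorem deriv1_add (u v : Vect2) (θ : ℝ) : (u + v).deriv1 θ = u.deriv1 θ + v.deriv1 θ := rfl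

theorem abs_disp_le (u : Vect2) (θ : ℝ) : |u.disp θ| ≤ ‖u‖ :=
  (u.1.1.norm_coe_le_norm θ).trans (le_max_left _ _)

theorem abs_deriv1_le (u : Vect2) (θ : ℝ) : |u.deriv1 θ| ≤ ‖u‖ :=
  (u.1.2.1.norm_coe_le_norm θ).trans ((le_max_left _ _).trans (le_max_right _ _))

theorem abs_deriv2_le (u : Vect2) (θ : ℝ) : |u.deriv2 θ| ≤ ‖u‖ :=
  (u.1.2.2.norm_coe_le_norm θ).trans ((le_max_right _ _).trans (le_max_right _ _))

theorem norm_le {u : Vect2} {C : ℝ} (hC : 0 ≤ C) (h0 : ∀ θ, |u.disp θ| ≤ C)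
    (h1 : ∀ θ, |u.deriv1 θ| ≤ C) (h2 : ∀ θ, |u.deriv2 θ| ≤ C) : ‖u‖ ≤ C :=
  max_le ((BoundedContinuousFunction.norm_le hC).2 h0)
    (max_le ((BoundedContinuousFunction.norm_le hC).2 h1)
      ((BoundedContinuousFunction.norm_le hC).2 h2))

theorem continuous_disp (u : Vect2) : Continuous u.disp := u.1.1.continuous
theorem continuous_deriv1 (u : Vect2) : Continuous u.deriv1 := u.1.2.1.continuous
theorem continuous_deriv2 (u : Vect2) : Continuous u.deriv2 := u.1.2.2.continuous

theorem abs_disp_sub_le (u : Vect2) (s t : ℝ) : |u.disp s - u.disp t| ≤ ‖u‖ * |s - t| := by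
  have := (convex_univ (𝕜 := ℝ) (E := ℝ)).norm_image_sub_le_of_norm_hasDerivWithin_le
    (f := u.disp) (f' := u.deriv1) (C := ‖u‖) (x := t) (y := s)
    (fun x _ => (u.hasDerivAt_disp x).hasDerivWithinAt) (fun x _ => u.abs_deriv1_le x)
    (mem_univ _) (mem_univ _)
  simpa using this

theorem periodic_deriv1 (u : Vect2) : Function.Periodic u.deriv1 (2 * Real.pi) := by
  have h : u.deriv1 = deriv u.disp := funext fun θ => (u.hasDerivAt_disp θ).deriv.symm
  rw [h]
  exact periodic_deriv u.periodic

theorem periodic_deriv2 (u : Vect2) : Function.Periodic u.deriv2 (2 * Real.pi) := by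
  have h : u.deriv2 = deriv u.deriv1 := funext fun θ => (u.hasDerivAt_deriv1 θ).deriv.symm
  rw [h]
  exact periodic_deriv u.periodic_deriv1

theorem hasDerivAt_add_disp (u : Vect2) (θ : ℝ) :
    HasDerivAt (fun θ => θ + u.disp θ) (1 + u.deriv1 θ) θ :=
  (hasDerivAt_id θ).add (u.hasDerivAt_disp θ)

theorem Admissible.exists_lower_bound {u : Vect2} (hu : u.Admissible) :
    ∃ c > 0, ∀ θ, c ≤ 1 + u.deriv1 θ := by
  obtain ⟨θ₀, -, h⟩ := (isCompact_Icc (a := (0 : ℝ)) (b := 2 * Real.pi)).exists_isMinOn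
    (nonempty_Icc.2 (by positivity)) u.continuous_deriv1.continuousOn
  refine ⟨1 + u.deriv1 θ₀, hu θ₀, fun θ => ?_⟩
  obtain ⟨t, ht, e⟩ := u.periodic_deriv1.exists_mem_Ico₀ (by positivity) θ
  rw [e]
  have := h (Ico_subset_Icc_self ht)
  change u.deriv1 θ₀ ≤ u.deriv1 t at this
  linarith

/-- Admissibility is preserved, with a uniform lower bound for the derivative of `θ ↦ θ + u(θ)`, under
small perturbations. -/
theorem lower_bound_of_norm_sub_le {u v : Vect2} {c : ℝ} (hu : ∀ θ, c ≤ 1 + u.deriv1 θ)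
    (h : ‖v - u‖ ≤ c / 2) (θ : ℝ) : c / 2 ≤ 1 + v.deriv1 θ := by
  have h1 := (abs_le.1 ((v - u).abs_deriv1_le θ)).1
  rw [deriv1_sub] at h1
  linarith [hu θ]

/-- The constant displacement `c`. -/
def const (c : ℝ) : Vect2 :=
  ofContDiff (fun _ => c) contDiff_const fun _ => rfl

theorem disp_const (c θ : ℝ) : (const c).disp θ = c := rfl

theorem deriv1_const (c θ : ℝ) : (const c).deriv1 θ = 0 := by
  have h1 := (const c).hasDerivAt_disp θ
  exact h1.unique (hasDerivAt_const θ c)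

theorem Admissible.add_const {u : Vect2} (hu : u.Admissible) (c : ℝ) :
    (u + const c).Admissible := fun θ => by
  rw [deriv1_add, deriv1_const, add_zero]
  exact hu θ

/-- The inverse of the homeomorphism `θ ↦ θ + u(θ)` of the line. -/
def angleInv (u : Vect2) : ℝ → ℝ := Function.surjInv u.lift_surjective

theorem angleInv_add_disp (u : Vect2) (θ : ℝ) : u.angleInv θ + u.disp (u.angleInv θ) = θ :=
  Function.surjInv_eq u.lift_surjective θ

theorem angleInv_eq {u : Vect2} (hu : u.Admissible) {a θ : ℝ} (h : a + u.disp a = θ) :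
    u.angleInv θ = a :=
  (lift_strictMono hu).injective ((u.angleInv_add_disp θ).trans h.symm)

theorem angleInv_add_two_pi {u : Vect2} (hu : u.Admissible) (θ : ℝ) (n : ℤ) :
    u.angleInv (θ + n * (2 * Real.pi)) = u.angleInv θ + n * (2 * Real.pi) := by
  refine angleInv_eq hu ?_
  rw [lift_periodic]
  linarith [u.angleInv_add_disp θ]

theorem mul_abs_sub_le {u : Vect2} {c : ℝ} (hc : ∀ θ, c ≤ 1 + u.deriv1 θ) (s t : ℝ) :
    c * |s - t| ≤ |(s + u.disp s) - (t + u.disp t)| := by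
  have key : ∀ s t : ℝ, s ≤ t → c * (t - s) ≤ (t + u.disp t) - (s + u.disp s) := by
    intro s t hst
    refine mul_sub_le_image_sub_of_le_deriv (f := fun θ => θ + u.disp θ)
      (fun θ => (u.hasDerivAt_add_disp θ).differentiableAt) (fun θ => ?_) hst
    rw [(u.hasDerivAt_add_disp θ).deriv]
    exact hc θ
  rcases le_total s t with h | h
  · rw [abs_sub_comm, abs_of_nonneg (sub_nonneg.2 h), abs_sub_comm]
    exact (key s t h).trans (le_abs_self _)
  · rw [abs_of_nonneg (sub_nonneg.2 h)]
    exact (key t s h).trans (le_abs_self _)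

/-- The inverse of `θ ↦ θ + u(θ)` is Lipschitz in both `u` and `θ`. -/
theorem mul_abs_angleInv_sub_le {u : Vect2} {c : ℝ} (hc : ∀ θ, c ≤ 1 + u.deriv1 θ) (v : Vect2)
    (s t : ℝ) : c * |v.angleInv s - u.angleInv t| ≤ ‖v - u‖ + |s - t| := by
  refine (mul_abs_sub_le hc _ _).trans ?_
  have h1 := v.angleInv_add_disp s
  have h2 := u.angleInv_add_disp t
  have h3 := (v - u).abs_disp_le (v.angleInv s)
  rw [disp_sub] at h3
  have h4 : (v.angleInv s + u.disp (v.angleInv s)) - (u.angleInv t + u.disp (u.angleInv t))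
      = (s - t) - (v.disp (v.angleInv s) - u.disp (v.angleInv s)) := by linarith
  rw [h4]
  linarith [abs_sub (s - t) (v.disp (v.angleInv s) - u.disp (v.angleInv s))]

end Vect2

/-! ### The covering of the group of diffeomorphisms by displacements -/

namespace CircleDiff

open Vect2

theorem ext_exp {γ γ' : CircleDiff}
    (h : ∀ θ : ℝ, γ.toEquiv (Circle.exp θ) = γ'.toEquiv (Circle.exp θ)) : γ = γ' := by
  cases γ
  cases γ'
  congr
  ext z
  obtain ⟨θ, rfl⟩ := Circle.exp_surjective z
  exact congrArg _ (h θ)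

theorem ofLift_exp {u : Vect2} (hu : u.Admissible) (θ : ℝ) :
    (ofLift u).toEquiv (Circle.exp θ) = Circle.exp (θ + u.disp θ) := by
  rw [ofLift, dif_pos hu]
  exact u.circleFun_exp θ

theorem ofLift_eq {u : Vect2} (hu : u.Admissible) {γ : CircleDiff}
    (h : ∀ θ : ℝ, γ.toEquiv (Circle.exp θ) = Circle.exp (θ + u.disp θ)) : ofLift u = γ :=
  ext_exp fun θ => (ofLift_exp hu θ).trans (h θ).symm

theorem lift_admissible (γ : CircleDiff) : γ.lift.Admissible := γ.exists_lift.choose_spec.1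

theorem ofLift_lift (γ : CircleDiff) : ofLift γ.lift = γ :=
  ofLift_eq γ.lift_admissible γ.exists_lift.choose_spec.2

theorem lift_mem_lifts {U : Set CircleDiff} {γ : CircleDiff} (h : γ ∈ U) : γ.lift ∈ lifts U :=
  ⟨γ.lift_admissible, by rwa [ofLift_lift]⟩

theorem ofLift_add_const {u : Vect2} (hu : u.Admissible) (n : ℤ) :
    ofLift (u + const (n * (2 * Real.pi))) = ofLift u := by
  refine ofLift_eq (hu.add_const _) fun θ => ?_
  rw [ofLift_exp hu, disp_add, disp_const]
  exact Circle.exp_eq_exp.2 ⟨-n, by push_cast; ring⟩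

/-- The loop `θ ↦ γ(e^{iθ})` in the plane. -/
def loop (γ : CircleDiff) (θ : ℝ) : ℂ := (γ.toEquiv (Circle.exp θ) : Circle)

theorem loop_ofLift {u : Vect2} (hu : u.Admissible) :
    loop (ofLift u) = fun θ => (Circle.exp (θ + u.disp θ) : ℂ) :=
  funext fun θ => by rw [loop, ofLift_exp hu]

theorem norm_loop (γ : CircleDiff) (θ : ℝ) : ‖loop γ θ‖ = 1 := Circle.norm_coe _

theorem hasDerivAt_loop {u : Vect2} (hu : u.Admissible) (θ : ℝ) :
    HasDerivAt (loop (ofLift u)) (Complex.I * (1 + u.deriv1 θ : ℝ) * loop (ofLift u) θ) θ := by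
  rw [loop_ofLift hu]
  refine HasDerivAt.congr_deriv (HasDerivAt.scomp (g₁ := fun θ : ℝ => (Circle.exp θ : ℂ)) θ
    (hasDerivAt_coe_exp (θ + u.disp θ)) (u.hasDerivAt_add_disp θ)) ?_
  rw [Complex.real_smul]
  ring

theorem deriv_loop {u : Vect2} (hu : u.Admissible) :
    deriv (loop (ofLift u)) = fun θ => Complex.I * (1 + u.deriv1 θ : ℝ) * loop (ofLift u) θ :=
  funext fun θ => (hasDerivAt_loop hu θ).deriv

theorem iteratedDeriv_two_loop {u : Vect2} (hu : u.Admissible) :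
    iteratedDeriv 2 (loop (ofLift u)) = fun θ =>
      (Complex.I * (u.deriv2 θ : ℝ) - ((1 + u.deriv1 θ : ℝ) : ℂ) ^ 2) * loop (ofLift u) θ := by
  rw [iteratedDeriv_succ, iteratedDeriv_one, deriv_loop hu]
  funext θ
  have h1 : HasDerivAt (fun θ => ((1 + u.deriv1 θ : ℝ) : ℂ)) (u.deriv2 θ : ℝ) θ :=
    ((u.hasDerivAt_deriv1 θ).const_add 1).ofReal_comp
  have h2 := (h1.const_mul Complex.I).mul (hasDerivAt_loop hu θ)
  refine (HasDerivAt.deriv h2).trans ?_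
  linear_combination (1 + u.deriv1 θ : ℝ) ^ 2 * loop (ofLift u) θ * Complex.I_sq

/-- The topology of the group is that of uniform convergence of the loops and of their first two
derivatives. -/
theorem tendsto_nhds_iff {ι : Type*} {l : Filter ι} {f : ι → CircleDiff} {γ : CircleDiff} :
    Tendsto f l (𝓝 γ) ↔ ∀ k : Fin 3, TendstoUniformly (fun i => iteratedDeriv k (loop (f i)))
      (iteratedDeriv k (loop γ)) l := by
  rw [nhds_induced, tendsto_comap_iff, tendsto_pi_nhds]
  refine forall_congr' fun k => ?_
  rw [UniformFun.tendsto_iff_tendstoUniformly]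
  rfl

/-- The function `θ ↦ e^{i(θ + u(θ))}` as a bounded continuous function. -/
def loopB (u : Vect2) : ℝ →ᵇ ℂ :=
  BoundedContinuousFunction.ofNormedAddCommGroup (fun θ => (Circle.exp (θ + u.disp θ) : ℂ))
    (continuous_circle_coe.comp (Circle.exp.continuous.comp
      (continuous_id.add u.continuous_disp))) 1 fun _ => (Circle.norm_coe _).le

theorem norm_exp_sub_le (s t : ℝ) : ‖(Circle.exp s : ℂ) - Circle.exp t‖ ≤ |s - t| := by
  have := (convex_univ (𝕜 := ℝ) (E := ℝ)).norm_image_sub_le_of_norm_hasDerivWithin_le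
    (f := fun θ : ℝ => (Circle.exp θ : ℂ)) (C := 1) (x := t) (y := s)
    (fun x _ => (hasDerivAt_coe_exp x).hasDerivWithinAt)
    (fun x _ => by rw [norm_mul, Complex.norm_I, Circle.norm_coe, one_mul])
    (mem_univ _) (mem_univ _)
  simpa using this

theorem continuous_loopB : Continuous loopB := by
  refine (LipschitzWith.of_dist_le_mul (K := 1) fun u v => ?_).continuous
  rw [NNReal.coe_one, one_mul, BoundedContinuousFunction.dist_le dist_nonneg]
  intro θ
  rw [dist_eq_norm, dist_eq_norm]
  refine (norm_exp_sub_le _ _).trans ?_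
  rw [add_sub_add_left_eq_sub]
  exact (u - v).abs_disp_le θ

/-- A bounded continuous real function as a complex one. -/
def toComplexB (f : ℝ →ᵇ ℝ) : ℝ →ᵇ ℂ :=
  BoundedContinuousFunction.comp _ Complex.isometry_ofReal.lipschitz f

theorem continuous_toComplexB : Continuous toComplexB :=
  BoundedContinuousFunction.continuous_comp Complex.isometry_ofReal.lipschitz

/-- The covering map is continuous: the loop and its derivatives are polynomials, in the algebra of
bounded continuous functions, in `u'`, `u''` and `e^{i(θ + u(θ))}`. -/
theorem tendsto_ofLift {u : Vect2} (hu : u.Admissible) : Tendsto ofLift (𝓝 u) (𝓝 (ofLift u)) := by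
  obtain ⟨c, hc0, hc⟩ := hu.exists_lower_bound
  have hev : ∀ᶠ v in 𝓝 u, v.Admissible := by
    filter_upwards [Metric.closedBall_mem_nhds u (half_pos hc0)] with v hv θ
    rw [mem_closedBall_iff_norm] at hv
    linarith [lower_bound_of_norm_sub_le hc hv θ]
  have c1 : Continuous fun v : Vect2 => v.1.2.1 := continuous_fst.comp
    (continuous_snd.comp continuous_subtype_val)
  have c2 : Continuous fun v : Vect2 => v.1.2.2 := continuous_snd.comp
    (continuous_snd.comp continuous_subtype_val)
  have d1 := continuous_toComplexB.comp c1
  have d2 := continuous_toComplexB.comp c2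
  have t1 : Continuous fun v : Vect2 => BoundedContinuousFunction.const ℝ Complex.I *
      (1 + toComplexB v.1.2.1) * loopB v :=
    (continuous_const.mul (continuous_const.add d1)).mul continuous_loopB
  have t2 : Continuous fun v : Vect2 => (BoundedContinuousFunction.const ℝ Complex.I *
      toComplexB v.1.2.2 - (1 + toComplexB v.1.2.1) ^ 2) * loopB v :=
    ((continuous_const.mul d2).sub ((continuous_const.add d1).pow 2)).mul continuous_loopB
  have key : ∀ (f : Vect2 → ℝ →ᵇ ℂ) (g : Vect2 → ℝ → ℂ), Continuous f →
      (∀ v, v.Admissible → g v = f v) → TendstoUniformly (fun v => g v) (g u) (𝓝 u) := by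
    intro f g hf hg
    have h1 : TendstoUniformly (fun v => ⇑(f v)) (f u) (𝓝 u) :=
      BoundedContinuousFunction.tendsto_iff_tendstoUniformly.1 (hf.tendsto u)
    rw [hg u hu]
    intro V hV
    filter_upwards [h1 V hV, hev] with v h2 hv x
    rw [hg v hv]
    exact h2 x
  rw [tendsto_nhds_iff]
  intro k
  fin_cases k
  · refine key loopB (fun v => iteratedDeriv 0 (loop (ofLift v))) continuous_loopB fun v hv => ?_
    rw [iteratedDeriv_zero, loop_ofLift hv]
    rfl
  · refine key _ (fun v => iteratedDeriv 1 (loop (ofLift v))) t1 fun v hv => ?_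
    rw [iteratedDeriv_one, deriv_loop hv, loop_ofLift hv]
    funext θ
    simp only [Complex.ofReal_add, Complex.ofReal_one, BoundedContinuousFunction.mul_apply,
      BoundedContinuousFunction.add_apply,
      BoundedContinuousFunction.const_apply, BoundedContinuousFunction.coe_one, Pi.one_apply]
    rfl
  · refine key _ (fun v => iteratedDeriv 2 (loop (ofLift v))) t2 fun v hv => ?_
    rw [iteratedDeriv_two_loop hv, loop_ofLift hv]
    funext θ
    simp only [Complex.ofReal_add, Complex.ofReal_one, BoundedContinuousFunction.mul_apply,
      BoundedContinuousFunction.add_apply, BoundedContinuousFunction.sub_apply,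
      BoundedContinuousFunction.pow_apply, BoundedContinuousFunction.const_apply,
      BoundedContinuousFunction.coe_one, Pi.one_apply]
    rfl

theorem isOpen_lifts {U : Set CircleDiff} (hU : IsOpen U) : IsOpen (lifts U) := by
  rw [isOpen_iff_mem_nhds]
  rintro u ⟨hu, huU⟩
  obtain ⟨c, hc0, hc⟩ := hu.exists_lower_bound
  filter_upwards [Metric.closedBall_mem_nhds u (half_pos hc0),
    (tendsto_ofLift hu).eventually (hU.mem_nhds huU)] with v hv hvU
  rw [mem_closedBall_iff_norm] at hv
  exact ⟨fun θ => by linarith [lower_bound_of_norm_sub_le hc hv θ], hvU⟩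

/-- If a continuous `w` keeps `e^{iw}` close to `1`, then `w` stays close to one multiple of `2π`. -/
theorem exists_int_abs_sub_le {w : ℝ → ℝ} (hw : Continuous w) {ε : ℝ} (hε : ε < 1)
    (h : ∀ θ, ‖(Circle.exp (w θ) : ℂ) - 1‖ ≤ ε) :
    ∃ n : ℤ, ∀ θ, |w θ - n * (2 * Real.pi)| ≤ Real.pi / 2 * ε := by
  -- The cosine of `w` does not vanish, which confines `w` to one interval of length `π`.
  have hcos : ∀ θ, 0 < Real.cos (w θ) := fun θ => by
    have h1 := (Complex.abs_re_le_norm _).trans (h θ)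
    rw [Complex.sub_re, Complex.one_re, Circle.coe_exp, Complex.exp_ofReal_mul_I_re] at h1
    linarith [(abs_le.1 h1).1]
  obtain ⟨n, hn⟩ := Circle.exp_eq_exp.1 (Circle.exp_arg (Circle.exp (w 0)))
  have h0 : |w 0 - (-n : ℤ) * (2 * Real.pi)| ≤ Real.pi := by
    have : w 0 - (-n : ℤ) * (2 * Real.pi) = (Circle.exp (w 0) : ℂ).arg := by
      rw [hn]; push_cast; ring
    rw [this]
    exact Complex.abs_arg_le_pi _
  refine ⟨-n, ?_⟩
  set v : ℝ → ℝ := fun θ => w θ - (-n : ℤ) * (2 * Real.pi) with hv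
  have hvc : ∀ θ, Real.cos (v θ) = Real.cos (w θ) := fun θ => Real.cos_sub_int_mul_two_pi _ _
  have hve : ∀ θ, Circle.exp (v θ) = Circle.exp (w θ) := fun θ =>
    Circle.exp_eq_exp.2 ⟨n, by simp only [hv]; push_cast; ring⟩
  have hpi := Real.pi_pos
  have hlt0 : |v 0| < Real.pi / 2 := by
    by_contra hge
    push Not at hge
    have h1 := Real.cos_nonpos_of_pi_div_two_le_of_le hge (by linarith)
    rw [Real.cos_abs, hvc] at h1
    linarith [hcos 0]
  have hlt : ∀ θ, |v θ| < Real.pi / 2 := by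
    by_contra hge
    push Not at hge
    obtain ⟨θ, hθ⟩ := hge
    have hc : Continuous fun θ => |v θ| := (hw.sub continuous_const).abs
    obtain ⟨t, ht⟩ := mem_range_of_exists_le_of_exists_ge hc ⟨0, hlt0.le⟩ ⟨θ, hθ⟩
    have h1 : Real.cos |v t| = 0 := by
      rw [show |v t| = Real.pi / 2 from ht]; exact Real.cos_pi_div_two
    rw [Real.cos_abs, hvc] at h1
    linarith [hcos t]
  intro θ
  have h1 := h θ
  rw [← hve] at h1
  have h2 : |Real.sin (v θ)| ≤ ε := by
    have := (Complex.abs_im_le_norm _).trans h1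
    rwa [Complex.sub_im, Complex.one_im, sub_zero, Circle.coe_exp,
      Complex.exp_ofReal_mul_I_im] at this
  have h3 := Real.mul_abs_le_abs_sin (hlt θ).le
  have h4 := h3.trans h2
  rw [div_mul_eq_mul_div, div_le_iff₀ hpi] at h4
  linarith

theorem norm_mul_sub_aux {X X₀ g g₀ : ℂ} (hg : ‖g‖ = 1) :
    ‖X - X₀‖ ≤ ‖X * g - X₀ * g₀‖ + ‖X₀‖ * ‖g - g₀‖ := by
  have h1 : (X - X₀) * g = (X * g - X₀ * g₀) - X₀ * (g - g₀) := by ring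
  have h2 := norm_sub_le (X * g - X₀ * g₀) (X₀ * (g - g₀))
  rwa [← h1, norm_mul, norm_mul, hg, mul_one] at h2

/-- Every diffeomorphism close to that with displacement `u` has a displacement close to `u`. -/
theorem eventually_exists_lift_near {u : Vect2} (hu : u.Admissible) {ε : ℝ} (hε : 0 < ε) :
    ∀ᶠ γ in 𝓝 (ofLift u), ∃ v : Vect2, v.Admissible ∧ ‖v - u‖ ≤ ε ∧ ofLift v = γ := by
  have ht := tendsto_nhds_iff.1 (tendsto_id (α := CircleDiff) (x := 𝓝 (ofLift u)))
  set M : ℝ := ‖u‖ + (1 + ‖u‖) ^ 2 with hM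
  have hM0 : 0 ≤ M := by positivity
  obtain ⟨δ, hδ0, hδ1, hδε⟩ : ∃ δ : ℝ, 0 < δ ∧ δ < 1 ∧ (2 + M) * δ ≤ ε := by
    refine ⟨min (1 / 2) (ε / (2 + M)), by positivity, (min_le_left _ _).trans_lt (by norm_num), ?_⟩
    calc (2 + M) * min (1 / 2) (ε / (2 + M)) ≤ (2 + M) * (ε / (2 + M)) := by gcongr; exact min_le_right _ _
      _ = ε := by field_simp
  have t0 := Metric.tendstoUniformly_iff.1 (ht 0) δ hδ0
  have t1 := Metric.tendstoUniformly_iff.1 (ht 1) δ hδ0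
  have t2 := Metric.tendstoUniformly_iff.1 (ht 2) δ hδ0
  filter_upwards [t0, t1, t2] with γ h0 h1 h2
  have hadm := γ.lift_admissible
  have hγ := γ.ofLift_lift
  set w := γ.lift with hw
  have e0 : ∀ θ, ‖loop (ofLift w) θ - loop (ofLift u) θ‖ < δ := fun θ => by
    have := h0 θ
    rw [dist_comm, dist_eq_norm] at this
    simpa only [Fin.val_zero, iteratedDeriv_zero, id, hγ] using this
  have e1 : ∀ θ, ‖deriv (loop (ofLift w)) θ - deriv (loop (ofLift u)) θ‖ < δ := fun θ => by
    have := h1 θ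
    rw [dist_comm, dist_eq_norm] at this
    simpa only [Fin.val_one, iteratedDeriv_one, id, hγ] using this
  have e2 : ∀ θ, ‖iteratedDeriv 2 (loop (ofLift w)) θ - iteratedDeriv 2 (loop (ofLift u)) θ‖ < δ :=
    fun θ => by
    have := h2 θ
    rw [dist_comm, dist_eq_norm] at this
    simpa only [Fin.val_two, id, hγ] using this
  obtain ⟨n, hn⟩ := exists_int_abs_sub_le (w := (w - u).disp) (w - u).continuous_disp hδ1
    fun θ => by
      have h3 := (e0 θ).le
      rw [loop_ofLift hadm, loop_ofLift hu] at h3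
      have h4 : (Circle.exp ((w - u).disp θ) : ℂ) - 1
          = (Circle.exp (θ + w.disp θ) - Circle.exp (θ + u.disp θ)) *
            ((Circle.exp (θ + u.disp θ))⁻¹ : Circle) := by
        rw [sub_mul, ← Circle.coe_mul, ← Circle.coe_mul, mul_inv_cancel, ← Circle.exp_neg,
          ← Circle.exp_add, disp_sub, Circle.coe_one]
        ring_nf
      rw [h4, norm_mul, Circle.norm_coe, mul_one]
      exact h3
  -- The modulus of the derivative of the loop of `γ` is `1 + w'`.
  have f1 : ∀ θ, |w.deriv1 θ - u.deriv1 θ| ≤ δ := fun θ => by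
    have h3 := (e1 θ).le
    rw [deriv_loop hadm, deriv_loop hu] at h3
    have h4 := (abs_norm_sub_norm_le _ _).trans h3
    simp only [norm_mul, Complex.norm_I, norm_loop, one_mul, mul_one, Complex.norm_real] at h4
    rw [Real.norm_of_nonneg (hadm θ).le, Real.norm_of_nonneg (hu θ).le,
      add_sub_add_left_eq_sub] at h4
    exact h4
  -- The second derivative of the loop, divided by the loop, has imaginary part `w''`.
  have f2 : ∀ θ, |w.deriv2 θ - u.deriv2 θ| ≤ (1 + M) * δ := fun θ => by
    have h3 := (e2 θ).le
    rw [iteratedDeriv_two_loop hadm, iteratedDeriv_two_loop hu] at h3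
    have h4 := (norm_mul_sub_aux (norm_loop (ofLift w) θ)).trans (add_le_add_left h3 _)
    have h5 := (Complex.abs_im_le_norm _).trans h4
    have h6 : (Complex.I * (w.deriv2 θ : ℝ) - ((1 + w.deriv1 θ : ℝ) : ℂ) ^ 2 -
        (Complex.I * (u.deriv2 θ : ℝ) - ((1 + u.deriv1 θ : ℝ) : ℂ) ^ 2)).im
          = w.deriv2 θ - u.deriv2 θ := by
      simp only [← Complex.ofReal_pow, Complex.sub_im, Complex.mul_im, Complex.I_re,
        Complex.I_im, Complex.ofReal_im, Complex.ofReal_re]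
      ring
    rw [h6] at h5
    refine h5.trans ?_
    have h7 : ‖Complex.I * (u.deriv2 θ : ℝ) - ((1 + u.deriv1 θ : ℝ) : ℂ) ^ 2‖ ≤ M := by
      refine (norm_sub_le _ _).trans (add_le_add ?_ ?_)
      · rw [norm_mul, Complex.norm_I, one_mul, Complex.norm_real]
        exact u.abs_deriv2_le θ
      · rw [norm_pow, Complex.norm_real, Real.norm_of_nonneg (hu θ).le]
        have := (abs_le.1 (u.abs_deriv1_le θ)).2
        have := hu θ
        gcongr
    have h8 := mul_le_mul h7 (e0 θ).le (norm_nonneg _) hM0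
    linarith
  have hpi : Real.pi / 2 ≤ 2 := by linarith [Real.pi_le_four]
  refine ⟨w + const ((-n : ℤ) * (2 * Real.pi)), hadm.add_const _, ?_, ?_⟩
  · refine (Vect2.norm_le (by positivity) (fun θ => ?_) (fun θ => ?_) fun θ => ?_).trans hδε
    · have h3 := hn θ
      rw [disp_sub] at h3
      rw [disp_sub, disp_add, disp_const]
      have h4 : w.disp θ + (-n : ℤ) * (2 * Real.pi) - u.disp θ
          = w.disp θ - u.disp θ - n * (2 * Real.pi) := by push_cast; ring
      rw [h4]
      nlinarith
    · rw [deriv1_sub, deriv1_add, deriv1_const, add_zero]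
      have := f1 θ
      nlinarith
    · have h3 : (w + const ((-n : ℤ) * (2 * Real.pi)) - u).deriv2 θ = w.deriv2 θ - u.deriv2 θ := by
        have h4 : (const ((-n : ℤ) * (2 * Real.pi))).deriv2 θ = 0 := by
          refine ((const _).hasDerivAt_deriv1 θ).unique ?_
          rw [show (const ((-n : ℤ) * (2 * Real.pi))).deriv1 = fun _ => 0 from
            funext fun t => deriv1_const _ t]
          exact hasDerivAt_const θ 0
        change w.deriv2 θ + (const _).deriv2 θ - u.deriv2 θ = _
        rw [h4, add_zero]
      rw [h3]
      have := f2 θ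
      nlinarith
  · rw [ofLift_add_const hadm, hγ]

end CircleDiff

/-! ### Velocity fields on the circle -/

theorem abs_le_two_mul_norm_exp_sub_one {s : ℝ} (hs : |s| ≤ Real.pi) :
    |s| ≤ 2 * ‖(Circle.exp s : ℂ) - 1‖ := by
  have h1 : ‖(Circle.exp s : ℂ) - 1‖ = 2 * |Real.sin (s / 2)| := by
    rw [Circle.coe_exp, mul_comm, Complex.norm_exp_I_mul_ofReal_sub_one, norm_mul,
      Real.norm_eq_abs, Real.norm_eq_abs, abs_two]
  have h2 : |s / 2| ≤ Real.pi / 2 := by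
    rw [abs_div, abs_two]; linarith
  have h3 := Real.mul_abs_le_abs_sin h2
  rw [abs_div, abs_two, div_mul_eq_mul_div, div_le_iff₀ Real.pi_pos] at h3
  rw [h1]
  nlinarith [Real.pi_le_four, abs_nonneg (Real.sin (s / 2))]

/-- A Lipschitz bound in the angle gives a Lipschitz bound for the chordal distance. -/
theorem boundedLipschitz_of_exp {E : Type*} [NormedAddCommGroup E] [NormedSpace ℂ E]
    {f : Circle → E} {K : ℝ} (hb : ∀ ξ, ‖f ξ‖ ≤ K)
    (hl : ∀ s t : ℝ, ‖f (Circle.exp s) - f (Circle.exp t)‖ ≤ K * |s - t|) :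
    BoundedLipschitz f (2 * K) := by
  have hK : 0 ≤ K := (norm_nonneg _).trans (hb 1)
  refine ⟨fun ξ => (hb ξ).trans (by linarith), fun ξ η => ?_⟩
  obtain ⟨t, rfl⟩ := Circle.exp_surjective η
  set s : ℝ := ((ξ / Circle.exp t : Circle) : ℂ).arg with hs
  have h1 : ξ = Circle.exp (s + t) := by
    rw [Circle.exp_add, hs, Circle.exp_arg, div_mul_cancel]
  have h2 : ‖(ξ : ℂ) - Circle.exp t‖ = ‖(Circle.exp s : ℂ) - 1‖ := by
    rw [h1, Circle.exp_add, Circle.coe_mul, ← sub_one_mul, norm_mul, Circle.norm_coe, mul_one]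
  have h3 := abs_le_two_mul_norm_exp_sub_one (Complex.abs_arg_le_pi (ξ / Circle.exp t : Circle))
  rw [h2]
  nth_rewrite 1 [h1]
  refine (hl _ _).trans ?_
  rw [add_sub_cancel_right]
  nlinarith

namespace CircleDiff

open Vect2

/-- The velocity `ξ ↦ i ξ h(a)`, where `γ(e^{ia}) = ξ`, of the point `ξ` of the circle as a function
of `ξ`, when the displacement `u` of the diffeomorphism `γ` moves in the direction `h`. -/
def vel (u h : Vect2) (ξ : Circle) : ℂ :=
  Complex.I * ξ * (h.disp (u.angleInv (Complex.arg ξ)) : ℝ)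

/-- Any angle may be used in place of the principal one of the definition. -/
theorem vel_exp {u : Vect2} (hu : u.Admissible) (h : Vect2) (θ : ℝ) :
    vel u h (Circle.exp θ) = Complex.I * Circle.exp θ * (h.disp (u.angleInv θ) : ℝ) := by
  obtain ⟨n, hn⟩ := Circle.exp_eq_exp.1 (Circle.exp_arg (Circle.exp θ))
  rw [vel, hn, angleInv_add_two_pi hu, lift_periodic]

theorem vel_add (u h k : Vect2) (ξ : Circle) : vel u (h + k) ξ = vel u h ξ + vel u k ξ := by
  rw [vel, disp_add, vel, vel]
  push_cast
  ring

theorem vel_smul (u : Vect2) (c : ℝ) (h : Vect2) (ξ : Circle) :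
    vel u (c • h) ξ = c * vel u h ξ := by
  rw [vel, disp_smul, vel]
  push_cast
  ring

theorem norm_vel_le (u h : Vect2) (ξ : Circle) : ‖vel u h ξ‖ ≤ ‖h‖ := by
  rw [vel, norm_mul, norm_mul, Complex.norm_I, Circle.norm_coe, Complex.norm_real, one_mul, one_mul]
  exact h.abs_disp_le _

theorem boundedLipschitz_vel {u : Vect2} {c : ℝ} (hc0 : 0 < c) (hc : ∀ θ, c ≤ 1 + u.deriv1 θ)
    (h : Vect2) : BoundedLipschitz (vel u h) (2 * ((1 + c⁻¹) * ‖h‖)) := by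
  have hu : u.Admissible := fun θ => hc0.trans_le (hc θ)
  refine boundedLipschitz_of_exp (fun ξ => (norm_vel_le u h ξ).trans ?_) fun s t => ?_
  · have : 0 < c⁻¹ := inv_pos.2 hc0
    nlinarith [norm_nonneg h]
  · have h1 := mul_abs_angleInv_sub_le hc u s t
    rw [sub_self, norm_zero, zero_add] at h1
    have h2 := h.abs_disp_sub_le (u.angleInv s) (u.angleInv t)
    have h3 : |u.angleInv s - u.angleInv t| ≤ c⁻¹ * |s - t| := by
      rw [← div_eq_inv_mul, le_div_iff₀ hc0, mul_comm]; exact h1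
    have e : vel u h (Circle.exp s) - vel u h (Circle.exp t) = Complex.I * Circle.exp s *
        ((h.disp (u.angleInv s) - h.disp (u.angleInv t) : ℝ) : ℂ) +
        Complex.I * ((Circle.exp s : ℂ) - Circle.exp t) * (h.disp (u.angleInv t) : ℝ) := by
      rw [vel_exp hu, vel_exp hu]
      push_cast
      ring
    rw [e]
    refine (norm_add_le _ _).trans ?_
    rw [norm_mul, norm_mul, norm_mul, norm_mul, Complex.norm_I, Circle.norm_coe,
      Complex.norm_real, Complex.norm_real, one_mul, one_mul, one_mul, Real.norm_eq_abs,
      Real.norm_eq_abs]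
    have h4 := norm_exp_sub_le s t
    have h5 := h.abs_disp_le (u.angleInv t)
    have h6 : ‖(Circle.exp s : ℂ) - Circle.exp t‖ * |h.disp (u.angleInv t)| ≤ |s - t| * ‖h‖ :=
      mul_le_mul h4 h5 (abs_nonneg _) (abs_nonneg _)
    have h7 : ‖h‖ * |u.angleInv s - u.angleInv t| ≤ ‖h‖ * (c⁻¹ * |s - t|) :=
      mul_le_mul_of_nonneg_left h3 (norm_nonneg _)
    nlinarith

theorem continuous_vel {u : Vect2} (hu : u.Admissible) (h : Vect2) : Continuous (vel u h) := by
  obtain ⟨c, hc0, hc⟩ := hu.exists_lower_bound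
  exact (boundedLipschitz_vel hc0 hc h).continuous

theorem continuousAt_angleInv {u : Vect2} (hu : u.Admissible) (t : ℝ) :
    ContinuousAt (fun p : Vect2 × ℝ => p.1.angleInv p.2) (u, t) := by
  obtain ⟨c, hc0, hc⟩ := hu.exists_lower_bound
  have h1 : Tendsto (fun p : Vect2 × ℝ => c⁻¹ * (‖p.1 - u‖ + |p.2 - t|)) (𝓝 (u, t)) (𝓝 0) := by
    have : ContinuousAt (fun p : Vect2 × ℝ => c⁻¹ * (‖p.1 - u‖ + |p.2 - t|)) (u, t) := by fun_prop
    simpa [ContinuousAt] using this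
  refine tendsto_iff_dist_tendsto_zero.2 (squeeze_zero (fun _ => dist_nonneg) (fun p => ?_) h1)
  rw [Real.dist_eq, ← div_eq_inv_mul, le_div_iff₀ hc0, mul_comm]
  exact mul_abs_angleInv_sub_le hc p.1 p.2 t

theorem ext_disp {u v : Vect2} (h : ∀ θ, u.disp θ = v.disp θ) : u = v := by
  have h0 : u.disp = v.disp := funext h
  have h1 : u.deriv1 = v.deriv1 := funext fun θ =>
    (u.hasDerivAt_disp θ).unique (h0 ▸ v.hasDerivAt_disp θ)
  have h2 : u.deriv2 = v.deriv2 := funext fun θ =>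
    (u.hasDerivAt_deriv1 θ).unique (h1 ▸ v.hasDerivAt_deriv1 θ)
  refine Subtype.ext (Prod.ext (DFunLike.coe_injective h0) (Prod.ext (DFunLike.coe_injective h1)
    (DFunLike.coe_injective h2)))

theorem virasoroAngle_ofLift {u : Vect2} (hu : u.Admissible) (m : ℤ) (θ : ℝ) :
    virasoroAngle m (ofLift u) θ = -Complex.I * Circle.exp (m * (θ + u.disp θ)) := by
  have hne : ((Circle.exp (θ + u.disp θ) : Circle) : ℂ) ≠ 0 := Circle.coe_ne_zero _
  rw [virasoroAngle, virasoro, ofLift_exp hu, zpow_add_one₀ hne, mul_div_mul_right _ _ hne,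
    Complex.div_I, Circle.coe_exp, Circle.coe_exp, ← Complex.exp_int_mul]
  push_cast
  ring_nf

theorem virasoroRe_disp {u : Vect2} (hu : u.Admissible) (m : ℤ) (θ : ℝ) :
    (virasoroRe m (ofLift u)).disp θ = Real.sin (m * (θ + u.disp θ)) := by
  change (virasoroAngle m (ofLift u) θ).re = _
  rw [virasoroAngle_ofLift hu, Circle.coe_exp]
  simp [Complex.mul_re, Complex.exp_ofReal_mul_I_im, -Complex.ofReal_mul, -Complex.ofReal_add]

theorem virasoroIm_disp {u : Vect2} (hu : u.Admissible) (m : ℤ) (θ : ℝ) :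
    (virasoroIm m (ofLift u)).disp θ = -Real.cos (m * (θ + u.disp θ)) := by
  change (virasoroAngle m (ofLift u) θ).im = _
  rw [virasoroAngle_ofLift hu, Circle.coe_exp]
  simp [Complex.mul_im, Complex.exp_ofReal_mul_I_re, -Complex.ofReal_mul, -Complex.ofReal_add]

theorem virasoroRe_neg {u : Vect2} (hu : u.Admissible) (m : ℤ) :
    virasoroRe (-m) (ofLift u) = (-1 : ℝ) • virasoroRe m (ofLift u) :=
  ext_disp fun θ => by
    rw [disp_smul, virasoroRe_disp hu, virasoroRe_disp hu, Int.cast_neg, neg_mul, Real.sin_neg]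
    ring

theorem virasoroIm_neg {u : Vect2} (hu : u.Admissible) (m : ℤ) :
    virasoroIm (-m) (ofLift u) = virasoroIm m (ofLift u) :=
  ext_disp fun θ => by
    rw [virasoroIm_disp hu, virasoroIm_disp hu, Int.cast_neg, neg_mul, Real.cos_neg]

/-- The velocity field of the complex tangent vector `L_m` is `ξ ↦ ξ^{m+1}`. -/
theorem vel_virasoro {u : Vect2} (hu : u.Admissible) (m : ℤ) (ξ : Circle) :
    vel u (virasoroRe m (ofLift u)) ξ + Complex.I * vel u (virasoroIm m (ofLift u)) ξ
      = (ξ : ℂ) ^ (m + 1) := by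
  obtain ⟨θ, rfl⟩ := Circle.exp_surjective ξ
  rw [vel_exp hu, vel_exp hu]
  have h1 : ((virasoroRe m (ofLift u)).disp (u.angleInv θ) : ℂ) +
      Complex.I * ((virasoroIm m (ofLift u)).disp (u.angleInv θ) : ℝ)
        = virasoroAngle m (ofLift u) (u.angleInv θ) := by
    rw [mul_comm]
    exact Complex.re_add_im _
  have h2 : virasoroAngle m (ofLift u) (u.angleInv θ) * (Complex.I * Circle.exp θ)
      = (Circle.exp θ : ℂ) ^ (m + 1) := by
    rw [virasoroAngle, virasoro, ofLift_exp hu, angleInv_add_disp, div_mul_cancel₀]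
    exact mul_ne_zero Complex.I_ne_zero (Circle.coe_ne_zero _)
  rw [← h2, ← h1]
  ring

/-! ### Density of trigonometric vector fields -/

/-- Uniform approximation of a periodic function by trigonometric polynomials. -/
theorem exists_trig_approx {B : ℝ → ℝ} (hB : Continuous B)
    (hp : Function.Periodic B (2 * Real.pi)) {ε : ℝ} (hε : 0 < ε) :
    ∃ f : ℤ →₀ ℂ, ∀ θ, ‖(∑ m ∈ f.support, f m * (Circle.exp (m * θ) : ℂ)) - B θ‖ ≤ ε := by
  have : Fact (0 < 2 * Real.pi) := ⟨by positivity⟩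
  have hBc : Continuous fun θ => (B θ : ℂ) := Complex.continuous_ofReal.comp hB
  have hBp : Function.Periodic (fun θ => (B θ : ℂ)) (2 * Real.pi) := fun θ => by
    simp only [hp θ]
  let b : C(AddCircle (2 * Real.pi), ℂ) := ⟨hBp.lift, continuous_coinduced_dom.2 hBc⟩
  have hb : b ∈ closure ((Submodule.span ℂ (range (@fourier (2 * Real.pi)))) :
      Set C(AddCircle (2 * Real.pi), ℂ)) := by
    rw [← Submodule.topologicalClosure_coe, span_fourier_closure_eq_top]
    trivial
  obtain ⟨q, hq, hqb⟩ := Metric.mem_closure_iff.1 hb ε hε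
  obtain ⟨f, hf⟩ := Finsupp.mem_span_range_iff_exists_finsupp.1 hq
  refine ⟨f, fun θ => ?_⟩
  have h1 := (ContinuousMap.dist_apply_le_dist (f := b) (g := q) (θ : AddCircle (2 * Real.pi)))
  rw [dist_comm, dist_eq_norm] at h1
  refine le_trans (le_of_eq ?_) (h1.trans hqb.le)
  congr 2
  rw [← hf, Finsupp.sum, ContinuousMap.sum_apply]
  refine Finset.sum_congr rfl fun m _ => ?_
  rw [ContinuousMap.smul_apply, smul_eq_mul, fourier_coe_apply, Circle.coe_exp]
  congr 2
  have : (Real.pi : ℂ) ≠ 0 := by exact_mod_cast Real.pi_ne_zero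
  push_cast
  field_simp

theorem exists_zero_of_periodic {g g' : ℝ → ℝ} (hg : ∀ θ, HasDerivAt g (g' θ) θ)
    (hp : Function.Periodic g (2 * Real.pi)) : ∃ θ, g' θ = 0 := by
  have h2 : (0 : ℝ) < 2 * Real.pi := by positivity
  obtain ⟨θ, -, h⟩ := exists_hasDerivAt_eq_zero (f := g) (f' := g') h2
    (fun x _ => (hg x).continuousAt.continuousWithinAt)
    (by have := hp 0; rw [zero_add] at this; exact this.symm) fun x _ => hg x
  exact ⟨θ, h⟩

theorem abs_le_of_periodic {g g' : ℝ → ℝ} (hg : ∀ θ, HasDerivAt g (g' θ) θ)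
    (hp : Function.Periodic g (2 * Real.pi)) {C : ℝ} (hC : ∀ θ, |g' θ| ≤ C) {t : ℝ} (ht : g t = 0)
    (θ : ℝ) : |g θ| ≤ 8 * C := by
  obtain ⟨s, hs, e⟩ := hp.exists_mem_Ico (by positivity) θ t
  have := (convex_univ (𝕜 := ℝ) (E := ℝ)).norm_image_sub_le_of_norm_hasDerivWithin_le
    (f := g) (f' := g') (C := C) (x := t) (y := s)
    (fun x _ => (hg x).hasDerivWithinAt) (fun x _ => hC x) (mem_univ _) (mem_univ _)
  rw [ht, sub_zero, Real.norm_eq_abs, Real.norm_eq_abs,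
    abs_of_nonneg (show 0 ≤ s - t by linarith [hs.1])] at this
  rw [e]
  have hC0 : 0 ≤ C := (abs_nonneg _).trans (hC 0)
  nlinarith [Real.pi_le_four, hs.1, hs.2]

/-- The vector field `Re (c e^{im(θ + u(θ))})`. -/
def trig (u : Vect2) (m : ℤ) (c : ℂ) : Vect2 :=
  (-c.im) • virasoroRe m (ofLift u) + (-c.re) • virasoroIm m (ofLift u)

theorem trig_disp {u : Vect2} (hu : u.Admissible) (m : ℤ) (c : ℂ) (θ : ℝ) :
    (trig u m c).disp θ = (c * (Circle.exp (m * (θ + u.disp θ)) : ℂ)).re := by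
  rw [trig, disp_add, disp_smul, disp_smul, virasoroRe_disp hu, virasoroIm_disp hu, Complex.mul_re,
    Circle.coe_exp, Complex.exp_ofReal_mul_I_re, Complex.exp_ofReal_mul_I_im]
  ring

theorem disp_sum {ι : Type*} (s : Finset ι) (f : ι → Vect2) (θ : ℝ) :
    (∑ i ∈ s, f i).disp θ = ∑ i ∈ s, (f i).disp θ := by
  classical
  induction s using Finset.induction_on with
  | empty => rfl
  | insert a s ha ih => rw [Finset.sum_insert ha, Finset.sum_insert ha, disp_add, ih]

/-- A closed real subspace of the space of vector fields which contains the real and imaginary parts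
of all `L_m` at some diffeomorphism is the whole space. A given field `h` is approximated by
approximating its second derivative in the coordinate `θ + u(θ)` by a trigonometric polynomial. -/
theorem eq_top_of_virasoro_mem {u : Vect2} (hu : u.Admissible) {S : Submodule ℝ Vect2}
    (hS : IsClosed (S : Set Vect2)) (hre : ∀ m, virasoroRe m (ofLift u) ∈ S)
    (him : ∀ m, virasoroIm m (ofLift u) ∈ S) : S = ⊤ := by
  rw [eq_top_iff]
  intro h _
  have htrig : ∀ m c, trig u m c ∈ S := fun m c =>
    S.add_mem (S.smul_mem _ (hre m)) (S.smul_mem _ (him m))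
  set M : ℝ := 1 + ‖u‖ with hM
  have hM1 : 1 ≤ M := by linarith [norm_nonneg u]
  set φ' : ℝ → ℝ := fun θ => 1 + u.deriv1 θ with hφ'
  have hφpos : ∀ θ, 0 < φ' θ := hu
  have hφle : ∀ θ, φ' θ ≤ M := fun θ => by linarith [(abs_le.1 (u.abs_deriv1_le θ)).2]
  have hφd : ∀ θ, HasDerivAt φ' (u.deriv2 θ) θ := fun θ => (u.hasDerivAt_deriv1 θ).const_add 1
  -- In the coordinate `θ + u(θ)` the derivative of `h` is `h' / φ'`, and `b` is its second derivative.
  set b : ℝ → ℝ := fun θ => (h.deriv2 θ * φ' θ - h.deriv1 θ * u.deriv2 θ) / φ' θ ^ 2 / φ' θ with hb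
  have hφc : Continuous φ' := continuous_const.add u.continuous_deriv1
  have hbc : Continuous b :=
    (((h.continuous_deriv2.mul hφc).sub (h.continuous_deriv1.mul u.continuous_deriv2)).div
      (hφc.pow 2) fun θ => pow_ne_zero 2 (hφpos θ).ne').div hφc fun θ => (hφpos θ).ne'
  have hφp : Function.Periodic φ' (2 * Real.pi) := fun θ => by
    simp only [hφ', u.periodic_deriv1 θ]
  have hbp : Function.Periodic b (2 * Real.pi) := fun θ => by
    simp only [hb, hφp θ, h.periodic_deriv1 θ, h.periodic_deriv2 θ, u.periodic_deriv2 θ]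
  have hac : Continuous u.angleInv := continuous_iff_continuousAt.2 fun t =>
    ContinuousAt.comp (f := fun t : ℝ => (u, t)) (continuousAt_angleInv hu t) (by fun_prop)
  have key : ∀ ε > 0, ∃ p ∈ S, ‖h - p‖ ≤ 128 * M ^ 2 * ε := by
    intro ε hε
    obtain ⟨f, hf⟩ := exists_trig_approx (B := b ∘ u.angleInv) (hbc.comp hac) (fun θ => by
      have := angleInv_add_two_pi hu θ 1
      rw [Int.cast_one, one_mul] at this
      simp only [Function.comp, this, hbp _]) hε
    set e : ℤ → ℝ → ℂ := fun m θ => (Circle.exp (m * (θ + u.disp θ)) : ℂ) with he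
    have hed : ∀ m θ, HasDerivAt (e m) (Complex.I * m * φ' θ * e m θ) θ := fun m θ => by
      refine HasDerivAt.congr_deriv (HasDerivAt.scomp (g₁ := fun θ : ℝ => (Circle.exp θ : ℂ)) θ
        (hasDerivAt_coe_exp (m * (θ + u.disp θ))) ((u.hasDerivAt_add_disp θ).const_mul (m : ℝ))) ?_
      rw [Complex.real_smul]
      push_cast
      simp only [he, hφ']
      push_cast
      ring
    have hep : ∀ m θ, e m (θ + 2 * Real.pi) = e m θ := fun m θ => by
      simp only [he, u.periodic θ]
      congr 1
      exact Circle.exp_eq_exp.2 ⟨m, by ring⟩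
    set s := f.support.erase 0 with hs
    have hsne : ∀ m ∈ s, Complex.I * (m : ℂ) ≠ 0 := fun m hm =>
      mul_ne_zero Complex.I_ne_zero (by exact_mod_cast (Finset.mem_erase.1 hm).1)
    set q : ℝ → ℂ := fun θ => ∑ m ∈ s, f m * e m θ with hq
    have hqb : ∀ θ, |(f 0 + q θ).re - b θ| ≤ ε := fun θ => by
      have h1 := hf (θ + u.disp θ)
      have h2 : (∑ m ∈ f.support, f m * (Circle.exp (m * (θ + u.disp θ)) : ℂ)) = f 0 + q θ := by
        by_cases h0 : (0 : ℤ) ∈ f.support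
        · rw [← Finset.add_sum_erase _ _ h0]
          simp [hq, he, hs]
        · rw [hq, hs, Finset.erase_eq_of_notMem h0, Finsupp.notMem_support_iff.1 h0, zero_add]
      rw [h2, Function.comp, angleInv_eq hu rfl] at h1
      have h3 := (Complex.abs_re_le_norm _).trans h1
      rwa [Complex.sub_re, Complex.ofReal_re] at h3
    -- `P₁` and `P₂` are the first and second primitives of `q` in the coordinate `θ + u(θ)`.
    set P₁ : ℝ → ℂ := fun θ => ∑ m ∈ s, f m / (Complex.I * m) * e m θ with hP₁
    set P₂ : ℝ → ℂ := fun θ => ∑ m ∈ s, f m / (Complex.I * m) ^ 2 * e m θ with hP₂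
    have hP₁d : ∀ θ, HasDerivAt P₁ (φ' θ * q θ) θ := fun θ => by
      refine HasDerivAt.congr_deriv (HasDerivAt.fun_sum fun m (_ : m ∈ s) =>
        (hed m θ).const_mul (f m / (Complex.I * m))) ?_
      rw [hq, Finset.mul_sum]
      refine Finset.sum_congr rfl fun m hm => ?_
      have := right_ne_zero_of_mul (hsne m hm)
      field_simp
    have hP₂d : ∀ θ, HasDerivAt P₂ (φ' θ * P₁ θ) θ := fun θ => by
      refine HasDerivAt.congr_deriv (HasDerivAt.fun_sum fun m (_ : m ∈ s) =>
        (hed m θ).const_mul (f m / (Complex.I * m) ^ 2)) ?_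
      rw [hP₁, Finset.mul_sum]
      refine Finset.sum_congr rfl fun m hm => ?_
      have := right_ne_zero_of_mul (hsne m hm)
      field_simp
    -- The field `p` has displacement `Re P₂` plus the constant that makes it agree with `h` at `0`.
    set p₀ : Vect2 := ∑ m ∈ s, trig u m (f m / (Complex.I * m) ^ 2) with hp₀
    set p : Vect2 := p₀ + trig u 0 ((h - p₀).disp 0 : ℝ) with hp
    refine ⟨p, S.add_mem (S.sum_mem fun m _ => htrig _ _) (htrig _ _), ?_⟩
    set w := h - p with hw
    have hp₀d : ∀ θ, p₀.disp θ = (P₂ θ).re := fun θ => by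
      rw [hp₀, disp_sum, hP₂, Complex.re_sum]
      exact Finset.sum_congr rfl fun m _ => trig_disp hu _ _ _
    have hwd : ∀ θ, w.disp θ = h.disp θ - (P₂ θ).re - (h - p₀).disp 0 := fun θ => by
      rw [hw, disp_sub, hp, disp_add, hp₀d, trig_disp hu]
      simp
      ring
    have hw0 : w.disp 0 = 0 := by rw [hwd, disp_sub, hp₀d]; ring
    set d : ℝ → ℝ := fun θ => h.deriv1 θ / φ' θ - (P₁ θ).re with hd
    have hw1 : ∀ θ, w.deriv1 θ = d θ * φ' θ := fun θ => by
      have h1 : HasDerivAt (fun θ => (P₂ θ).re) (φ' θ * P₁ θ).re θ := by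
        exact Complex.reCLM.hasFDerivAt.comp_hasDerivAt θ (hP₂d θ)
      have h2 := ((h.hasDerivAt_disp θ).sub h1).sub_const ((h - p₀).disp 0)
      have h3 : w.disp = fun θ => h.disp θ - (P₂ θ).re - (h - p₀).disp 0 := funext hwd
      have h4 := w.hasDerivAt_disp θ
      rw [h3] at h4
      rw [h4.unique h2, hd, Complex.re_ofReal_mul]
      have := (hφpos θ).ne'
      field_simp
    set d' : ℝ → ℝ := fun θ => (b θ - (q θ).re) * φ' θ with hd'
    have hdd : ∀ θ, HasDerivAt d (d' θ) θ := fun θ => by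
      have h1 : HasDerivAt (fun θ => (P₁ θ).re) (φ' θ * q θ).re θ := by
        exact Complex.reCLM.hasFDerivAt.comp_hasDerivAt θ (hP₁d θ)
      refine HasDerivAt.congr_deriv
        (((h.hasDerivAt_deriv1 θ).div (hφd θ) (hφpos θ).ne').sub h1) ?_
      have := (hφpos θ).ne'
      rw [Complex.re_ofReal_mul, hd', hb]
      field_simp
    have hw2 : ∀ θ, w.deriv2 θ = d' θ * φ' θ + d θ * u.deriv2 θ := fun θ => by
      have h3 : w.deriv1 = fun θ => d θ * φ' θ := funext hw1
      have h4 := w.hasDerivAt_deriv1 θ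
      rw [h3] at h4
      exact h4.unique ((hdd θ).mul (hφd θ))
    have hdp : Function.Periodic d (2 * Real.pi) := fun θ => by
      simp only [hd, hP₁, h.periodic_deriv1 θ, hφp θ, hep]
    -- As `d` is periodic, `d'` vanishes somewhere. There `b` is the real part of `q`, hence the real part
    -- of the constant term `f 0` of the trigonometric polynomial is small, and it can be dropped.
    have hf0 : |(f 0).re| ≤ ε := by
      obtain ⟨t, ht⟩ := exists_zero_of_periodic hdd hdp
      have h1 := hqb t
      have h2 : b t - (q t).re = 0 := (mul_eq_zero.1 ht).resolve_right (hφpos t).ne'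
      rw [Complex.add_re, add_sub_assoc, ← neg_sub, h2, neg_zero, add_zero] at h1
      exact h1
    have hd'le : ∀ θ, |d' θ| ≤ 2 * ε * M := fun θ => by
      have h1 := hqb θ
      have h2 : |b θ - (q θ).re| ≤ 2 * ε := by
        have h3 : b θ - (q θ).re = (f 0).re - ((f 0 + q θ).re - b θ) := by
          rw [Complex.add_re]; ring
        rw [h3]
        linarith [abs_sub ((f 0).re) ((f 0 + q θ).re - b θ)]
      rw [hd', abs_mul, abs_of_pos (hφpos θ)]
      exact mul_le_mul h2 (hφle θ) (hφpos θ).le (by positivity)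
    have hdle : ∀ θ, |d θ| ≤ 16 * ε * M := fun θ => by
      obtain ⟨t, ht⟩ := exists_zero_of_periodic w.hasDerivAt_disp w.periodic
      rw [hw1] at ht
      have := abs_le_of_periodic hdd hdp hd'le ((mul_eq_zero.1 ht).resolve_right (hφpos t).ne') θ
      linarith
    have hw1le : ∀ θ, |w.deriv1 θ| ≤ 16 * ε * M * M := fun θ => by
      rw [hw1, abs_mul, abs_of_pos (hφpos θ)]
      exact mul_le_mul (hdle θ) (hφle θ) (hφpos θ).le (by positivity)
    have hεM : 0 ≤ ε * M * M := by positivity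
    refine Vect2.norm_le (by positivity) (fun θ => ?_) (fun θ => ?_) fun θ => ?_
    · have := abs_le_of_periodic w.hasDerivAt_disp w.periodic hw1le hw0 θ
      linarith
    · linarith [hw1le θ]
    · rw [hw2]
      have h1 : |d' θ * φ' θ| ≤ 2 * ε * M * M := by
        rw [abs_mul, abs_of_pos (hφpos θ)]
        exact mul_le_mul (hd'le θ) (hφle θ) (hφpos θ).le (by positivity)
      have h2 : |d θ * u.deriv2 θ| ≤ 16 * ε * M * M := by
        rw [abs_mul]
        refine mul_le_mul (hdle θ) ((u.abs_deriv2_le θ).trans ?_) (abs_nonneg _) (by positivity)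
        linarith
      linarith [abs_add_le (d' θ * φ' θ) (d θ * u.deriv2 θ)]
  rw [← SetLike.mem_coe, ← hS.closure_eq, Metric.mem_closure_iff]
  intro η hη
  obtain ⟨p, hp, hle⟩ := key (η / (256 * M ^ 2)) (by positivity)
  refine ⟨p, hp, ?_⟩
  rw [dist_eq_norm]
  refine hle.trans_lt ?_
  have : 128 * M ^ 2 * (η / (256 * M ^ 2)) = η / 2 := by
    field_simp
    norm_num
  rw [this]
  exact half_lt_self hη

end CircleDiff

section Family

variable {𝔸 : Type*} [NormedRing 𝔸] [NormedAlgebra ℂ 𝔸] [CompleteSpace 𝔸]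

/-! ### Families of systems depending on a displacement -/

/-- A family of systems `dY/dx = 𝒜(x,u) Y`, with `𝒜` the Cauchy integral of `F u`, and of their
fundamental solutions normalized at infinity, given by `Y(x) = y u x` inside and by `Y(x) = z u (1/x)`
outside of the circle, depending on a displacement `u` in a convex open set `V`, with uniform
bounds. Both `y u` and `z u` are solutions on the unit disk, the latter in the coordinate `1/x`. -/
structure Family (V : Set Vect2) (F : Vect2 → Circle → 𝔸) (y z : Vect2 → ℂ → 𝔸) (L c : ℝ) :
    Prop where
  isOpen : IsOpen V
  convex : Convex ℝ V
  pos : 0 < c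
  lower : ∀ u ∈ V, ∀ θ, c ≤ 1 + u.deriv1 θ
  bl : ∀ u ∈ V, BoundedLipschitz (F u) L
  mean : ∀ u ∈ V, circleMean (fun ξ : Circle => (ξ : ℂ) • F u ξ) = 0
  contF : ContinuousOn (fun p : ℝ × Vect2 => F p.2 (Circle.exp p.1)) (univ ×ˢ V)
  sol : ∀ u ∈ V, DiskSolution (F u) (y u)
  sol' : ∀ u ∈ V, DiskSolution (flip (F u)) (z u)
  diff : ∀ x ∈ Metric.ball (0 : ℂ) 1, ContDiffOn ℝ 1 (fun u => y u x) V
  diff' : ∀ x ∈ Metric.ball (0 : ℂ) 1, ContDiffOn ℝ 1 (fun u => z u x) V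
  bound : ∀ u ∈ V, ‖y u 0‖ ≤ L
  bound_inv : ∀ u ∈ V, ‖Ring.inverse (y u 0)‖ ≤ L
  infty : ∀ u ∈ V, z u 0 = 1
  bound_one : ‖(1 : 𝔸)‖ ≤ L

/-- Boundary values depend continuously on the point and on the parameter if the functions are
uniformly Lipschitz on the disk and depend continuously on the parameter there. -/
theorem continuousOn_diskExt_family {E : Type*} [NormedAddCommGroup E] [NormedSpace ℂ E]
    [CompleteSpace E] {V : Set Vect2} {f : Vect2 → ℂ → E} {C : NNReal}
    (hf : ∀ u ∈ V, LipschitzOnWith C (f u) (Metric.ball 0 1))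
    (hc : ∀ x ∈ Metric.ball (0 : ℂ) 1, ContinuousOn (fun u => f u x) V) :
    ContinuousOn (fun p : ℂ × Vect2 => diskExt (f p.2) p.1) (Metric.closedBall 0 1 ×ˢ V) := by
  refine continuousOn_prod_of_subset_closure_continuousOn_lipschitzOnWith _
    (s' := Metric.ball (0 : ℂ) 1) Metric.ball_subset_closedBall
    (closure_ball (0 : ℂ) one_ne_zero).ge C (fun x hx => ?_) fun u hu =>
    lipschitzOnWith_diskExt (hf u hu)
  exact (hc x hx).congr fun u hu => diskExt_eq (hf u hu) hx

namespace Family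

variable {V : Set Vect2} {F : Vect2 → Circle → 𝔸} {y z : Vect2 → ℂ → 𝔸} {L c : ℝ}
  (hV : Family V F y z L c)

include hV

theorem admissible {u : Vect2} (hu : u ∈ V) : u.Admissible := fun θ =>
  hV.pos.trans_le (hV.lower u hu θ)

theorem nonneg : 0 ≤ L := (norm_nonneg _).trans hV.bound_one

theorem lip {u : Vect2} (hu : u ∈ V) : LipschitzOnWith
    (3 * (4 * L) * (L * Real.exp (3 * (4 * L)))).toNNReal (y u) (Metric.ball 0 1) := by
  have hL := hV.nonneg
  refine ((hV.sol u hu).lipschitz (hV.bl u hu)).weaken (Real.toNNReal_mono ?_)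
  have h1 := hV.bound u hu
  gcongr <;> linarith

theorem lip_inv {u : Vect2} (hu : u ∈ V) : LipschitzOnWith
    (3 * (4 * L) * (L * Real.exp (3 * (4 * L)))).toNNReal (fun x => Ring.inverse (y u x))
    (Metric.ball 0 1) := by
  have hL := hV.nonneg
  refine ((hV.sol u hu).lipschitz_inverse (hV.bl u hu)).weaken (Real.toNNReal_mono ?_)
  have h1 := hV.bound_inv u hu
  gcongr <;> linarith

theorem lip' {u : Vect2} (hu : u ∈ V) : LipschitzOnWith
    (3 * (4 * L) * (L * Real.exp (3 * (4 * L)))).toNNReal (z u) (Metric.ball 0 1) := by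
  have hL := hV.nonneg
  refine ((hV.sol' u hu).lipschitz (hV.bl u hu).flip).weaken (Real.toNNReal_mono ?_)
  have h1 := hV.bound_one
  rw [hV.infty u hu]
  gcongr

theorem lip_inv' {u : Vect2} (hu : u ∈ V) : LipschitzOnWith
    (3 * (4 * L) * (L * Real.exp (3 * (4 * L)))).toNNReal (fun x => Ring.inverse (z u x))
    (Metric.ball 0 1) := by
  have hL := hV.nonneg
  refine ((hV.sol' u hu).lipschitz_inverse (hV.bl u hu).flip).weaken (Real.toNNReal_mono ?_)
  have h1 := hV.bound_one
  rw [hV.infty u hu, Ring.inverse_one]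
  gcongr

theorem norm_le {u : Vect2} (hu : u ∈ V) {x : ℂ} (hx : x ∈ Metric.ball (0 : ℂ) 1) :
    ‖y u x‖ ≤ L * Real.exp (3 * (4 * L)) := by
  have hL := hV.nonneg
  refine ((hV.sol u hu).norm_le (hV.bl u hu) hx).trans ?_
  have h1 := hV.bound u hu
  gcongr
  linarith

theorem norm_inv_le {u : Vect2} (hu : u ∈ V) {x : ℂ} (hx : x ∈ Metric.ball (0 : ℂ) 1) :
    ‖Ring.inverse (y u x)‖ ≤ L * Real.exp (3 * (4 * L)) := by
  have hL := hV.nonneg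
  refine ((hV.sol u hu).norm_inverse_le (hV.bl u hu) hx).trans ?_
  have h1 := hV.bound_inv u hu
  gcongr
  linarith

theorem norm_le' {u : Vect2} (hu : u ∈ V) {x : ℂ} (hx : x ∈ Metric.ball (0 : ℂ) 1) :
    ‖z u x‖ ≤ L * Real.exp (3 * (4 * L)) := by
  refine ((hV.sol' u hu).norm_le (hV.bl u hu).flip hx).trans ?_
  rw [hV.infty u hu]
  exact mul_le_mul_of_nonneg_right hV.bound_one (Real.exp_nonneg _)

theorem norm_inv_le' {u : Vect2} (hu : u ∈ V) {x : ℂ} (hx : x ∈ Metric.ball (0 : ℂ) 1) :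
    ‖Ring.inverse (z u x)‖ ≤ L * Real.exp (3 * (4 * L)) := by
  refine ((hV.sol' u hu).norm_inverse_le (hV.bl u hu).flip hx).trans ?_
  rw [hV.infty u hu, Ring.inverse_one]
  exact mul_le_mul_of_nonneg_right hV.bound_one (Real.exp_nonneg _)

theorem continuousOn_inverse {f : Vect2 → 𝔸} (hf : ContinuousOn f V) (hu : ∀ u ∈ V, IsUnit (f u)) :
    ContinuousOn (fun u => Ring.inverse (f u)) V := fun u huV => by
  obtain ⟨a, ha⟩ := hu u huV
  have h1 := NormedRing.inverse_continuousAt a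
  rw [ha] at h1
  exact ContinuousAt.comp_continuousWithinAt (g := Ring.inverse) (f := f) h1 (hf u huV)

theorem continuousOn_ext : ContinuousOn
    (fun p : ℝ × Vect2 => diskExt (y p.2) (Circle.exp p.1)) (univ ×ˢ V) :=
  (continuousOn_diskExt_family (f := y) (fun _ hu => hV.lip hu)
    fun x hx => (hV.diff x hx).continuousOn).comp
    (f := fun p : ℝ × Vect2 => ((Circle.exp p.1 : ℂ), p.2))
    ((continuous_circle_coe.comp (Circle.exp.continuous.comp continuous_fst)).prodMk
      continuous_snd).continuousOn fun _ hp => ⟨mem_closedBall_circle _, hp.2⟩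

theorem continuousOn_ext' : ContinuousOn
    (fun p : ℝ × Vect2 => diskExt (z p.2) ((Circle.exp p.1)⁻¹ : Circle)) (univ ×ˢ V) :=
  (continuousOn_diskExt_family (f := z) (fun _ hu => hV.lip' hu)
    fun x hx => (hV.diff' x hx).continuousOn).comp
    (f := fun p : ℝ × Vect2 => ((((Circle.exp p.1)⁻¹ : Circle) : ℂ), p.2))
    ((continuous_circle_coe.comp (Circle.exp.continuous.comp continuous_fst).inv).prodMk
      continuous_snd).continuousOn fun _ hp => ⟨mem_closedBall_circle _, hp.2⟩

theorem continuousOn_ext_inv' : ContinuousOn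
    (fun p : ℝ × Vect2 => Ring.inverse (diskExt (z p.2) ((Circle.exp p.1)⁻¹ : Circle)))
    (univ ×ˢ V) := by
  have h := (continuousOn_diskExt_family (f := fun u x => Ring.inverse (z u x))
    (fun _ hu => hV.lip_inv' hu) fun x hx => hV.continuousOn_inverse (hV.diff' x hx).continuousOn
      fun u hu => (hV.sol' u hu).isUnit x hx).comp
    (f := fun p : ℝ × Vect2 => ((((Circle.exp p.1)⁻¹ : Circle) : ℂ), p.2))
    ((continuous_circle_coe.comp (Circle.exp.continuous.comp continuous_fst).inv).prodMk
      continuous_snd).continuousOn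
    (t := Metric.closedBall 0 1 ×ˢ V) (s := univ ×ˢ V) fun _ hp => ⟨mem_closedBall_circle _, hp.2⟩
  exact h.congr fun p hp => (hV.sol' p.2 hp.2).inverse_diskExt (hV.bl p.2 hp.2).flip _

theorem continuousOn_vel (h : Vect2) : ContinuousOn
    (fun p : ℝ × Vect2 => vel p.2 h (Circle.exp p.1)) (univ ×ˢ V) := by
  have h1 : ContinuousOn (fun p : ℝ × Vect2 => Complex.I * (Circle.exp p.1 : ℂ) *
      (h.disp (p.2.angleInv p.1) : ℝ)) (univ ×ˢ V) := by
    refine ContinuousOn.mul (Continuous.continuousOn (continuous_const.mul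
      (continuous_circle_coe.comp (Circle.exp.continuous.comp continuous_fst)))) ?_
    refine (Complex.continuous_ofReal.comp h.continuous_disp).comp_continuousOn ?_
    rintro ⟨θ, u⟩ ⟨-, hu⟩
    refine ContinuousAt.continuousWithinAt ?_
    exact ContinuousAt.comp (g := fun p : Vect2 × ℝ => p.1.angleInv p.2) (f := Prod.swap)
      (x := (θ, u)) (continuousAt_angleInv (hV.admissible hu) θ) continuous_swap.continuousAt
  exact h1.congr fun p hp => vel_exp (hV.admissible hp.2) h p.1

theorem boundedLipschitz_vel_smul (h : Vect2) {u : Vect2} (hu : u ∈ V) :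
    BoundedLipschitz (fun ξ => vel u h ξ • F u ξ) (2 * (2 * ((1 + c⁻¹) * ‖h‖) * L)) :=
  (boundedLipschitz_vel hV.pos (hV.lower u hu) h).smul (hV.bl u hu)

theorem continuousOn_cauchyT_vel (h : Vect2) {x : ℂ} (hx : ‖x‖ ≠ 1) :
    ContinuousOn (fun u => cauchyT (fun ξ => vel u h ξ • F u ξ) x) V := by
  intro u hu
  obtain ⟨K, hK0, hK⟩ := exists_norm_le (continuous_cauchyKernel hx)
  refine tendsto_circleMean (K * (2 * (2 * ((1 + c⁻¹) * ‖h‖) * L))) 1 ?_ ?_ fun ξ _ => ?_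
  · filter_upwards [self_mem_nhdsWithin] with v hv
    exact continuous_cauchyT_integrand (hV.boundedLipschitz_vel_smul h hv).continuous hx
  · filter_upwards [self_mem_nhdsWithin] with v hv ξ
    rw [norm_smul]
    exact mul_le_mul (hK ξ) ((hV.boundedLipschitz_vel_smul h hv).bound ξ) (norm_nonneg _) hK0
  · obtain ⟨θ, rfl⟩ := Circle.exp_surjective ξ
    have h1 := ((hV.continuousOn_vel h).smul hV.contF).comp (f := fun v : Vect2 => (θ, v)) (s := V)
      (by fun_prop) (fun v hv => ⟨mem_univ _, hv⟩)
    exact (h1 u hu).const_smul ((Circle.exp θ : ℂ) / (Circle.exp θ - x))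

/-! ### From invariant monodromy to the equations of variation -/

/-- If the monodromy is transported by the diffeomorphisms then the logarithmic derivatives of the
fundamental solutions with respect to `u` are Cauchy integrals: the quotient of two of the fundamental
solutions is the Cauchy integral of its jump, in which the limit of difference quotients is taken. -/
theorem variation_of_monodromy (hmon : ∀ u ∈ V, ∀ v ∈ V, ∀ a : ℝ,
      monodromy (y u) (z u) (Circle.exp (a + u.disp a))
        = monodromy (y v) (z v) (Circle.exp (a + v.disp a)))
    {u : Vect2} (hu : u ∈ V) (h : Vect2) :
    (∀ x ∈ Metric.ball (0 : ℂ) 1, fderiv ℝ (fun u => y u x) u h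
      = -cauchyT (fun ξ => vel u h ξ • F u ξ) x * y u x) ∧
    (∀ w ∈ Metric.ball (0 : ℂ) 1, w ≠ 0 → fderiv ℝ (fun u => z u w) u h
      = -cauchyT (fun ξ => vel u h ξ • F u ξ) w⁻¹ * z u w) := by
  -- The derivative is taken along the segment `p t = u + t h`; `g` is the monodromy at `t = 0`.
  set p : ℝ → Vect2 := fun t => u + t • h with hp
  have hp0 : p 0 = u := by simp [hp]
  have hpc : Continuous p := by fun_prop
  have hpd : HasDerivAt p h 0 := by
    have h1 := ((hasDerivAt_id (0 : ℝ)).smul_const h).const_add u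
    rw [one_smul] at h1
    exact h1
  have hpV : ∀ᶠ t in 𝓝 0, p t ∈ V :=
    hpc.continuousAt.eventually (hV.isOpen.mem_nhds (hp0.symm ▸ hu))
  have hpV' : ∀ᶠ t in 𝓝[≠] 0, p t ∈ V := hpV.filter_mono nhdsWithin_le_nhds
  have hua := hV.admissible hu
  have hF := hV.bl u hu
  have hL := hV.nonneg
  set D := L * Real.exp (3 * (4 * L)) with hD
  have hD0 : 0 ≤ D := by positivity
  set g : ℝ → 𝔸 := fun θ => monodromy (y u) (z u) (Circle.exp θ) with hg
  set g' : ℝ → 𝔸 := fun θ => Ring.inverse (diskExt (z u) ((Circle.exp θ)⁻¹ : Circle)) *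
    ((Complex.I * Circle.exp θ) • F u (Circle.exp θ)) * diskExt (y u) (Circle.exp θ) with hg'
  have hgd : ∀ θ, HasDerivAt g (g' θ) θ :=
    hasDerivAt_monodromy hF (hV.mean u hu) (hV.sol u hu) (hV.sol' u hu)
  have hg'b : ∀ θ, ‖g' θ‖ ≤ D * L * D := fun θ => by
    refine norm_mul_le_of_le (norm_mul_le_of_le ?_ ?_)
      (norm_diskExt_le (hV.lip hu) (fun x hx => hV.norm_le hu hx) _)
    · rw [(hV.sol' u hu).inverse_diskExt hF.flip]
      exact norm_diskExt_le (hV.lip_inv' hu) (fun x hx => hV.norm_inv_le' hu hx) _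
    · rw [norm_smul, norm_mul, Complex.norm_I, Circle.norm_coe, one_mul, one_mul]
      exact hF.bound _
  have hgl : ∀ s t, ‖g s - g t‖ ≤ D * L * D * |s - t| := fun s t => by
    have := (convex_univ (𝕜 := ℝ) (E := ℝ)).norm_image_sub_le_of_norm_hasDerivWithin_le
      (f := g) (f' := g') (C := D * L * D) (x := t) (y := s)
      (fun x _ => (hgd x).hasDerivWithinAt) (fun x _ => hg'b x) (mem_univ _) (mem_univ _)
    simpa using this
  -- The monodromy at time `t` is the monodromy at time `0`, reparametrized.
  have hmt : ∀ t, p t ∈ V → ∀ θ, monodromy (y (p t)) (z (p t)) (Circle.exp θ)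
      = g (θ - t * h.disp ((p t).angleInv θ)) := fun t ht θ => by
    have h1 := (p t).angleInv_add_disp θ
    have h2 := hmon (p t) ht u hu ((p t).angleInv θ)
    rw [h1] at h2
    rw [h2, hg]
    have h3 : (p t).disp ((p t).angleInv θ)
        = u.disp ((p t).angleInv θ) + t * h.disp ((p t).angleInv θ) := rfl
    simp only
    congr 2
    linarith
  -- `J t` is the jump across the circle of the quotient of the fundamental solutions at the times `t`
  -- and `0`; its quotient by `t` is bounded and converges pointwise as `t → 0`.
  set J : ℝ → Circle → 𝔸 := fun t ξ => diskExt (z (p t)) (ξ⁻¹ : Circle) *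
    (monodromy (y (p t)) (z (p t)) ξ - monodromy (y u) (z u) ξ) *
      Ring.inverse (diskExt (y u) ξ) with hJ
  have hJc : ∀ t, p t ∈ V → Continuous (J t) := fun t ht => by
    refine (((continuous_diskExt_coe (hV.lip' ht)).comp continuous_inv).mul
      ((continuous_monodromy (hV.bl _ ht) (hV.sol _ ht) (hV.sol' _ ht)).sub
        (continuous_monodromy hF (hV.sol _ hu) (hV.sol' _ hu)))).mul ?_
    simp only [(hV.sol u hu).inverse_diskExt hF]
    exact continuous_diskExt_coe (hV.lip_inv hu)
  have hJb : ∀ t, p t ∈ V → t ≠ 0 → ∀ ξ,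
      ‖(t⁻¹ : ℝ) • J t ξ‖ ≤ D * (D * L * D * ‖h‖) * D := by
    intro t ht ht0 ξ
    obtain ⟨θ, rfl⟩ := Circle.exp_surjective ξ
    have e : (t⁻¹ : ℝ) • J t (Circle.exp θ) = diskExt (z (p t)) ((Circle.exp θ)⁻¹ : Circle) *
        ((t⁻¹ : ℝ) • (monodromy (y (p t)) (z (p t)) (Circle.exp θ) -
          monodromy (y u) (z u) (Circle.exp θ))) *
        Ring.inverse (diskExt (y u) (Circle.exp θ)) := by
      rw [hJ, mul_smul_comm, smul_mul_assoc]
    rw [e]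
    refine norm_mul_le_of_le (norm_mul_le_of_le
      (norm_diskExt_le (hV.lip' ht) (fun x hx => hV.norm_le' ht hx) _) ?_) ?_
    · rw [hmt t ht, norm_smul, norm_inv, Real.norm_eq_abs, inv_mul_le_iff₀ (abs_pos.2 ht0)]
      refine (hgl _ _).trans ?_
      rw [sub_sub_cancel_left, abs_neg, abs_mul]
      have := h.abs_disp_le ((p t).angleInv θ)
      have h3 : 0 ≤ D * L * D := by positivity
      calc D * L * D * (|t| * |h.disp ((p t).angleInv θ)|) ≤ D * L * D * (|t| * ‖h‖) := by gcongr
        _ = |t| * (D * L * D * ‖h‖) := by ring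
    · rw [(hV.sol u hu).inverse_diskExt hF]
      exact norm_diskExt_le (hV.lip_inv hu) (fun x hx => hV.norm_inv_le hu hx) _
  have hJl : ∀ ξ, Tendsto (fun t : ℝ => (t⁻¹ : ℝ) • J t ξ) (𝓝[≠] 0)
      (𝓝 (-(vel u h ξ • F u ξ))) := by
    intro ξ
    obtain ⟨θ, rfl⟩ := Circle.exp_surjective ξ
    have c1 : Tendsto (fun t => diskExt (z (p t)) ((Circle.exp θ)⁻¹ : Circle)) (𝓝 0)
        (𝓝 (diskExt (z u) ((Circle.exp θ)⁻¹ : Circle))) := by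
      have h1 : ContinuousAt (fun p : ℝ × Vect2 => diskExt (z p.2) ((Circle.exp p.1)⁻¹ : Circle))
        (θ, p 0) := hV.continuousOn_ext'.continuousAt
          (prod_mem_nhds univ_mem (hV.isOpen.mem_nhds (hp0.symm ▸ hu)))
      have h2 := ContinuousAt.comp (f := fun t : ℝ => (θ, p t)) (x := 0) h1 (by fun_prop)
      have h3 := h2.tendsto
      simp only [Function.comp_def, hp0] at h3
      exact h3
    have c2 : HasDerivAt (fun t : ℝ => θ - t * h.disp ((p t).angleInv θ))
        (-h.disp (u.angleInv θ)) 0 := by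
      have h1 : ContinuousAt (fun t : ℝ => h.disp ((p t).angleInv θ)) 0 := by
        refine h.continuous_disp.continuousAt.comp ?_
        have h2 : ContinuousAt (fun p : Vect2 × ℝ => p.1.angleInv p.2) (p 0, θ) :=
          continuousAt_angleInv (hp0.symm ▸ hua) θ
        exact ContinuousAt.comp (f := fun t : ℝ => (p t, θ)) (x := 0) h2 (by fun_prop)
      have h3 : HasDerivAt (fun t : ℝ => t * h.disp ((p t).angleInv θ))
          (h.disp (u.angleInv θ)) 0 := by
        rw [hasDerivAt_iff_tendsto_slope]
        have h4 := h1.tendsto.mono_left (nhdsWithin_le_nhds (s := {0}ᶜ))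
        rw [hp0] at h4
        refine h4.congr' ?_
        filter_upwards [self_mem_nhdsWithin] with t ht
        have : t ≠ 0 := ht
        rw [slope_def_field]
        field_simp
        simp
      simpa using h3.const_sub θ
    have c3 : HasDerivAt (fun t : ℝ => g (θ - t * h.disp ((p t).angleInv θ)))
        (-h.disp (u.angleInv θ) • g' θ) 0 := by
      refine HasDerivAt.scomp (g₁ := g) 0 ?_ c2
      have := hgd (θ - 0 * h.disp ((p 0).angleInv θ))
      rwa [zero_mul, sub_zero] at this ⊢
    have c4 : Tendsto (fun t : ℝ => (t⁻¹ : ℝ) • (monodromy (y (p t)) (z (p t)) (Circle.exp θ) -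
        monodromy (y u) (z u) (Circle.exp θ))) (𝓝[≠] 0) (𝓝 (-h.disp (u.angleInv θ) • g' θ)) := by
      refine (hasDerivAt_iff_tendsto_slope.1 c3).congr' ?_
      filter_upwards [hpV'] with t ht
      rw [hmt t ht, slope_def_module, sub_zero, zero_mul, sub_zero]
    have c5 := ((c1.mono_left (nhdsWithin_le_nhds (s := {0}ᶜ))).mul c4).mul_const
      (Ring.inverse (diskExt (y u) (Circle.exp θ)))
    have e1 : diskExt (z u) ((Circle.exp θ)⁻¹ : Circle) * (-h.disp (u.angleInv θ) • g' θ) *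
        Ring.inverse (diskExt (y u) (Circle.exp θ)) = -(vel u h (Circle.exp θ) • F u (Circle.exp θ)) := by
      have u1 := (hV.sol' u hu).isUnit_diskExt hF.flip (Circle.exp θ)⁻¹
      have u2 := (hV.sol u hu).isUnit_diskExt hF (Circle.exp θ)
      rw [vel_exp hua, hg', mul_smul_comm, smul_mul_assoc]
      simp only [mul_assoc]
      rw [Ring.mul_inverse_cancel _ u2, mul_one, ← mul_assoc, Ring.mul_inverse_cancel _ u1, one_mul,
        neg_smul, ← Complex.coe_smul, smul_smul]
      congr 2
      ring
    rw [e1] at c5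
    refine c5.congr fun t => ?_
    rw [hJ, mul_smul_comm, smul_mul_assoc]
  have hC : ∀ x : ℂ, ‖x‖ ≠ 1 → Tendsto (fun t : ℝ => (t⁻¹ : ℝ) • cauchyT (J t) x) (𝓝[≠] 0)
      (𝓝 (-cauchyT (fun ξ => vel u h ξ • F u ξ) x)) := by
    intro x hx
    obtain ⟨K, hK0, hK⟩ := exists_norm_le (continuous_cauchyKernel hx)
    have e1 : -cauchyT (fun ξ => vel u h ξ • F u ξ) x
        = circleMean fun ξ => ((ξ : ℂ) / (ξ - x)) • -(vel u h ξ • F u ξ) := by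
      rw [cauchyT, ← circleMean_neg]
      simp only [smul_neg]
    have e2 : ∀ t : ℝ, (t⁻¹ : ℝ) • cauchyT (J t) x
        = circleMean fun ξ => ((ξ : ℂ) / (ξ - x)) • (t⁻¹ : ℝ) • J t ξ := fun t => by
      rw [← Complex.coe_smul, cauchyT, ← circleMean_smul]
      congr 1
      funext ξ
      rw [← Complex.coe_smul, smul_comm]
    rw [e1]
    simp only [e2]
    refine tendsto_circleMean (K * (D * (D * L * D * ‖h‖) * D)) 1 ?_ ?_ fun ξ _ =>
      (hJl ξ).const_smul _
    · filter_upwards [hpV'] with t ht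
      exact (continuous_cauchyKernel hx).smul ((hJc t ht).const_smul _)
    · filter_upwards [hpV', self_mem_nhdsWithin] with t ht ht0 ξ
      rw [norm_smul]
      exact mul_le_mul (hK ξ) (hJb t ht ht0 ξ) (norm_nonneg _) hK0
  have hfin : ∀ (f : Vect2 → 𝔸) (x : ℂ), ContDiffOn ℝ 1 f V → IsUnit (f u) → ‖x‖ ≠ 1 →
      (∀ t, p t ∈ V → f (p t) * Ring.inverse (f u) - 1 = cauchyT (J t) x) →
      fderiv ℝ f u h = -cauchyT (fun ξ => vel u h ξ • F u ξ) x * f u := by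
    intro f x hf hfu hx hfJ
    have d1 : HasFDerivAt f (fderiv ℝ f u) (p 0) := by
      rw [hp0]
      exact ((hf.differentiableOn one_ne_zero).differentiableAt (hV.isOpen.mem_nhds hu)).hasFDerivAt
    have d2 : HasDerivAt (fun t => f (p t)) (fderiv ℝ f u h) 0 := d1.comp_hasDerivAt 0 hpd
    have d3 := (hasDerivAt_iff_tendsto_slope.1 d2).mul_const (Ring.inverse (f u))
    have d4 : Tendsto (fun t : ℝ => (t⁻¹ : ℝ) • cauchyT (J t) x) (𝓝[≠] 0)
        (𝓝 (fderiv ℝ f u h * Ring.inverse (f u))) := by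
      refine d3.congr' ?_
      filter_upwards [hpV'] with t ht
      rw [slope_def_module, sub_zero, hp0, smul_mul_assoc, sub_mul, Ring.mul_inverse_cancel _ hfu,
        hfJ t ht]
    have d5 := tendsto_nhds_unique d4 (hC x hx)
    rw [← d5, mul_assoc, Ring.inverse_mul_cancel _ hfu, mul_one]
  have hcmp : ∀ t, p t ∈ V → _ := fun t ht => mul_inverse_sub_one hF (hV.sol u hu) (hV.sol' u hu)
    (hV.infty u hu) (hV.bl _ ht) (hV.sol _ ht) (hV.sol' _ ht) (hV.infty _ ht)
  constructor
  · intro x hx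
    have hx' : ‖x‖ < 1 := by simpa using hx
    exact hfin (fun u => y u x) x (hV.diff x hx) ((hV.sol u hu).isUnit x hx) hx'.ne
      fun t ht => (hcmp t ht).1 x hx'
  · intro w hw hw0
    have hw' : 1 < ‖w⁻¹‖ := by
      rw [norm_inv]
      exact (one_lt_inv₀ (norm_pos_iff.2 hw0)).2 (by simpa using hw)
    refine hfin (fun u => z u w) w⁻¹ (hV.diff' w hw) ((hV.sol' u hu).isUnit w hw) hw'.ne'
      fun t ht => ?_
    have := (hcmp t ht).2 w⁻¹ hw'
    rwa [inv_inv] at this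

end Family

end Family

/-! ### From the equations of variation to invariant monodromy -/

/-- The chain rule along a path `t ↦ (φ t, t)` for a function of two real variables with
continuous partial derivatives. -/
theorem hasDerivAt_of_partial {E : Type*} [NormedAddCommGroup E] [NormedSpace ℝ E]
    {f f₁ f₂ : ℝ → ℝ → E} {I : Set ℝ} (hI : IsOpen I)
    (h₁ : ∀ θ, ∀ t ∈ I, HasDerivAt (fun s => f s t) (f₁ θ t) θ)
    (h₂ : ∀ θ, ∀ t ∈ I, HasDerivAt (fun s => f θ s) (f₂ θ t) t)
    (hc₁ : ContinuousOn (fun p : ℝ × ℝ => f₁ p.1 p.2) (univ ×ˢ I))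
    (hc₂ : ContinuousOn (fun p : ℝ × ℝ => f₂ p.1 p.2) (univ ×ˢ I))
    {φ : ℝ → ℝ} {φ' t : ℝ} (ht : t ∈ I) (hφ : HasDerivAt φ φ' t) :
    HasDerivAt (fun s => f (φ s) s) (φ' • f₁ (φ t) t + f₂ (φ t) t) t := by
  have hn : (univ : Set ℝ) ×ˢ I ∈ 𝓝 (φ t, t) := prod_mem_nhds univ_mem (hI.mem_nhds ht)
  have key : HasStrictFDerivAt (fun p : ℝ × ℝ => f p.1 p.2)
      ((ContinuousLinearMap.toSpanSingleton ℝ (f₁ (φ t) t)).coprod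
        (ContinuousLinearMap.toSpanSingleton ℝ (f₂ (φ t) t))) (φ t, t) := by
    refine hasStrictFDerivAt_uncurry_coprod (𝕜 := ℝ) (f := f) (u := (φ t, t))
      (f₁ := fun θ t => ContinuousLinearMap.toSpanSingleton ℝ (f₁ θ t))
      (f₂ := fun θ t => ContinuousLinearMap.toSpanSingleton ℝ (f₂ θ t)) ?_ ?_ ?_ ?_
    · filter_upwards [hn] with p hp
      exact (h₁ p.1 p.2 hp.2).hasFDerivAt
    · filter_upwards [hn] with p hp
      exact (h₂ p.1 p.2 hp.2).hasFDerivAt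
    · exact (ContinuousLinearMap.toSpanSingletonCLE (𝕜 := ℝ) (E := E)).continuous.continuousAt.comp
        (hc₁.continuousAt hn)
    · exact (ContinuousLinearMap.toSpanSingletonCLE (𝕜 := ℝ) (E := E)).continuous.continuousAt.comp
        (hc₂.continuousAt hn)
  have h3 := key.hasFDerivAt.comp_hasDerivAt (f := fun s => (φ s, s)) t (hφ.prodMk (hasDerivAt_id t))
  refine HasDerivAt.congr_deriv h3 ?_
  simp

namespace Family

variable {𝔸 : Type*} [NormedRing 𝔸] [NormedAlgebra ℂ 𝔸] [CompleteSpace 𝔸]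

variable {V : Set Vect2} {F : Vect2 → Circle → 𝔸} {y z : Vect2 → ℂ → 𝔸} {L c : ℝ}
  (hV : Family V F y z L c)

include hV

/-- If the logarithmic derivatives of the fundamental solutions with respect to `u` are the Cauchy
integrals of `-vel u h • F u`, then along a curve in `V` the derivative of the monodromy at a fixed
point of the circle is given by the jump of these Cauchy integrals. -/
theorem hasDerivAt_monodromy_of_variation
    (hvar : ∀ u ∈ V, ∀ h, ∀ x ∈ Metric.ball (0 : ℂ) 1, fderiv ℝ (fun u => y u x) u h
      = -cauchyT (fun ξ => vel u h ξ • F u ξ) x * y u x)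
    (hvar' : ∀ u ∈ V, ∀ h, ∀ w ∈ Metric.ball (0 : ℂ) 1, w ≠ 0 → fderiv ℝ (fun u => z u w) u h
      = -cauchyT (fun ξ => vel u h ξ • F u ξ) w⁻¹ * z u w)
    {p : ℝ → Vect2} {h : Vect2} (hp : ∀ t, HasDerivAt p h t) (hI : (p ⁻¹' V).OrdConnected)
    (θ : ℝ) {t : ℝ} (ht : p t ∈ V) :
    HasDerivAt (fun t => monodromy (y (p t)) (z (p t)) (Circle.exp θ))
      (-(Ring.inverse (diskExt (z (p t)) ((Circle.exp θ)⁻¹ : Circle)) *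
        (vel (p t) h (Circle.exp θ) • F (p t) (Circle.exp θ)) *
        diskExt (y (p t)) (Circle.exp θ))) t := by
  have hpc : Continuous p := continuous_iff_continuousAt.2 fun t => (hp t).continuousAt
  have hD : 0 ≤ L * Real.exp (3 * (4 * L)) := mul_nonneg hV.nonneg (Real.exp_nonneg _)
  set D := L * Real.exp (3 * (4 * L))
  set ξ := Circle.exp θ with hξ
  have hθ : MapsTo (fun t => ((θ, p t) : ℝ × Vect2)) (p ⁻¹' V) (univ ×ˢ V) :=
    fun t ht => ⟨mem_univ _, ht⟩
  have hθc : ContinuousOn (fun t => ((θ, p t) : ℝ × Vect2)) (p ⁻¹' V) := by fun_prop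
  set a : ℝ → ℂ → 𝔸 := fun t => cauchyT fun ξ => vel (p t) h ξ • F (p t) ξ with ha
  -- The monodromy is the limit as `r → 1` of its analogues at radius `r`, whose derivatives are known.
  refine hasDerivAt_of_tendsto_of_bounded (l := 𝓝[<] (1 : ℝ)) (I := p ⁻¹' V)
    (H := fun r t => Ring.inverse (z (p t) (r * (ξ⁻¹ : Circle))) * y (p t) (r * ξ))
    (H' := fun r t => -(Ring.inverse (z (p t) (r * (ξ⁻¹ : Circle))) *
      (a t (r * ξ) - a t (ξ / r)) * y (p t) (r * ξ)))
    (h' := fun t => -(Ring.inverse (diskExt (z (p t)) (ξ⁻¹ : Circle)) *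
        (vel (p t) h ξ • F (p t) ξ) * diskExt (y (p t)) ξ))
    (C := D * (5 * (2 * (2 * ((1 + c⁻¹) * ‖h‖) * L))) * D)
    (hV.isOpen.preimage hpc) hI ?_ ?_ ?_ (fun t ht => ?_) (fun t ht => ?_) ?_ ht
  · filter_upwards [eventually_mem_Ioo_one] with r hr t ht
    have m1 := mul_circle_mem_ball hr ξ
    have m2 := mul_circle_mem_ball hr ξ⁻¹
    have w0 : (r : ℂ) * (ξ⁻¹ : Circle) ≠ 0 :=
      mul_ne_zero (by exact_mod_cast hr.1.ne') (Circle.coe_ne_zero _)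
    have wi : ((r : ℂ) * (ξ⁻¹ : Circle))⁻¹ = ξ / r := by
      rw [mul_inv, Circle.coe_inv, inv_inv, div_eq_mul_inv, mul_comm]
    have d1 : HasDerivAt (fun t => y (p t) (r * ξ)) (-a t (r * ξ) * y (p t) (r * ξ)) t := by
      rw [← hvar (p t) ht h _ m1]
      exact (((hV.diff _ m1).differentiableOn one_ne_zero).differentiableAt
        (hV.isOpen.mem_nhds ht)).hasFDerivAt.comp_hasDerivAt t (hp t)
    have d2 : HasDerivAt (fun t => z (p t) (r * (ξ⁻¹ : Circle)))
        (-a t (ξ / r) * z (p t) (r * (ξ⁻¹ : Circle))) t := by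
      rw [← wi, ← hvar' (p t) ht h _ m2 w0]
      exact (((hV.diff' _ m2).differentiableOn one_ne_zero).differentiableAt
        (hV.isOpen.mem_nhds ht)).hasFDerivAt.comp_hasDerivAt t (hp t)
    have hu := (hV.sol' (p t) ht).isUnit _ m2
    refine ((d2.ringInverse hu).mul d1).congr_deriv ?_
    simp only [neg_mul, mul_neg, mul_assoc]
    rw [Ring.mul_inverse_cancel_left _ _ hu, neg_neg, sub_mul, mul_sub]
    abel
  · filter_upwards [eventually_mem_Ioo_one] with r hr
    have m1 := mul_circle_mem_ball hr ξ
    have m2 := mul_circle_mem_ball hr ξ⁻¹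
    have n1 : ‖(r : ℂ) * ξ‖ ≠ 1 := by rw [norm_mul_circle hr.1.le]; exact hr.2.ne
    have n2 : ‖(ξ : ℂ) / r‖ ≠ 1 := by
      rw [norm_div_circle hr.1.le]; exact ((one_lt_inv₀ hr.1).2 hr.2).ne'
    have k1 : ContinuousOn p (p ⁻¹' V) := hpc.continuousOn
    have k2 : MapsTo p (p ⁻¹' V) V := fun t ht => ht
    exact ((((hV.continuousOn_inverse (hV.diff' _ m2).continuousOn
      fun u hu => (hV.sol' u hu).isUnit _ m2).comp k1 k2).mul
      (((hV.continuousOn_cauchyT_vel h n1).comp k1 k2).sub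
        ((hV.continuousOn_cauchyT_vel h n2).comp k1 k2))).mul
      ((hV.diff _ m1).continuousOn.comp k1 k2)).neg
  · filter_upwards [eventually_mem_Ioo_one] with r hr t ht
    rw [norm_neg]
    exact norm_mul_le_of_le (norm_mul_le_of_le (hV.norm_inv_le' ht (mul_circle_mem_ball hr _))
      ((hV.boundedLipschitz_vel_smul h ht).norm_jump_le ξ hr.1 hr.2))
      (hV.norm_le ht (mul_circle_mem_ball hr _))
  · exact tendsto_monodromy (hV.bl _ ht) (hV.sol _ ht) (hV.sol' _ ht) ξ
  · rw [(hV.sol' _ ht).inverse_diskExt (hV.bl _ ht).flip]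
    exact (((tendsto_diskExt_radial (hV.lip_inv' ht) ξ⁻¹).mul
      ((hV.boundedLipschitz_vel_smul h ht).tendsto_jump ξ)).mul
      (tendsto_diskExt_radial (hV.lip ht) ξ)).neg
  · exact (((hV.continuousOn_ext_inv'.comp hθc hθ).mul
      (((hV.continuousOn_vel h).comp hθc hθ).smul (hV.contF.comp hθc hθ))).mul
      (hV.continuousOn_ext.comp hθc hθ)).neg

/-- If the logarithmic derivatives of the fundamental solutions with respect to `u` are the Cauchy
integrals of `-vel u h • F u`, then the monodromy is transported by the diffeomorphisms. -/
theorem monodromy_of_variation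
    (hvar : ∀ u ∈ V, ∀ h, ∀ x ∈ Metric.ball (0 : ℂ) 1, fderiv ℝ (fun u => y u x) u h
      = -cauchyT (fun ξ => vel u h ξ • F u ξ) x * y u x)
    (hvar' : ∀ u ∈ V, ∀ h, ∀ w ∈ Metric.ball (0 : ℂ) 1, w ≠ 0 → fderiv ℝ (fun u => z u w) u h
      = -cauchyT (fun ξ => vel u h ξ • F u ξ) w⁻¹ * z u w)
    {u v : Vect2} (hu : u ∈ V) (hv : v ∈ V) (a : ℝ) :
    monodromy (y u) (z u) (Circle.exp (a + u.disp a))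
      = monodromy (y v) (z v) (Circle.exp (a + v.disp a)) := by
  -- Along the segment from `u` to `v`, the derivative of the monodromy at the moving image of `e^{ia}`
  -- vanishes.
  set h : Vect2 := v - u with hh
  set p : ℝ → Vect2 := ⇑(AffineMap.lineMap (k := ℝ) u v) with hp
  have hpd : ∀ t, HasDerivAt p h t := fun t => AffineMap.hasDerivAt_lineMap
  have hpc : Continuous p := continuous_iff_continuousAt.2 fun t => (hpd t).continuousAt
  have hI' : Convex ℝ (p ⁻¹' V) := hV.convex.affine_preimage (AffineMap.lineMap (k := ℝ) u v)
  have hI : (p ⁻¹' V).OrdConnected := hI'.ordConnected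
  have hIo := hV.isOpen.preimage hpc
  have hpa : ∀ t, (p t).disp a = u.disp a + t * h.disp a := fun t => by
    rw [hp, AffineMap.lineMap_apply_module', ← hh, add_comm]
    rfl
  have hφ : ∀ t, HasDerivAt (fun t => a + (p t).disp a) (h.disp a) t := fun t => by
    simp only [hpa]
    exact (((hasDerivAt_mul_const (h.disp a)).const_add (u.disp a)).const_add a)
  have hq : MapsTo (fun q : ℝ × ℝ => (q.1, p q.2)) (univ ×ˢ (p ⁻¹' V)) (univ ×ˢ V) :=
    fun q hq => ⟨mem_univ _, hq.2⟩
  have hqc : ContinuousOn (fun q : ℝ × ℝ => (q.1, p q.2)) (univ ×ˢ (p ⁻¹' V)) := by fun_prop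
  have k1 := hV.continuousOn_ext_inv'.comp hqc hq
  have k2 := hV.continuousOn_ext.comp hqc hq
  have k3 := hV.contF.comp hqc hq
  have k4 := (hV.continuousOn_vel h).comp hqc hq
  have k5 : ContinuousOn (fun q : ℝ × ℝ => Complex.I * (Circle.exp q.1 : ℂ))
      (univ ×ˢ (p ⁻¹' V)) := Continuous.continuousOn (continuous_const.mul
    (continuous_circle_coe.comp (Circle.exp.continuous.comp continuous_fst)))
  simp only [Function.comp_def] at k1 k2 k3 k4
  have key : ∀ t ∈ p ⁻¹' V, HasDerivAt
      (fun t => monodromy (y (p t)) (z (p t)) (Circle.exp (a + (p t).disp a))) 0 t := by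
    intro t ht
    have h1 := hasDerivAt_of_partial hIo
      (f := fun θ t => monodromy (y (p t)) (z (p t)) (Circle.exp θ))
      (f₁ := fun θ t => Ring.inverse (diskExt (z (p t)) ((Circle.exp θ)⁻¹ : Circle)) *
        ((Complex.I * Circle.exp θ) • F (p t) (Circle.exp θ)) * diskExt (y (p t)) (Circle.exp θ))
      (f₂ := fun θ t => -(Ring.inverse (diskExt (z (p t)) ((Circle.exp θ)⁻¹ : Circle)) *
        (vel (p t) h (Circle.exp θ) • F (p t) (Circle.exp θ)) * diskExt (y (p t)) (Circle.exp θ)))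
      (fun θ t ht => hasDerivAt_monodromy (hV.bl _ ht) (hV.mean _ ht) (hV.sol _ ht)
        (hV.sol' _ ht) θ)
      (fun θ t ht => hV.hasDerivAt_monodromy_of_variation hvar hvar' hpd hI θ ht)
      ((k1.mul (k5.smul k3)).mul k2) ((k1.mul (k4.smul k3)).mul k2).neg ht (hφ t)
    -- The velocity of `a + (p t) a` cancels the two partial derivatives against each other.
    refine h1.congr_deriv ?_
    rw [vel_exp (hV.admissible ht), Vect2.angleInv_eq (hV.admissible ht) rfl, ← Complex.coe_smul,
      ← smul_mul_assoc, ← mul_smul_comm, smul_smul, mul_comm ((h.disp a : ℝ) : ℂ), add_neg_cancel]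
  have h0 : (0 : ℝ) ∈ p ⁻¹' V := by simpa [hp] using hu
  have h1 : (1 : ℝ) ∈ p ⁻¹' V := by simpa [hp] using hv
  have := hIo.is_const_of_deriv_eq_zero hI'.isPreconnected
    (fun t ht => (key t ht).differentiableAt.differentiableWithinAt)
    (fun t ht => (key t ht).deriv) h0 h1
  simpa [hp] using this

end Family

/-! ### Locally uniform bounds for functions of class `C¹` -/

/-- A `C¹` function of an angle and a parameter is bounded and Lipschitz in the angle, uniformly for
parameters near a given one. -/
theorem exists_eventually_bound {E X : Type*} [NormedAddCommGroup E] [NormedSpace ℝ E]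
    [NormedAddCommGroup X] [NormedSpace ℝ X] {f : ℝ × X → E} {W : Set X} (hW : IsOpen W)
    (hf : ContDiffOn ℝ 1 f (univ ×ˢ W)) (hper : ∀ q, f (q + (2 * Real.pi, 0)) = f q) {u : X}
    (hu : u ∈ W) : ∃ K, ∀ᶠ v in 𝓝 u, (∀ θ, ‖f (θ, v)‖ ≤ K) ∧
      ∀ s t, ‖f (s, v) - f (t, v)‖ ≤ K * |s - t| := by
  have hWo : IsOpen ((univ : Set ℝ) ×ˢ W) := isOpen_univ.prod hW
  have hc : ContinuousOn (fun q => ‖f q‖ + ‖fderiv ℝ f q‖) (univ ×ˢ W) :=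
    hf.continuousOn.norm.add (hf.continuousOn_fderiv_of_isOpen hWo le_rfl).norm
  have hper' : ∀ q, fderiv ℝ f (q + (2 * Real.pi, 0)) = fderiv ℝ f q := fun q => by
    rw [← fderiv_comp_add_right]
    simp only [hper]
  have hb : ∃ K, ∀ θ ∈ Icc 0 (2 * Real.pi), ‖f (θ, u)‖ + ‖fderiv ℝ f (θ, u)‖ ≤ K := by
    have h1 := hc.comp (f := fun θ : ℝ => ((θ, u) : ℝ × X)) (s := Icc 0 (2 * Real.pi))
      (by fun_prop) fun θ _ => ⟨mem_univ _, hu⟩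
    obtain ⟨K, hK⟩ := (isCompact_Icc.image_of_continuousOn h1).bddAbove
    exact ⟨K, fun θ hθ => hK ⟨θ, hθ, rfl⟩⟩
  obtain ⟨K, hK⟩ := hb
  refine ⟨K + 1, ?_⟩
  -- The circle of angles is compact, hence the bound persists for parameters near `u`.
  have hev : ∀ᶠ v in 𝓝 u, ∀ θ ∈ Icc 0 (2 * Real.pi),
      ‖f (θ, v)‖ + ‖fderiv ℝ f (θ, v)‖ < K + 1 := by
    refine isCompact_Icc.eventually_forall_of_forall_eventually fun θ hθ => ?_
    have h1 : ContinuousAt (fun q => ‖f q‖ + ‖fderiv ℝ f q‖) (θ, u) :=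
      hc.continuousAt (hWo.mem_nhds ⟨mem_univ _, hu⟩)
    exact (h1.comp' (f := Prod.swap) (x := (u, θ)) continuous_swap.continuousAt).eventually_lt_const
      ((hK θ hθ).trans_lt (lt_add_one K))
  filter_upwards [hev, hW.mem_nhds hu] with v hv hvW
  have hv' : ∀ θ, ‖f (θ, v)‖ + ‖fderiv ℝ f (θ, v)‖ ≤ K + 1 := fun θ => by
    have hp : Function.Periodic (fun θ => ‖f (θ, v)‖ + ‖fderiv ℝ f (θ, v)‖) (2 * Real.pi) := by
      intro θ
      have h1 := hper (θ, v)
      have h2 := hper' (θ, v)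
      simp only [Prod.mk_add_mk, add_zero] at h1 h2
      simp only [h1, h2]
    obtain ⟨t, ht, e⟩ := hp.exists_mem_Ico₀ (by positivity) θ
    exact e.trans_le (hv t (Ico_subset_Icc_self ht)).le
  have hd : ∀ θ, HasDerivAt (fun θ => f (θ, v)) (fderiv ℝ f (θ, v) (1, 0)) θ := fun θ =>
    ((hf.differentiableOn one_ne_zero).differentiableAt
      (hWo.mem_nhds ⟨mem_univ _, hvW⟩)).hasFDerivAt.comp_hasDerivAt θ
      ((hasDerivAt_id θ).prodMk (hasDerivAt_const θ v))
  refine ⟨fun θ => by linarith [hv' θ, norm_nonneg (fderiv ℝ f (θ, v))], fun s t => ?_⟩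
  have := (convex_univ (𝕜 := ℝ) (E := ℝ)).norm_image_sub_le_of_norm_hasDerivWithin_le
    (f := fun θ => f (θ, v)) (C := K + 1) (x := t) (y := s)
    (fun θ _ => (hd θ).hasDerivWithinAt) (fun θ _ => ?_) (mem_univ _) (mem_univ _)
  · simpa using this
  · refine ((fderiv ℝ f (θ, v)).le_opNorm _).trans ?_
    rw [Prod.norm_mk, norm_one, norm_zero, max_eq_left zero_le_one, mul_one]
    linarith [hv' θ, norm_nonneg (f (θ, v))]

/-! ### Matrix-valued functions -/

section Matrices

-- The choice of the norm plays no role; it induces the product topology of the statement.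
attribute [local instance] Matrix.linftyOpNormedRing Matrix.linftyOpNormedAlgebra

variable {N : ℕ}

theorem contDiffOn_matrix {X : Type*} [NormedAddCommGroup X] [NormedSpace ℝ X]
    {f : X → Matrix (Fin N) (Fin N) ℂ} {s : Set X}
    (hf : ∀ i j, ContDiffOn ℝ 1 (fun x => f x i j) s) : ContDiffOn ℝ 1 f s := by
  have h : f = fun x => ∑ i, ∑ j, f x i j • Matrix.single i j (1 : ℂ) := by
    funext x
    conv_lhs => rw [Matrix.matrix_eq_sum_single (f x)]
    simp [Matrix.smul_single]
  rw [h]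
  exact ContDiffOn.sum fun i _ => ContDiffOn.sum fun j _ => (hf i j).smul contDiffOn_const

theorem hasDerivAt_matrix {f : ℂ → Matrix (Fin N) (Fin N) ℂ} {f' : Matrix (Fin N) (Fin N) ℂ} {x : ℂ}
    (h : ∀ i j, HasDerivAt (fun z => f z i j) (f' i j) x) : HasDerivAt f f' x :=
  hasDerivAt_pi.2 fun i => hasDerivAt_pi.2 (h i)

/-- The evaluation of a matrix entry. -/
def entryCLM (i j : Fin N) : Matrix (Fin N) (Fin N) ℂ →L[ℂ] ℂ :=
  LinearMap.toContinuousLinearMap (Matrix.entryLinearMap ℂ ℂ i j)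

theorem circleMean_apply {F : Circle → Matrix (Fin N) (Fin N) ℂ} (hF : Continuous F) (i j : Fin N) :
    circleMean F i j = circleMean fun ξ => F ξ i j := by
  have h1 := (entryCLM i j).intervalIntegral_comp_comm (a := 0) (b := 2 * Real.pi)
    (intervalIntegrable_comp_exp hF 0 (2 * Real.pi))
  exact (((entryCLM i j).restrictScalars ℝ).map_smul _ _).trans (congrArg _ h1.symm)

theorem contourIntegral_eq (f : Circle → ℂ) :
    (2 * Real.pi * Complex.I : ℂ)⁻¹ * contourIntegral f = circleMean fun ξ => (ξ : ℂ) * f ξ := by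
  have h1 : contourIntegral f
      = Complex.I * ∫ θ in (0 : ℝ)..2 * Real.pi, (Circle.exp θ : ℂ) * f (Circle.exp θ) := by
    rw [contourIntegral, ← intervalIntegral.integral_const_mul]
    congr 1
    funext θ
    ring
  rw [h1, circleMean, Complex.real_smul]
  push_cast
  have : (Real.pi : ℂ) ≠ 0 := by exact_mod_cast Real.pi_ne_zero
  field_simp

theorem cauchyIntegral_infty (F : Circle → Matrix (Fin N) (Fin N) ℂ) : cauchyIntegral F ∞ = 0 := rfl

theorem cauchyIntegral_coe {F : Circle → Matrix (Fin N) (Fin N) ℂ} (hF : Continuous F) {x : ℂ}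
    (hx : ‖x‖ ≠ 1) : cauchyIntegral F x = cauchyT F x := by
  ext i j
  rw [cauchyT, circleMean_apply (continuous_cauchyT_integrand hF hx)]
  change (2 * Real.pi * Complex.I : ℂ)⁻¹ * contourIntegral (fun ξ => F ξ i j / ((ξ : ℂ) - x)) = _
  rw [contourIntegral_eq]
  congr 1
  funext ξ
  rw [Matrix.smul_apply, smul_eq_mul]
  ring

theorem continuous_zpow_smul {E : Type*} [NormedAddCommGroup E] [NormedSpace ℂ E] {F : Circle → E}
    (hF : Continuous F) (k : ℤ) : Continuous fun ξ : Circle => (ξ : ℂ) ^ k • F ξ :=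
  (continuous_circle_coe.zpow₀ _ fun ξ => Or.inl (Circle.coe_ne_zero ξ)).smul hF

theorem coeffB_eq {A : Circle → CircleDiff → Matrix (Fin N) (Fin N) ℂ} {γ : CircleDiff}
    (hA : Continuous fun ξ => A ξ γ) (k : ℤ) :
    coeffB A k γ = -circleMean fun ξ : Circle => (ξ : ℂ) ^ (k + 1) • A ξ γ := by
  ext i j
  rw [Matrix.neg_apply, circleMean_apply (continuous_zpow_smul hA (k + 1))]
  change -((2 * Real.pi * Complex.I : ℂ)⁻¹ * contourIntegral fun ξ => (ξ : ℂ) ^ k * A ξ γ i j) = _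
  rw [contourIntegral_eq]
  congr 2
  funext ξ
  rw [Matrix.smul_apply, smul_eq_mul, zpow_add_one₀ (Circle.coe_ne_zero ξ)]
  ring

/-! ### Fundamental solutions in the two charts of the Riemann sphere -/

theorem coe_mem_offCircle {x : ℂ} : (x : OnePoint ℂ) ∈ offCircle ↔ ‖x‖ ≠ 1 := by
  simp [offCircle]

theorem infty_mem_offCircle : (∞ : OnePoint ℂ) ∈ offCircle := by simp [offCircle]

theorem nearInfty_zero : nearInfty 0 = ∞ := if_pos rfl

theorem nearInfty_of_ne_zero {w : ℂ} (hw : w ≠ 0) : nearInfty w = (w⁻¹ : ℂ) := if_neg hw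

theorem one_lt_norm_inv {w : ℂ} (hw : w ∈ Metric.ball (0 : ℂ) 1) (hw0 : w ≠ 0) : 1 < ‖w⁻¹‖ := by
  rw [norm_inv]
  exact (one_lt_inv₀ (norm_pos_iff.2 hw0)).2 (by simpa using hw)

theorem nearInfty_mem_offCircle {w : ℂ} (hw : w ∈ Metric.ball (0 : ℂ) 1) :
    nearInfty w ∈ offCircle := by
  rcases eq_or_ne w 0 with rfl | hw0
  · rw [nearInfty_zero]
    exact infty_mem_offCircle
  · rw [nearInfty_of_ne_zero hw0, coe_mem_offCircle]
    exact (one_lt_norm_inv hw hw0).ne'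

theorem ball_mem_offCircle {x : ℂ} (hx : x ∈ Metric.ball (0 : ℂ) 1) : (x : OnePoint ℂ) ∈ offCircle :=
  coe_mem_offCircle.2 (by simpa using hx : ‖x‖ < 1).ne

/-- A differentiable function whose derivative is given, except at one point, by a function
continuous at this point has the derivative given by this function. -/
theorem hasDerivAt_of_analyticAt {f g : ℂ → ℂ} {s : Set ℂ} {x : ℂ} (hs : s ∈ 𝓝 x)
    (hf : AnalyticAt ℂ f x) (hg : ContinuousAt g x)
    (h : ∀ w ∈ s, w ≠ x → HasDerivAt f (g w) w) : HasDerivAt f (g x) x := by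
  have h1 : Tendsto (deriv f) (𝓝[≠] x) (𝓝 (g x)) := by
    refine (hg.tendsto.mono_left nhdsWithin_le_nhds).congr' ?_
    filter_upwards [self_mem_nhdsWithin, mem_nhdsWithin_of_mem_nhds hs] with w hw hws
    exact (h w hws hw).deriv.symm
  have h2 : Tendsto (deriv f) (𝓝[≠] x) (𝓝 (deriv f x)) :=
    hf.deriv.continuousAt.tendsto.mono_left nhdsWithin_le_nhds
  rw [← tendsto_nhds_unique h2 h1]
  exact hf.differentiableAt.hasDerivAt

variable {U : Set CircleDiff} {A : Circle → CircleDiff → Matrix (Fin N) (Fin N) ℂ}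
  {Y : OnePoint ℂ → CircleDiff → Matrix (Fin N) (Fin N) ℂ}

theorem circleMean_coe_smul_eq_zero {F : Circle → Matrix (Fin N) (Fin N) ℂ} (hF : Continuous F)
    (h : ∀ i j, contourIntegral (fun ξ => F ξ i j) = 0) :
    circleMean (fun ξ : Circle => (ξ : ℂ) • F ξ) = 0 := by
  have hc : Continuous fun ξ : Circle => (ξ : ℂ) • F ξ := continuous_circle_coe.smul hF
  ext i j
  rw [circleMean_apply hc]
  have := contourIntegral_eq fun ξ => F ξ i j
  rw [h i j, mul_zero] at this
  simpa using this.symm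

theorem IsFundamentalSolution.diskSolution (hY : IsFundamentalSolution U A Y) {γ : CircleDiff}
    (hγ : γ ∈ U) (hA : Continuous fun ξ => A ξ γ) :
    DiskSolution (fun ξ => A ξ γ) (fun x : ℂ => Y x γ) where
  isUnit x hx := hY.isUnit x (ball_mem_offCircle hx) γ hγ
  ode x hx := by
    have hx' : ‖x‖ ≠ 1 := (by simpa using hx : ‖x‖ < 1).ne
    rw [← cauchyIntegral_coe hA hx']
    exact hasDerivAt_matrix (hY.ode x hx' γ hγ)

theorem IsFundamentalSolution.diskSolution_nearInfty (hY : IsFundamentalSolution U A Y)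
    {γ : CircleDiff} (hγ : γ ∈ U) {L : ℝ} (hA : BoundedLipschitz (fun ξ => A ξ γ) L)
    (hA0 : circleMean (fun ξ : Circle => (ξ : ℂ) • A ξ γ) = 0) :
    DiskSolution (flip fun ξ => A ξ γ) (fun w : ℂ => Y (nearInfty w) γ) where
  isUnit w hw := hY.isUnit _ (nearInfty_mem_offCircle hw) γ hγ
  ode := by
    have h1 : ∀ w ∈ Metric.ball (0 : ℂ) 1, w ≠ 0 → HasDerivAt (fun w : ℂ => Y (nearInfty w) γ)
        (cauchyT (flip fun ξ => A ξ γ) w * Y (nearInfty w) γ) w := by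
      intro w hw hw0
      have hwi := one_lt_norm_inv hw hw0
      have h2 : HasDerivAt (fun x : ℂ => Y x γ) (cauchyT (fun ξ => A ξ γ) w⁻¹ * Y (w⁻¹ : ℂ) γ) w⁻¹ := by
        rw [← cauchyIntegral_coe hA.continuous hwi.ne']
        exact hasDerivAt_matrix (hY.ode w⁻¹ hwi.ne' γ hγ)
      have h3 := HasDerivAt.scomp (g₁ := fun x : ℂ => Y x γ) w h2 (hasDerivAt_inv hw0)
      have h4 : HasDerivAt (fun w : ℂ => Y (nearInfty w) γ)
          (-(w ^ 2)⁻¹ • (cauchyT (fun ξ => A ξ γ) w⁻¹ * Y (w⁻¹ : ℂ) γ)) w := by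
        refine h3.congr_of_eventuallyEq ?_
        filter_upwards [isOpen_ne.mem_nhds hw0] with v hv
        rw [nearInfty_of_ne_zero hv]
        rfl
      refine h4.congr_deriv ?_
      have h5 := cauchyT_flip hA.continuous hA0 (by simpa using hw) hw0
      rw [nearInfty_of_ne_zero hw0, ← smul_mul_assoc, neg_smul, ← smul_neg, ← h5, smul_smul,
        inv_mul_cancel₀ (pow_ne_zero 2 hw0), one_smul]
    intro w hw
    -- At `w = 0`, analyticity of `Y` at infinity allows to pass to the limit in the equation.
    rcases eq_or_ne w 0 with rfl | hw0
    · have hb := Metric.ball_mem_nhds (0 : ℂ) one_pos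
      refine hasDerivAt_matrix fun i j => ?_
      refine hasDerivAt_of_analyticAt
        (g := fun w => (cauchyT (flip fun ξ => A ξ γ) w * Y (nearInfty w) γ) i j) hb
        (hY.analytic_infty γ hγ i j) ?_ fun w hw hw0 => ?_
      · have c1 : ContinuousAt (fun w => cauchyT (flip fun ξ => A ξ γ) w) 0 :=
          continuousAt_cauchyT hA.flip.continuous (by simp)
        have c2 : ContinuousAt (fun w => Y (nearInfty w) γ) 0 :=
          continuousAt_pi.2 fun i => continuousAt_pi.2 fun j =>
            (hY.analytic_infty γ hγ i j).continuousAt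
        exact (entryCLM i j).continuous.continuousAt.comp (c1.mul c2)
      · exact (entryCLM i j).hasFDerivAt.comp_hasDerivAt w (h1 w hw hw0)
    · exact h1 w hw hw0

/-! ### Uniform families near a given displacement -/

theorem eventually_boundedLipschitz (hU : IsOpen U)
    (hA : ∀ i j, JointC1On (fun ξ γ => A ξ γ i j) U) {u : Vect2} (hu : u ∈ lifts U) :
    ∃ L, ∀ᶠ v in 𝓝 u, BoundedLipschitz (fun ξ => A ξ (ofLift v)) L := by
  obtain ⟨K, hK⟩ := exists_eventually_bound (isOpen_lifts hU)
    (f := fun q : ℝ × Vect2 => A (Circle.exp q.1) (ofLift q.2)) (contDiffOn_matrix hA)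
    (fun q => by simp only [Prod.fst_add, Prod.snd_add, add_zero, Circle.periodic_exp q.1]) hu
  refine ⟨2 * K, hK.mono fun v hv => boundedLipschitz_of_exp (fun ξ => ?_) hv.2⟩
  obtain ⟨θ, rfl⟩ := Circle.exp_surjective ξ
  exact hv.1 θ

theorem exists_boundedLipschitz (hU : IsOpen U)
    (hA : ∀ i j, JointC1On (fun ξ γ => A ξ γ i j) U) {γ : CircleDiff} (hγ : γ ∈ U) :
    ∃ L, BoundedLipschitz (fun ξ => A ξ γ) L := by
  obtain ⟨L, hL⟩ := eventually_boundedLipschitz hU hA (lift_mem_lifts hγ)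
  have := hL.self_of_nhds
  rw [ofLift_lift] at this
  exact ⟨L, this⟩

theorem IsFundamentalSolution.contDiffOn (hY : IsFundamentalSolution U A Y) {x : OnePoint ℂ}
    (hx : x ∈ offCircle) : ContDiffOn ℝ 1 (fun u => Y x (ofLift u)) (lifts U) :=
  contDiffOn_matrix (hY.c1 x hx)

/-- Near each displacement, the systems and their fundamental solutions form a family with uniform
bounds. -/
theorem exists_family (hU : IsOpen U) (hA : ∀ i j, JointC1On (fun ξ γ => A ξ γ i j) U)
    (hA0 : ∀ γ ∈ U, ∀ i j, contourIntegral (fun ξ => A ξ γ i j) = 0)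
    (hY : IsFundamentalSolution U A Y) (hYinf : ∀ γ ∈ U, Y ∞ γ = 1) {u : Vect2}
    (hu : u ∈ lifts U) : ∃ V L c, u ∈ V ∧ V ⊆ lifts U ∧
      Family V (fun u ξ => A ξ (ofLift u)) (fun u x => Y x (ofLift u))
        (fun u w => Y (nearInfty w) (ofLift u)) L c := by
  obtain ⟨L, hL⟩ := eventually_boundedLipschitz hU hA hu
  obtain ⟨c, hc0, hc⟩ := hu.1.exists_lower_bound
  have hUo := isOpen_lifts hU
  have h0 : ((0 : ℂ) : OnePoint ℂ) ∈ offCircle := coe_mem_offCircle.2 (by simp)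
  have c0 : ContinuousAt (fun u => Y (0 : ℂ) (ofLift u)) u :=
    (hY.contDiffOn h0).continuousOn.continuousAt (hUo.mem_nhds hu)
  have c1 : ContinuousAt (fun u => Ring.inverse (Y (0 : ℂ) (ofLift u))) u := by
    obtain ⟨a, ha⟩ := hY.isUnit _ h0 _ hu.2
    have h1 := NormedRing.inverse_continuousAt a
    rw [ha] at h1
    exact ContinuousAt.comp (g := Ring.inverse) (f := fun u => Y (0 : ℂ) (ofLift u)) h1 c0
  have hev : ∀ᶠ v in 𝓝 u, v ∈ lifts U ∧ ‖v - u‖ ≤ c / 2 ∧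
      BoundedLipschitz (fun ξ => A ξ (ofLift v)) L ∧
      ‖Y (0 : ℂ) (ofLift v)‖ ≤ ‖Y (0 : ℂ) (ofLift u)‖ + 1 ∧
      ‖Ring.inverse (Y (0 : ℂ) (ofLift v))‖ ≤ ‖Ring.inverse (Y (0 : ℂ) (ofLift u))‖ + 1 := by
    filter_upwards [hUo.mem_nhds hu, Metric.closedBall_mem_nhds u (half_pos hc0), hL,
      c0.norm.eventually_le_const (lt_add_one _), c1.norm.eventually_le_const (lt_add_one _)]
      with v h1 h2 h3 h4 h5
    exact ⟨h1, mem_closedBall_iff_norm.1 h2, h3, h4, h5⟩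
  obtain ⟨ε, hε, hV⟩ := Metric.eventually_nhds_iff_ball.1 hev
  set L' := max L (max (‖Y (0 : ℂ) (ofLift u)‖ + 1)
    (max (‖Ring.inverse (Y (0 : ℂ) (ofLift u))‖ + 1) ‖(1 : Matrix (Fin N) (Fin N) ℂ)‖)) with hL'
  have l1 : L ≤ L' := le_max_left _ _
  have l2 : ‖Y (0 : ℂ) (ofLift u)‖ + 1 ≤ L' := (le_max_left _ _).trans (le_max_right _ _)
  have l3 : ‖Ring.inverse (Y (0 : ℂ) (ofLift u))‖ + 1 ≤ L' :=
    (le_max_left _ _).trans ((le_max_right _ _).trans (le_max_right _ _))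
  have l4 : ‖(1 : Matrix (Fin N) (Fin N) ℂ)‖ ≤ L' :=
    (le_max_right _ _).trans ((le_max_right _ _).trans (le_max_right _ _))
  have hmean : ∀ v ∈ Metric.ball u ε,
      circleMean (fun ξ : Circle => (ξ : ℂ) • A ξ (ofLift v)) = 0 := fun v hv =>
    circleMean_coe_smul_eq_zero (hV v hv).2.2.1.continuous (hA0 _ (hV v hv).1.2)
  exact ⟨Metric.ball u ε, L', c / 2, Metric.mem_ball_self hε, fun v hv => (hV v hv).1, {
    isOpen := Metric.isOpen_ball
    convex := convex_ball _ _
    pos := half_pos hc0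
    lower := fun v hv => Vect2.lower_bound_of_norm_sub_le hc (hV v hv).2.1
    bl := fun v hv => (hV v hv).2.2.1.mono l1
    mean := hmean
    contF := (contDiffOn_matrix hA).continuousOn.mono
      (prod_mono_right fun v hv => (hV v hv).1)
    sol := fun v hv => hY.diskSolution (hV v hv).1.2 (hV v hv).2.2.1.continuous
    sol' := fun v hv => hY.diskSolution_nearInfty (hV v hv).1.2 (hV v hv).2.2.1 (hmean v hv)
    diff := fun x hx => (hY.contDiffOn (ball_mem_offCircle hx)).mono fun v hv => (hV v hv).1
    diff' := fun w hw => (hY.contDiffOn (nearInfty_mem_offCircle hw)).mono fun v hv => (hV v hv).1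
    bound := fun v hv => (hV v hv).2.2.2.1.trans l2
    bound_inv := fun v hv => (hV v hv).2.2.2.2.trans l3
    infty := fun v hv => by
      rw [nearInfty_zero]
      exact hYinf _ (hV v hv).1.2
    bound_one := l4 }⟩

/-! ### The Lie derivatives along the complex vector fields -/

/-- Two displacements of the same diffeomorphism differ by a multiple of `2π`. -/
theorem exists_lift_eq {u : Vect2} (hu : u.Admissible) :
    ∃ n : ℤ, (ofLift u).lift = u + Vect2.const (n * (2 * Real.pi)) := by
  set v := (ofLift u).lift with hv
  have h1 : ∀ θ, Circle.exp (v.disp θ - u.disp θ) = 1 := fun θ => by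
    have h2 := ofLift_exp hu θ
    rw [← ofLift_lift (ofLift u), ofLift_exp (lift_admissible _)] at h2
    rw [show v.disp θ - u.disp θ = (θ + v.disp θ) - (θ + u.disp θ) by ring, Circle.exp_sub, h2,
      div_self']
  obtain ⟨n, hn⟩ := exists_int_abs_sub_le (w := fun θ => v.disp θ - u.disp θ)
    (v.continuous_disp.sub u.continuous_disp) zero_lt_one fun θ => by simp [h1 θ]
  refine ⟨n, ext_disp fun θ => ?_⟩
  have h3 := hn θ
  rw [mul_zero, abs_nonpos_iff] at h3
  rw [Vect2.disp_add, Vect2.disp_const]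
  linarith

/-- The Lie derivative can be computed with any displacement of the diffeomorphism. -/
theorem lieDeriv_ofLift {u : Vect2} (hu : u.Admissible) (m : ℤ) (Φ : CircleDiff → ℂ) :
    lieDeriv m Φ (ofLift u) = fderiv ℝ (fun u => Φ (ofLift u)) u (virasoroRe m (ofLift u)) +
      Complex.I * fderiv ℝ (fun u => Φ (ofLift u)) u (virasoroIm m (ofLift u)) := by
  obtain ⟨n, hn⟩ := exists_lift_eq hu
  have h1 : fderiv ℝ (fun u => Φ (ofLift u)) (ofLift u).lift
      = fderiv ℝ (fun u => Φ (ofLift u)) u := by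
    rw [hn, ← fderiv_comp_add_right]
    refine Filter.EventuallyEq.fderiv_eq ?_
    filter_upwards [(isOpen_lifts isOpen_univ).mem_nhds (⟨hu, mem_univ _⟩ : u ∈ lifts univ)]
      with v hv
    rw [ofLift_add_const hv.1]
  rw [lieDeriv, h1]

theorem omega_eq (hU : IsOpen U) (hY : IsFundamentalSolution U A Y) {u : Vect2} (hu : u ∈ lifts U)
    {x : OnePoint ℂ} (hx : x ∈ offCircle) (m : ℤ) : Omega Y m x (ofLift u) =
      (fderiv ℝ (fun u => Y x (ofLift u)) u (virasoroRe m (ofLift u)) +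
        Complex.I • fderiv ℝ (fun u => Y x (ofLift u)) u (virasoroIm m (ofLift u))) *
          (Y x (ofLift u))⁻¹ := by
  have h1 : ∀ i j, fderiv ℝ (fun u => Y x (ofLift u) i j) u
      = ((entryCLM i j).restrictScalars ℝ).comp (fderiv ℝ (fun u => Y x (ofLift u)) u) := fun i j =>
    (((entryCLM i j).restrictScalars ℝ).hasFDerivAt.comp u
      (((hY.contDiffOn hx).differentiableOn one_ne_zero).differentiableAt
        ((isOpen_lifts hU).mem_nhds hu)).hasFDerivAt).fderiv
  rw [Omega]
  congr 1
  ext i j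
  rw [Matrix.of_apply, lieDeriv_ofLift hu.1, h1]
  rfl

/-- The equations for the Lie derivatives along all the complex vector fields `L_m` are equivalent to
equations for the derivatives in all real directions: both sides are linear and continuous in the
direction, and the real and imaginary parts of the `L_m` span a dense subspace. -/
theorem forall_omega_eq_iff (hU : IsOpen U) (hA : ∀ i j, JointC1On (fun ξ γ => A ξ γ i j) U)
    (hY : IsFundamentalSolution U A Y) {u : Vect2} (hu : u ∈ lifts U) {x : ℂ} (hx : ‖x‖ ≠ 1) :
    (∀ m : ℤ, Omega Y m x (ofLift u)
      = -cauchyIntegral (fun ξ => (ξ : ℂ) ^ (m + 1) • A ξ (ofLift u)) x) ↔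
    ∀ h, fderiv ℝ (fun u => Y x (ofLift u)) u h
      = -cauchyT (fun ξ => vel u h ξ • A ξ (ofLift u)) x * Y x (ofLift u) := by
  obtain ⟨L, hL⟩ := exists_boundedLipschitz hU hA hu.2
  have hAc := hL.continuous
  have hvc : ∀ h, Continuous fun ξ => vel u h ξ • A ξ (ofLift u) := fun h =>
    (continuous_vel hu.1 h).smul hAc
  have hYu : IsUnit (Y x (ofLift u)) := hY.isUnit _ (coe_mem_offCircle.2 hx) _ hu.2
  obtain ⟨K, hK0, hK⟩ := exists_norm_le (continuous_cauchyKernel hx)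
  -- The right-hand side is the continuous real-linear map `-C`.
  obtain ⟨C, hC⟩ : ∃ C : Vect2 →L[ℝ] Matrix (Fin N) (Fin N) ℂ, ∀ h, C h
      = cauchyT (fun ξ => vel u h ξ • A ξ (ofLift u)) x * Y x (ofLift u) := by
    refine ⟨LinearMap.mkContinuous
      { toFun := fun h => cauchyT (fun ξ => vel u h ξ • A ξ (ofLift u)) x * Y x (ofLift u)
        map_add' := fun h k => ?_
        map_smul' := fun c h => ?_ } (K * L * ‖Y x (ofLift u)‖) fun h => ?_, fun h => rfl⟩
    · rw [← add_mul, ← cauchyT_add (hvc h) (hvc k) hx]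
      simp only [vel_add, add_smul]
    · simp only [vel_smul, mul_smul, RingHom.id_apply]
      rw [cauchyT_smul, Complex.coe_smul, smul_mul_assoc]
    · refine (norm_mul_le _ _).trans ?_
      have h1 : ‖cauchyT (fun ξ => vel u h ξ • A ξ (ofLift u)) x‖ ≤ K * (‖h‖ * L) := by
        refine norm_circleMean_le fun ξ => ?_
        rw [norm_smul, norm_smul]
        exact mul_le_mul (hK ξ) (mul_le_mul (norm_vel_le u h ξ) (hL.bound ξ) (norm_nonneg _)
          (norm_nonneg _)) (by positivity) hK0
      calc _ ≤ K * (‖h‖ * L) * ‖Y x (ofLift u)‖ := by gcongr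
        _ = K * L * ‖Y x (ofLift u)‖ * ‖h‖ := by ring
  set D := fderiv ℝ (fun u => Y x (ofLift u)) u
  have hm : ∀ m : ℤ, (Omega Y m x (ofLift u)
      = -cauchyIntegral (fun ξ => (ξ : ℂ) ^ (m + 1) • A ξ (ofLift u)) x) ↔
      (D + C) (virasoroRe m (ofLift u)) + Complex.I • (D + C) (virasoroIm m (ofLift u)) = 0 := by
    intro m
    have hc2 : Continuous fun ξ => Complex.I • vel u (virasoroIm m (ofLift u)) ξ • A ξ (ofLift u) :=
      (hvc (virasoroIm m (ofLift u))).const_smul Complex.I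
    have e1 : cauchyIntegral (fun ξ => (ξ : ℂ) ^ (m + 1) • A ξ (ofLift u)) x * Y x (ofLift u)
        = C (virasoroRe m (ofLift u)) + Complex.I • C (virasoroIm m (ofLift u)) := by
      rw [cauchyIntegral_coe (continuous_zpow_smul hAc _) hx, hC, hC, ← smul_mul_assoc, ← add_mul,
        ← cauchyT_smul, ← cauchyT_add (hvc _) hc2 hx]
      simp only [smul_smul, ← add_smul, vel_virasoro hu.1]
    have hdet := (Matrix.isUnit_iff_isUnit_det _).1 hYu
    have e2 : (D + C) (virasoroRe m (ofLift u)) + Complex.I • (D + C) (virasoroIm m (ofLift u))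
        = (D (virasoroRe m (ofLift u)) + Complex.I • D (virasoroIm m (ofLift u))) +
          cauchyIntegral (fun ξ => (ξ : ℂ) ^ (m + 1) • A ξ (ofLift u)) x * Y x (ofLift u) := by
      rw [e1, add_apply, add_apply, smul_add]
      abel
    rw [omega_eq hU hY hu (coe_mem_offCircle.2 hx), e2]
    constructor
    · intro h
      rw [← Matrix.nonsing_inv_mul_cancel_right _ (D _ + _) hdet, h, neg_mul, neg_add_cancel]
    · intro h
      rw [eq_neg_of_add_eq_zero_left h, neg_mul, Matrix.mul_nonsing_inv_cancel_right _ _ hdet]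
  simp only [hm]
  constructor
  · intro h0
    have h1 : ∀ m, (D + C) (virasoroIm m (ofLift u)) = 0 ∧ (D + C) (virasoroRe m (ofLift u)) = 0 := by
      intro m
      -- The real part of `L_m` is odd in `m` and the imaginary part is even.
      have a1 := h0 m
      have a2 := h0 (-m)
      rw [virasoroRe_neg hu.1, virasoroIm_neg hu.1, map_smul, neg_one_smul] at a2
      have a3 : (2 * Complex.I) • (D + C) (virasoroIm m (ofLift u)) = 0 := by
        have a5 := congrArg₂ (· + ·) a1 a2
        simp only [add_zero] at a5
        rw [two_mul, add_smul, ← a5]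
        abel
      have a4 := (smul_eq_zero.1 a3).resolve_left (by simp)
      rw [a4, smul_zero, add_zero] at a1
      exact ⟨a4, a1⟩
    have h2 := eq_top_of_virasoro_mem hu.1 (S := LinearMap.ker (D + C).toLinearMap)
      (D + C).isClosed_ker (fun m => (h1 m).2) fun m => (h1 m).1
    intro h
    have h3 : h ∈ LinearMap.ker (D + C).toLinearMap := h2 ▸ Submodule.mem_top
    have h4 : D h + C h = 0 := h3
    rw [neg_mul, ← hC]
    exact eq_neg_of_add_eq_zero_left h4
  · intro h0 m
    have h1 : ∀ h, (D + C) h = 0 := fun h => by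
      rw [add_apply, h0, hC, neg_mul, neg_add_cancel]
    rw [h1, h1, smul_zero, add_zero]

/-- At infinity both sides vanish, as the solution is normalized there. -/
theorem omega_infty (hU : IsOpen U) (hY : IsFundamentalSolution U A Y) (hYinf : ∀ γ ∈ U, Y ∞ γ = 1)
    {γ : CircleDiff} (hγ : γ ∈ U) (m : ℤ) : Omega Y m ∞ γ = 0 := by
  have h1 : fderiv ℝ (fun u => Y ∞ (ofLift u)) γ.lift = 0 := by
    have h2 : (fun u => Y ∞ (ofLift u)) =ᶠ[𝓝 γ.lift] fun _ => 1 := by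
      filter_upwards [(isOpen_lifts hU).mem_nhds (lift_mem_lifts hγ)] with v hv
      exact hYinf _ hv.2
    rw [h2.fderiv_eq, fderiv_const_apply]
  have h3 := omega_eq hU hY (lift_mem_lifts hγ) infty_mem_offCircle m
  rw [ofLift_lift, h1] at h3
  simpa using h3

/-! ### Invariant monodromy on the Riemann sphere -/

/-- The monodromy along the circle of the fundamental solution `Y(·, γ)`. -/
def sphereMonodromy (Y : OnePoint ℂ → CircleDiff → Matrix (Fin N) (Fin N) ℂ) (γ : CircleDiff)
    (ξ : Circle) : Matrix (Fin N) (Fin N) ℂ :=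
  monodromy (fun x : ℂ => Y x γ) (fun w => Y (nearInfty w) γ) ξ

theorem tendsto_mul_circle (p : Circle) :
    Tendsto (fun r : ℝ => (r : ℂ) * p) (𝓝[<] 1) (𝓝[Metric.ball 0 1] (p : ℂ)) := by
  refine tendsto_nhdsWithin_iff.2 ⟨?_, eventually_mem_Ioo_one.mono fun r hr =>
    mul_circle_mem_ball hr p⟩
  have : ContinuousAt (fun r : ℝ => (r : ℂ) * p) 1 := by fun_prop
  simpa using this.tendsto.mono_left (nhdsWithin_le_nhds (s := Iio 1))

theorem neBot_nhdsWithin_ball (p : Circle) : (𝓝[Metric.ball (0 : ℂ) 1] (p : ℂ)).NeBot :=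
  (tendsto_mul_circle p).neBot

theorem tendsto_inv_nhdsWithin (p : Circle) :
    Tendsto (fun x : ℂ => x⁻¹) (𝓝[{x : ℂ | 1 < ‖x‖}] (p : ℂ))
      (𝓝[Metric.ball 0 1] ((p⁻¹ : Circle) : ℂ)) := by
  refine tendsto_nhdsWithin_iff.2 ⟨?_, ?_⟩
  · rw [Circle.coe_inv]
    exact (tendsto_inv₀ (Circle.coe_ne_zero p)).mono_left nhdsWithin_le_nhds
  · filter_upwards [self_mem_nhdsWithin] with x hx
    rw [mem_ball_zero_iff, norm_inv]
    exact inv_lt_one_of_one_lt₀ hx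

theorem neBot_nhdsWithin_one_lt (p : Circle) : (𝓝[{x : ℂ | 1 < ‖x‖}] (p : ℂ)).NeBot := by
  have h : Tendsto (fun r : ℝ => (p : ℂ) / r) (𝓝[<] 1) (𝓝[{x : ℂ | 1 < ‖x‖}] (p : ℂ)) := by
    refine tendsto_nhdsWithin_iff.2 ⟨?_, eventually_mem_Ioo_one.mono fun r hr => ?_⟩
    · have : ContinuousAt (fun r : ℝ => (p : ℂ) / r) 1 :=
        continuousAt_const.div Complex.continuous_ofReal.continuousAt (by simp)
      simpa using this.tendsto.mono_left (nhdsWithin_le_nhds (s := Iio 1))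
    · change 1 < ‖(p : ℂ) / r‖
      rw [norm_div_circle hr.1.le]
      exact (one_lt_inv₀ hr.1).2 hr.2
  exact h.neBot

/-- The limits at the circle of a fundamental solution always exist and are invertible. -/
theorem isMonodromyAt_iff (hU : IsOpen U) (hA : ∀ i j, JointC1On (fun ξ γ => A ξ γ i j) U)
    (hA0 : ∀ γ ∈ U, ∀ i j, contourIntegral (fun ξ => A ξ γ i j) = 0)
    (hY : IsFundamentalSolution U A Y) {γ : CircleDiff} (hγ : γ ∈ U) (ξ : Circle)
    (M : Matrix (Fin N) (Fin N) ℂ) :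
    IsMonodromyAt (fun x => Y x γ) ξ M ↔ M = sphereMonodromy Y γ ξ := by
  obtain ⟨L, hL⟩ := exists_boundedLipschitz hU hA hγ
  have hy := hY.diskSolution hγ hL.continuous
  have hz := hY.diskSolution_nearInfty hγ hL
    (circleMean_coe_smul_eq_zero hL.continuous (hA0 γ hγ))
  have hball : {x : ℂ | ‖x‖ < 1} = Metric.ball 0 1 := by ext x; simp
  have t1 : Tendsto (fun x : ℂ => Y x γ) (𝓝[{x : ℂ | ‖x‖ < 1}] (ξ : ℂ))
      (𝓝 (diskExt (fun x : ℂ => Y x γ) ξ)) := by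
    rw [hball]
    exact tendsto_diskExt (hy.lipschitz hL) (mem_closedBall_circle ξ)
  have t2 : Tendsto (fun x : ℂ => Y x γ) (𝓝[{x : ℂ | 1 < ‖x‖}] (ξ : ℂ))
      (𝓝 (diskExt (fun w => Y (nearInfty w) γ) (ξ⁻¹ : Circle))) := by
    refine ((tendsto_diskExt (hz.lipschitz hL.flip) (mem_closedBall_circle ξ⁻¹)).comp
      (tendsto_inv_nhdsWithin ξ)).congr' ?_
    filter_upwards [self_mem_nhdsWithin] with x hx
    have hx0 : x ≠ 0 := norm_pos_iff.1 (zero_lt_one.trans hx)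
    rw [Function.comp_apply, nearInfty_of_ne_zero (inv_ne_zero hx0), inv_inv]
  have hb1 : (𝓝[{x : ℂ | ‖x‖ < 1}] (ξ : ℂ)).NeBot := hball ▸ neBot_nhdsWithin_ball ξ
  have hb2 := neBot_nhdsWithin_one_lt ξ
  rw [sphereMonodromy, monodromy, ← Matrix.nonsing_inv_eq_ringInverse]
  constructor
  · rintro ⟨yp, ym, -, -, h1, h2, rfl⟩
    rw [tendsto_nhds_unique h1 t1, tendsto_nhds_unique h2 t2]
  · rintro rfl
    exact ⟨_, _, hy.isUnit_diskExt hL ξ, hz.isUnit_diskExt hL.flip ξ⁻¹, t1, t2, rfl⟩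

/-- `M`-invariance means that the monodromy is transported by the diffeomorphisms. -/
theorem mInvariant_iff (hU : IsOpen U) (hUe : (1 : CircleDiff) ∈ U)
    (hA : ∀ i j, JointC1On (fun ξ γ => A ξ γ i j) U)
    (hA0 : ∀ γ ∈ U, ∀ i j, contourIntegral (fun ξ => A ξ γ i j) = 0)
    (hY : IsFundamentalSolution U A Y) : MInvariant U Y ↔
      ∀ γ ∈ U, ∀ δ ∈ U, ∀ η, sphereMonodromy Y γ (γ.toEquiv η) = sphereMonodromy Y δ (δ.toEquiv η) := by
  have hm := fun ξ γ hγ => isMonodromyAt_iff hU hA hA0 hY (γ := γ) hγ ξ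
  constructor
  · rintro ⟨G, hG, hG'⟩
    have h1 : ∀ γ ∈ U, ∀ η, sphereMonodromy Y γ (γ.toEquiv η) = G η 1 := fun γ hγ η => by
      rw [← (hm _ γ hγ _).1 (hG _ γ hγ), hG' _ γ hγ, Equiv.symm_apply_apply]
    intro γ hγ δ hδ η
    rw [h1 γ hγ, h1 δ hδ]
  · intro h
    refine ⟨fun ξ γ => sphereMonodromy Y γ ξ, fun ξ γ hγ => (hm ξ γ hγ _).2 rfl, fun ξ γ hγ => ?_⟩
    have := h γ hγ 1 hUe (γ.toEquiv.symm ξ)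
    rwa [Equiv.apply_symm_apply] at this

/-- The monodromy is transported by the diffeomorphisms if and only if the fundamental solution
satisfies the equations of variation. -/
theorem sphereMonodromy_eq_iff (hU : IsOpen U) (hUc : IsPreconnected U)
    (hA : ∀ i j, JointC1On (fun ξ γ => A ξ γ i j) U)
    (hA0 : ∀ γ ∈ U, ∀ i j, contourIntegral (fun ξ => A ξ γ i j) = 0)
    (hY : IsFundamentalSolution U A Y) (hYinf : ∀ γ ∈ U, Y ∞ γ = 1) :
    (∀ γ ∈ U, ∀ δ ∈ U, ∀ η,
      sphereMonodromy Y γ (γ.toEquiv η) = sphereMonodromy Y δ (δ.toEquiv η)) ↔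
    ∀ u ∈ lifts U, ∀ x : ℂ, ‖x‖ ≠ 1 → ∀ h, fderiv ℝ (fun u => Y x (ofLift u)) u h
      = -cauchyT (fun ξ => vel u h ξ • A ξ (ofLift u)) x * Y x (ofLift u) := by
  constructor
  · intro h u hu x hx k
    obtain ⟨V, L, c, huV, hVU, hV⟩ := exists_family hU hA hA0 hY hYinf hu
    have h1 := hV.variation_of_monodromy (fun v hv w hw a => by
      have h2 := h _ (hVU hv).2 _ (hVU hw).2 (Circle.exp a)
      rwa [ofLift_exp (hVU hv).1, ofLift_exp (hVU hw).1] at h2) huV k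
    rcases hx.lt_or_gt with hx1 | hx1
    · exact h1.1 x (by simpa using hx1)
    · have hx0 : x ≠ 0 := norm_pos_iff.1 (zero_lt_one.trans hx1)
      have h2 := h1.2 x⁻¹ (by
        rw [mem_ball_zero_iff, norm_inv]
        exact inv_lt_one_of_one_lt₀ hx1) (inv_ne_zero hx0)
      rwa [nearInfty_of_ne_zero (inv_ne_zero hx0), inv_inv] at h2
  · intro h γ hγ δ hδ
    -- By connectedness it is enough to compare neighbouring diffeomorphisms, which have neighbouring
    -- displacements.
    refine hUc.induction₂ (fun γ δ => ∀ η,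
      sphereMonodromy Y γ (γ.toEquiv η) = sphereMonodromy Y δ (δ.toEquiv η)) (fun γ hγ => ?_)
      (fun _ _ _ _ _ _ h1 h2 η => (h1 η).trans (h2 η)) (fun _ _ _ _ h1 η => (h1 η).symm) hγ hδ
    have hu := lift_mem_lifts hγ
    obtain ⟨V, L, c, huV, hVU, hV⟩ := exists_family hU hA hA0 hY hYinf hu
    obtain ⟨ε, hε, hεV⟩ := Metric.nhds_basis_closedBall.mem_iff.1 (hV.isOpen.mem_nhds huV)
    have hev := eventually_exists_lift_near hu.1 hε
    rw [ofLift_lift] at hev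
    filter_upwards [mem_nhdsWithin_of_mem_nhds hev] with δ hδ η
    obtain ⟨v, hv, hvε, rfl⟩ := hδ
    have hvV : v ∈ V := hεV (mem_closedBall_iff_norm.2 hvε)
    obtain ⟨a, rfl⟩ := Circle.exp_surjective η
    have h1 := hV.monodromy_of_variation
      (fun v hv k x hx => h v (hVU hv) x (by simpa using hx : ‖x‖ < 1).ne k)
      (fun v hv k w hw hw0 => by
        have h2 := h v (hVU hv) w⁻¹ (one_lt_norm_inv hw hw0).ne' k
        rwa [← nearInfty_of_ne_zero hw0] at h2) huV hvV a
    have h3 := ofLift_exp hu.1 a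
    rw [ofLift_lift] at h3
    rw [ofLift_exp hv, h3]
    rw [ofLift_lift] at h1
    exact h1

/-- A fundamental solution is `M`-invariant if and only if its logarithmic derivatives along the
complex vector fields `L_m` are Cauchy integrals. -/
theorem mInvariant_iff_omega (hU : IsOpen U) (hUc : IsPreconnected U) (hUe : (1 : CircleDiff) ∈ U)
    (hA : ∀ i j, JointC1On (fun ξ γ => A ξ γ i j) U)
    (hA0 : ∀ γ ∈ U, ∀ i j, contourIntegral (fun ξ => A ξ γ i j) = 0)
    (hY : IsFundamentalSolution U A Y) (hYinf : ∀ γ ∈ U, Y ∞ γ = 1) :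
    MInvariant U Y ↔ ∀ m : ℤ, ∀ x ∈ offCircle, ∀ γ ∈ U,
      Omega Y m x γ = -cauchyIntegral (fun ξ => (ξ : ℂ) ^ (m + 1) • A ξ γ) x := by
  rw [mInvariant_iff hU hUe hA hA0 hY, sphereMonodromy_eq_iff hU hUc hA hA0 hY hYinf]
  constructor
  · intro h m x hx γ hγ
    induction x using OnePoint.rec with
    | infty => rw [omega_infty hU hY hYinf hγ, cauchyIntegral_infty, neg_zero]
    | coe x =>
      have hx' := coe_mem_offCircle.1 hx
      have h1 := (forall_omega_eq_iff hU hA hY (lift_mem_lifts hγ) hx').2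
        (h _ (lift_mem_lifts hγ) x hx') m
      rwa [ofLift_lift] at h1
  · intro h u hu x hx
    exact (forall_omega_eq_iff hU hA hY hu hx).1 fun m => h m x (coe_mem_offCircle.2 hx) _ hu.2

/-! ### Expansions at the origin and at infinity -/

theorem hasSum_cauchyIntegral_zpow_smul (hU : IsOpen U)
    (hA : ∀ i j, JointC1On (fun ξ γ => A ξ γ i j) U) {γ : CircleDiff} (hγ : γ ∈ U) (m : ℤ) {x : ℂ}
    (hx : ‖x‖ < 1) : HasSum (fun n : ℕ => x ^ n • coeffB A (m - n) γ)
      (-cauchyIntegral (fun ξ => (ξ : ℂ) ^ (m + 1) • A ξ γ) x) := by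
  obtain ⟨L, hL⟩ := exists_boundedLipschitz hU hA hγ
  have hc := continuous_zpow_smul hL.continuous (m + 1)
  have h1 := (hasSum_cauchyT hc hx).neg
  rw [cauchyIntegral_coe hc hx.ne]
  have e : ∀ n : ℕ, coeffB A (m - n) γ
      = -circleMean fun ξ : Circle => (ξ : ℂ) ^ (-n : ℤ) • (ξ : ℂ) ^ (m + 1) • A ξ γ := fun n => by
    rw [coeffB_eq hL.continuous]
    simp only [smul_smul, ← zpow_add₀ (Circle.coe_ne_zero _)]
    rw [show (-n : ℤ) + (m + 1) = m - n + 1 by ring]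
  simp only [e, smul_neg]
  exact h1

theorem hasSum_cauchyIntegral_zpow_smul_of_one_lt (hU : IsOpen U)
    (hA : ∀ i j, JointC1On (fun ξ γ => A ξ γ i j) U) {γ : CircleDiff} (hγ : γ ∈ U) (m : ℤ) {x : ℂ}
    (hx : 1 < ‖x‖) : HasSum (fun n : ℕ => -((x ^ (n + 1))⁻¹ • coeffB A (m + (n + 1)) γ))
      (-cauchyIntegral (fun ξ => (ξ : ℂ) ^ (m + 1) • A ξ γ) x) := by
  obtain ⟨L, hL⟩ := exists_boundedLipschitz hU hA hγ
  have hc := continuous_zpow_smul hL.continuous (m + 1)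
  have h1 := (hasSum_cauchyT_of_one_lt hc hx).neg
  rw [cauchyIntegral_coe hc hx.ne']
  have e : ∀ n : ℕ, coeffB A (m + (n + 1)) γ
      = -circleMean fun ξ : Circle => (ξ : ℂ) ^ (n + 1 : ℤ) • (ξ : ℂ) ^ (m + 1) • A ξ γ := fun n => by
    rw [coeffB_eq hL.continuous]
    simp only [smul_smul, ← zpow_add₀ (Circle.coe_ne_zero _)]
    rw [show (n + 1 : ℤ) + (m + 1) = m + (n + 1) + 1 by ring]
  simp only [e, smul_neg, neg_neg]
  simp only [neg_neg] at h1
  exact h1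

end Matrices

end UnivSchlesinger

end

open UnivSchlesinger in
theorem mainTheorem3 (N : ℕ) (U : Set CircleDiff) (hUopen : IsOpen U) (hUconn : IsConnected U)
    (hUe : (1 : CircleDiff) ∈ U)
    (A : Circle → CircleDiff → Matrix (Fin N) (Fin N) ℂ)
    (hA : ∀ i j, CircleDiff.JointC1On (fun ξ γ => A ξ γ i j) U)
    (hA0 : ∀ γ ∈ U, ∀ i j, contourIntegral (fun ξ => A ξ γ i j) = 0)
    (Y : OnePoint ℂ → CircleDiff → Matrix (Fin N) (Fin N) ℂ)
    (hY : IsFundamentalSolution U A Y)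
    (hYinf : ∀ γ ∈ U, Y OnePoint.infty γ = 1) :
    (MInvariant U Y ↔
      ∀ m : ℤ, ∀ x ∈ offCircle, ∀ γ ∈ U,
        Omega Y m x γ = -cauchyIntegral (fun ξ => (ξ : ℂ) ^ (m + 1) • A ξ γ) x) ∧
    (∀ m : ℤ, ∀ γ ∈ U,
      (∀ x ∈ offCircle,
        Omega Y m x γ = -cauchyIntegral (fun ξ => (ξ : ℂ) ^ (m + 1) • A ξ γ) x) ↔
      ((∀ x : ℂ, 1 < ‖x‖ →
          HasSum (fun n : ℕ => -((x ^ (n + 1))⁻¹ • coeffB A (m + (n + 1)) γ)) (Omega Y m x γ)) ∧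
        (∀ x : ℂ, ‖x‖ < 1 →
          HasSum (fun n : ℕ => x ^ n • coeffB A (m - n) γ) (Omega Y m x γ)))) ∧
    (∀ γ ∈ U,
      (∀ x : ℂ, 1 < ‖x‖ →
        HasSum (fun n : ℕ => (x ^ (n + 1))⁻¹ • coeffB A n γ) (cauchyIntegral (fun ξ => A ξ γ) x)) ∧
      (∀ x : ℂ, ‖x‖ < 1 →
        HasSum (fun n : ℕ => -(x ^ n • coeffB A (-(n + 1)) γ))
          (cauchyIntegral (fun ξ => A ξ γ) x))) := by
  refine ⟨mInvariant_iff_omega hUopen hUconn.isPreconnected hUe hA hA0 hY hYinf,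
    fun m γ hγ => ⟨fun h => ⟨fun x hx => ?_, fun x hx => ?_⟩, fun h x hx => ?_⟩,
    fun γ hγ => ⟨fun x hx => ?_, fun x hx => ?_⟩⟩
  · rw [h x (coe_mem_offCircle.2 hx.ne')]
    exact hasSum_cauchyIntegral_zpow_smul_of_one_lt hUopen hA hγ m hx
  · rw [h x (coe_mem_offCircle.2 hx.ne)]
    exact hasSum_cauchyIntegral_zpow_smul hUopen hA hγ m hx
  · induction x using OnePoint.rec with
    | infty => rw [omega_infty hUopen hY hYinf hγ, cauchyIntegral_infty, neg_zero]
    | coe x =>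
      rcases (coe_mem_offCircle.1 hx).lt_or_gt with hx1 | hx1
      · exact (h.2 x hx1).unique (hasSum_cauchyIntegral_zpow_smul hUopen hA hγ m hx1)
      · exact (h.1 x hx1).unique (hasSum_cauchyIntegral_zpow_smul_of_one_lt hUopen hA hγ m hx1)
  · have h1 := (hasSum_cauchyIntegral_zpow_smul_of_one_lt hUopen hA hγ (-1) hx).neg
    simpa using h1
  · have h1 := (hasSum_cauchyIntegral_zpow_smul hUopen hA hγ (-1) hx).neg
    have e : ∀ n : ℕ, (-1 : ℤ) - n = -(n + 1) := fun n => by ring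
    simpa [e] using h1
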